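/- Let $\mathbb K$ be a field of characteristic zero. A bihom-associative algebra $(A,\mu,\alpha,\beta)$ is a $\mathbb K$-vector space $A$ with a bilinear map $\mu: A\times A\to A$ and two commuting linear maps $\alpha,\beta:A\to A$ such that $\alpha\mu(a,b)=\mu(\alpha a,\alpha b)$, $\beta\mu(a,b)=\mu(\beta a,\beta b)$ and $\mu(\alpha a,\mu(b,c))=\mu(\mu(a,b),\beta c)$ for all $a,b,c\in A$. For $n\ge 1$ let $C^n=C^n_{\mathrm{Hoch}}(A,A)$ be the space of multilinear maps $f:A^{n}\to A$ with $\alpha\circ f=f\circ\alpha^{\otimes n}$ and $\beta\circ f=f\circ\beta^{\otimes n}$, put $\deg f=n$ and $|f|=n-1$ for $f \in C^n$, let $C^\bullet=\bigoplus_{n\ge1}C^n$, and let $\delta_{\mathrm{Hoch}}:C^n\to C^{n+1}$ be $$(\delta_{\mathrm{Hoch}} f)(a_1,\dots,a_{n+1})=\mu(\alpha^{n-1}a_1,f(a_2,\dots,a_{n+1}))+\sum_{i=1}^n(-1)^i f(\alpha a_1,\dots,\alpha a_{i-1},\mu(a_i,a_{i+1}),\beta a_{i+2},\dots,\beta a_{n+1})+(-1)^{n+1}\mu(f(a_1,\dots,a_n),\beta^{n-1}a_{n+1}).$$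 The bi-twisted endomorphism operad is the non-symmetric operad $\mathcal O(n)=C^n$ ($n\ge1$) with identity $\mathrm{id}\in C^1$ and partial compositions, for $f\in C^m$, $g\in C^n$, $1\le i\le m$, $$(f\circ_i g)(a_1,\dots,a_{m+n-1})=f(\alpha^{n-1}a_1,\dots,\alpha^{n-1}a_{i-1},g(a_i,\dots,a_{i+n-1}),\beta^{n-1}a_{i+n},\dots,\beta^{n-1}a_{m+n-1}).$$ Put $\gamma(f;g_1,\dots,g_k)=(\cdots((f\circ_k g_k)\circ_{k-1}g_{k-1})\cdots)\circ_1 g_1$ for $f\in\mathcal O(k)$, and $$\{f\}\{g_1,\dots,g_n\}=\sum(-1)^{\epsilon}\,\gamma(f;\mathrm{id},\dots,\mathrm{id},g_1,\mathrm{id},\dots,\mathrm{id},g_n,\mathrm{id},\dots,\mathrm{id}),\qquad \epsilon=\sum_{p=1}^n|g_p|\,i_p,$$ where the sum is over all substitutions of $g_1,\dots,g_n$ in this order and $i_p$ is the total number of inputs in front of $g_p$. Let $f\circ g=\{f\}\{g\}$, $[f,g]=f\circ g-(-1)^{|f||g|}g\circ f$, $f\cdot g=(-1)^{|f|+1}\{\mu\}\{f,g\}$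 and $d f=\mu\circ f-(-1)^{|f|}f\circ\mu$. **Theorem.** Let $(A,\mu,\alpha,\beta)$ be a bihom-associative algebra over $\mathbb K$. 1. $\mu\circ\mu=0$, i.e. $\mu\in C^2$ is a multiplication on the bi-twisted endomorphism operad. 2. $d f=(-1)^{|f|}\,\delta_{\mathrm{Hoch}}f$ for every homogeneous $f$, and $(\delta_{\mathrm{Hoch}})^2=0$. 3. The braces, the dot product and $d$ make $C^\bullet$ a homotopy $G$-algebra. 4. The dot product and the bracket of cocycles induce well-defined operations on the cohomology $H^\bullet_{\mathrm{Hoch}}(A,A)=\bigoplus_{n\ge1}H^n$ of $(C^\bullet,\delta_{\mathrm{Hoch}})$, and these make it a Gerstenhaber algebra. Here a *homotopy $G$-algebra* is a graded vector space $V$ (with $|x|=\deg x-1$) with multilinear braces $x\{x_1,\dots,x_n\}$ of degree $-n$ ($n\ge0$), a bilinear product $\cdot$ of degree $0$ and a linear map $d$ of degree $1$ such that $x\{\}=x$, such that $(V,\cdot,d)$ is a differential graded associative algebra ($\cdot$ is associative, $d^2=0$, $d(x\cdot y)=dx\cdot y+(-1)^{\deg x}x\cdot dy$), and such that for homogeneous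 elements $$x\{x_1,\dots,x_m\}\{y_1,\dots,y_n\}=\sum_{0\le i_1\le j_1\le\dots\le i_m\le j_m\le n}(-1)^{\sum_p|x_p|\sum_{q\le i_p}|y_q|}\,x\{y_1,\dots,y_{i_1},x_1\{y_{i_1+1},\dots,y_{j_1}\},y_{j_1+1},\dots,x_m\{y_{i_m+1},\dots,y_{j_m}\},y_{j_m+1},\dots,y_n\},$$ $$(x_1\cdot x_2)\{y_1,\dots,y_n\}=\sum_{k=0}^n(-1)^{\deg x_2\sum_{p\le k}|y_p|}\,x_1\{y_1,\dots,y_k\}\cdot x_2\{y_{k+1},\dots,y_n\},$$ and, for $n\ge0$, $$\begin{aligned}&d(x\{y_1,\dots,y_{n+1}\})-(dx)\{y_1,\dots,y_{n+1}\}-(-1)^{|x|}\sum_{i=1}^{n+1}(-1)^{|y_1|+\dots+|y_{i-1}|}x\{y_1,\dots,dy_i,\dots,y_{n+1}\}\\&=(-1)^{(|x|+1)|y_1|}\,y_1\cdot x\{y_2,\dots,y_{n+1}\}+(-1)^{|x|+1}\sum_{i=1}^{n}(-1)^{|y_1|+\dots+|y_i|}x\{y_1,\dots,y_i\cdot y_{i+1},\dots,y_{n+1}\}\\&\quad+(-1)^{|x|+|y_1|+\dots+|y_n|}\,x\{y_1,\dots,y_n\}\cdot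 y_{n+1}.\end{aligned}$$ A *Gerstenhaber algebra* is a graded vector space with an associative bilinear product of degree $0$ satisfying $a\cdot b=(-1)^{\deg a\deg b}\,b\cdot a$ and a bilinear bracket of degree $-1$ which is a graded Lie bracket with respect to $|a|=\deg a-1$, such that $[a,b\cdot c]=[a,b]\cdot c+(-1)^{|a|(|b|+1)}\,b\cdot[a,c]$ for homogeneous $a,b,c$. -/

import Mathlib

open scoped DirectSum

set_option maxSynthPendingDepth 3

/-! ### Graded vector spaces -/

/-- The grading of `⨁ p, G p` in which the summand `G p` sits in degree `p + 1`
(so there is nothing in degrees `≤ 0`). -/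
def succDegree (K : Type*) [Field K] (G : ℕ → Type*) [∀ p, AddCommGroup (G p)]
    [∀ p, Module K (G p)] (n : ℤ) : Submodule K (⨁ p, G p) :=
  ⨆ (p : ℕ) (_ : (p : ℤ) + 1 = n), LinearMap.range (DirectSum.lof K ℕ G p)

/-! ### Gerstenhaber algebras -/

/-- A Gerstenhaber algebra structure on the graded vector space `V = ⨁ 𝒱 n`: a graded commutative
associative product of degree `0`, and a bracket of degree `-1` which is a graded Lie bracket
for the shifted degree `|a| = deg a - 1`, subject to the graded Leibniz rule. -/
structure GerstenhaberAlgebra (K : Type*) [Field K] {V : Type*} [AddCommGroup V] [Module K V]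
    (𝒱 : ℤ → Submodule K V) where
  mul : V →ₗ[K] V →ₗ[K] V
  bracket : V →ₗ[K] V →ₗ[K] V
  isInternal : DirectSum.IsInternal 𝒱
  mul_mem : ∀ {i j : ℤ} {a b : V}, a ∈ 𝒱 i → b ∈ 𝒱 j → mul a b ∈ 𝒱 (i + j)
  mul_assoc : ∀ a b c : V, mul (mul a b) c = mul a (mul b c)
  mul_comm : ∀ {i j : ℤ} {a b : V}, a ∈ 𝒱 i → b ∈ 𝒱 j →
    mul a b = (i * j).negOnePow • mul b a
  bracket_mem : ∀ {i j : ℤ} {a b : V}, a ∈ 𝒱 i → b ∈ 𝒱 j → bracket a b ∈ 𝒱 (i + j - 1)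
  bracket_skew : ∀ {i j : ℤ} {a b : V}, a ∈ 𝒱 i → b ∈ 𝒱 j →
    bracket a b = -(((i - 1) * (j - 1)).negOnePow • bracket b a)
  jacobi : ∀ {i j k : ℤ} {a b c : V}, a ∈ 𝒱 i → b ∈ 𝒱 j → c ∈ 𝒱 k →
    bracket a (bracket b c) =
      bracket (bracket a b) c + ((i - 1) * (j - 1)).negOnePow • bracket b (bracket a c)
  leibniz : ∀ {i j k : ℤ} {a b c : V}, a ∈ 𝒱 i → b ∈ 𝒱 j → c ∈ 𝒱 k →
    bracket a (mul b c) = mul (bracket a b) c + ((i - 1) * j).negOnePow • mul b (bracket a c)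

/-! ### Brace algebras and homotopy G-algebras -/

/-- The multibrace `x{y₁, …, yₙ}` with its arguments given as a list. -/
def braceList {K : Type*} [Field K] {V : Type*} [AddCommGroup V] [Module K V]
    (br : ∀ n : ℕ, V →ₗ[K] MultilinearMap K (fun _ : Fin n => V) V) (x : V) (ys : List V) : V :=
  br ys.length x ys.get

/-- For a list `(x₁, i₁, j₁), …, (xₘ, iₘ, jₘ)` and `s ≤ i₁ ≤ j₁ ≤ i₂ ≤ ⋯ ≤ jₘ ≤ n`, the list
`y_{s+1}, …, y_{i₁}, x₁{y_{i₁+1}, …, y_{j₁}}, y_{j₁+1}, …, xₘ{y_{iₘ+1}, …, y_{jₘ}}, y_{jₘ+1}, …, yₙ`.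
-/
def nestedArgs {K : Type*} [Field K] {V : Type*} [AddCommGroup V] [Module K V]
    (br : ∀ n : ℕ, V →ₗ[K] MultilinearMap K (fun _ : Fin n => V) V) (ys : List V) :
    ℕ → List (V × ℕ × ℕ) → List V
  | s, [] => ys.drop s
  | s, (x, i, j) :: t =>
      (ys.take i).drop s ++ braceList br x ((ys.take j).drop i) :: nestedArgs br ys j t

/-- The pairs of sequences `0 ≤ i₁ ≤ j₁ ≤ i₂ ≤ j₂ ≤ ⋯ ≤ iₘ ≤ jₘ ≤ n`. -/
def nestingIndices (m n : ℕ) : Finset ((Fin m → Fin (n + 1)) × (Fin m → Fin (n + 1))) :=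
  {w | (∀ p, w.1 p ≤ w.2 p) ∧ ∀ p p', p < p' → w.2 p ≤ w.1 p'}

/-- A brace algebra structure on the graded vector space `V = ⨁ 𝒱 n`. In the signs,
`|x| = deg x - 1`; the degrees of the arguments `xs p`, `ys q` are `a p`, `b q`. -/
structure BraceAlgebra (K : Type*) [Field K] {V : Type*} [AddCommGroup V] [Module K V]
    (𝒱 : ℤ → Submodule K V) where
  brace : ∀ n : ℕ, V →ₗ[K] MultilinearMap K (fun _ : Fin n => V) V
  isInternal : DirectSum.IsInternal 𝒱
  /-- the `n`-ary brace has degree `-n` -/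
  brace_mem : ∀ {n : ℕ} {i : ℤ} {b : Fin n → ℤ} {x : V} {ys : Fin n → V}, x ∈ 𝒱 i →
    (∀ q, ys q ∈ 𝒱 (b q)) → brace n x ys ∈ 𝒱 (i + (∑ q, b q) - n)
  /-- `x{} = x` -/
  brace_zero : ∀ (x : V) (ys : Fin 0 → V), brace 0 x ys = x
  /-- the higher pre-Lie identities for `x{x₁, …, xₘ}{y₁, …, yₙ}` -/
  brace_brace : ∀ {m n : ℕ} {c : ℤ} {a : Fin m → ℤ} {b : Fin n → ℤ} {x : V} {xs : Fin m → V}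
    {ys : Fin n → V}, x ∈ 𝒱 c → (∀ p, xs p ∈ 𝒱 (a p)) → (∀ q, ys q ∈ 𝒱 (b q)) →
    brace n (brace m x xs) ys =
      ∑ w ∈ nestingIndices m n,
        (∑ p, (a p - 1) * ∑ q ∈ {q : Fin n | (q : ℕ) < w.1 p}, (b q - 1)).negOnePow •
          braceList brace x (nestedArgs brace (List.ofFn ys) 0
            (List.ofFn fun p => (xs p, (w.1 p : ℕ), (w.2 p : ℕ))))

/-- A homotopy G-algebra structure on the graded vector space `V = ⨁ 𝒱 n`: a brace algebra with a
product of degree `0` and a differential of degree `1` which make it a differential graded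
associative algebra, both compatible with the braces. In the signs, `|x| = deg x - 1`. -/
structure HomotopyGAlgebra (K : Type*) [Field K] {V : Type*} [AddCommGroup V] [Module K V]
    (𝒱 : ℤ → Submodule K V) extends BraceAlgebra K 𝒱 where
  dot : V →ₗ[K] V →ₗ[K] V
  d : V →ₗ[K] V
  dot_mem : ∀ {i j : ℤ} {x y : V}, x ∈ 𝒱 i → y ∈ 𝒱 j → dot x y ∈ 𝒱 (i + j)
  dot_assoc : ∀ x y z : V, dot (dot x y) z = dot x (dot y z)
  d_mem : ∀ {i : ℤ} {x : V}, x ∈ 𝒱 i → d x ∈ 𝒱 (i + 1)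
  d_d : ∀ x : V, d (d x) = 0
  d_dot : ∀ {i : ℤ} {x : V} (y : V), x ∈ 𝒱 i →
    d (dot x y) = dot (d x) y + i.negOnePow • dot x (d y)
  /-- `(x₁ · x₂){y₁, …, yₙ} = ∑ₖ ± x₁{y₁, …, yₖ} · x₂{yₖ₊₁, …, yₙ}` -/
  dot_brace : ∀ {n : ℕ} {i j : ℤ} {b : Fin n → ℤ} {x₁ x₂ : V} {ys : Fin n → V},
    x₁ ∈ 𝒱 i → x₂ ∈ 𝒱 j → (∀ q, ys q ∈ 𝒱 (b q)) →
    brace n (dot x₁ x₂) ys =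
      ∑ k ∈ Finset.range (n + 1),
        (j * ∑ q ∈ {q : Fin n | (q : ℕ) < k}, (b q - 1)).negOnePow •
          dot (braceList brace x₁ ((List.ofFn ys).take k))
            (braceList brace x₂ ((List.ofFn ys).drop k))
  /-- `d(x{y₁, …, yₙ₊₁}) - (d x){y₁, …, yₙ₊₁} - (-1)^|x| ∑ᵢ ± x{y₁, …, d yᵢ, …, yₙ₊₁}
  = ± y₁ · x{y₂, …, yₙ₊₁} + ∑ᵢ ± x{y₁, …, yᵢ · yᵢ₊₁, …, yₙ₊₁} ± x{y₁, …, yₙ} · yₙ₊₁` -/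
  d_brace : ∀ {n : ℕ} {i : ℤ} {b : Fin (n + 1) → ℤ} {x : V} {ys : Fin (n + 1) → V},
    x ∈ 𝒱 i → (∀ q, ys q ∈ 𝒱 (b q)) →
    d (brace (n + 1) x ys) - brace (n + 1) (d x) ys
        - (i - 1).negOnePow • ∑ r : Fin (n + 1),
            (∑ q : Fin (n + 1) with q < r, (b q - 1)).negOnePow •
              brace (n + 1) x (Function.update ys r (d (ys r))) =
      (i * (b 0 - 1)).negOnePow • dot (ys 0) (brace n x (Fin.tail ys))
        + i.negOnePow • ∑ r : Fin n,
            (∑ q : Fin (n + 1) with q ≤ r.castSucc, (b q - 1)).negOnePow •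
              brace n x (Fin.contractNth r.castSucc (fun u v => dot u v) ys)
        + ((i - 1) + ∑ q : Fin n, (b q.castSucc - 1)).negOnePow •
            dot (brace n x (Fin.init ys)) (ys (Fin.last n))

/-! ### Non-symmetric operads -/

/-- A non-symmetric operad (without operations of arity `0`) in vector spaces, by partial
compositions. `Op p` is the space of operations with `p + 1` inputs, so that `|f| = p` for
`f ∈ Op p`, and inputs are numbered from `0`. Equations between elements of `Op p` and `Op p'` with
`p = p'` are stated in the direct sum `⨁ p, Op p`. -/
structure NSOperad (K : Type*) [Field K] where
  Op : ℕ → Type*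
  [addCommGroup : ∀ p, AddCommGroup (Op p)]
  [module : ∀ p, Module K (Op p)]
  comp : ∀ {p q : ℕ}, Fin (p + 1) → Op p →ₗ[K] Op q →ₗ[K] Op (p + q)
  one : Op 0
  comp_seq : ∀ {p q r : ℕ} (f : Op p) (g : Op q) (h : Op r) (i : Fin (p + 1)) (j : Fin (q + 1)),
    DirectSum.lof K ℕ Op (p + q + r) (comp ⟨i + j, by omega⟩ (comp i f g) h) =
      DirectSum.lof K ℕ Op (p + (q + r)) (comp i f (comp j g h))
  comp_par : ∀ {p q r : ℕ} (f : Op p) (g : Op q) (h : Op r) (i j : Fin (p + 1)), i < j →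
    DirectSum.lof K ℕ Op (p + q + r) (comp ⟨j + q, by omega⟩ (comp i f g) h) =
      DirectSum.lof K ℕ Op (p + r + q) (comp ⟨i, by omega⟩ (comp j f h) g)
  comp_one : ∀ {p : ℕ} (f : Op p) (i : Fin (p + 1)), comp i f one = f
  one_comp : ∀ {p : ℕ} (f : Op p),
    DirectSum.lof K ℕ Op (0 + p) (comp 0 one f) = DirectSum.lof K ℕ Op p f

attribute [instance] NSOperad.addCommGroup NSOperad.module

namespace NSOperad

variable {K : Type*} [Field K] (P : NSOperad K)

/-- The graded vector space `⨁ p, Op p` of an operad; `Op p` has degree `p + 1`. -/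
abbrev Total : Type _ := ⨁ p, P.Op p

/-- The inclusion of the operations with `p + 1` inputs. -/
abbrev incl (p : ℕ) : P.Op p →ₗ[K] P.Total := DirectSum.lof K ℕ P.Op p

/-- The degree decomposition of `⨁ p, Op p`. -/
abbrev degree : ℤ → Submodule K P.Total := succDegree K P.Op

/-- The partial composition at input `i`, extended bilinearly to `⨁ p, Op p`
(it is `0` on those `f` which have no input `i`). -/
noncomputable def pcomp (i : ℕ) : P.Total →ₗ[K] P.Total →ₗ[K] P.Total :=
  DirectSum.toModule K ℕ _ fun p => LinearMap.flip <|
    DirectSum.toModule K ℕ _ fun q => LinearMap.flip <|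
      if h : i < p + 1 then (P.comp (⟨i, h⟩ : Fin (p + 1))).compr₂ (P.incl (p + q)) else 0

/-- `(⋯((f ∘ₖ gₖ) ∘ₖ₋₁ gₖ₋₁) ⋯) ∘ₛ gₛ` for the list `gₛ, …, gₖ`. -/
noncomputable def gammaFrom (f : P.Total) : ℕ → List P.Total → P.Total
  | _, [] => f
  | s, g :: gs => P.pcomp s (gammaFrom f (s + 1) gs) g

/-- The full composition `γ(f; g₁, …, gₖ)`. -/
noncomputable def gamma (f : P.Total) (gs : List P.Total) : P.Total := P.gammaFrom f 0 gs

open Classical in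
/-- The brace `{x}{y₁, …, yₙ}`. For homogeneous `x ∈ Op p` and `yⱼ ∈ Op (q j)` it is the sum of
`(-1)^ε γ(x; id, …, id, y₁, id, …, id, yₙ, id, …, id)` over all positions `k 1 < ⋯ < k n` of the
`yⱼ` among the inputs of `x`, where `ε = ∑ⱼ |yⱼ| iⱼ` and `iⱼ = k j + ∑_{l < j} |y_l|` is the number
of inputs in front of `yⱼ`; in general it is extended multilinearly. -/
noncomputable def brace {n : ℕ} (x : P.Total) (y : Fin n → P.Total) : P.Total :=
  ∑ p ∈ DFinsupp.support x, ∑ q ∈ Fintype.piFinset fun j => DFinsupp.support (y j),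
    ∑ k : Fin n → Fin (p + 1) with StrictMono k,
      (-1 : K) ^ (∑ j, q j * ((k j : ℕ) + ∑ l with l < j, q l)) •
        P.gamma (P.incl p (x p)) (List.ofFn
          (Function.extend k (fun j => P.incl (q j) (y j (q j))) fun _ => P.incl 0 P.one))

open Classical in
/-- The bracket `[f, g] = f ∘ g - (-1)^(|f||g|) g ∘ f`, where `f ∘ g = {f}{g}`. -/
noncomputable def bracket (f g : P.Total) : P.Total :=
  ∑ p ∈ DFinsupp.support f, ∑ q ∈ DFinsupp.support g,
    (P.brace (P.incl p (f p)) ![P.incl q (g q)] -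
      (-1 : K) ^ (p * q) • P.brace (P.incl q (g q)) ![P.incl p (f p)])

/-- A multiplication on an operad: a binary operation `m` with `m ∘ m = 0`. -/
def IsMultiplication (m : P.Op 1) : Prop := P.brace (P.incl 1 m) ![P.incl 1 m] = 0

open Classical in
/-- The dot product `f · g = (-1)^(|f| + 1) {m}{f, g}`. -/
noncomputable def dot (m : P.Op 1) (f g : P.Total) : P.Total :=
  ∑ p ∈ DFinsupp.support f, (-1 : K) ^ (p + 1) • P.brace (P.incl 1 m) ![P.incl p (f p), g]

open Classical in
/-- The differential `d f = m ∘ f - (-1)^|f| f ∘ m`. -/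
noncomputable def diff (m : P.Op 1) (f : P.Total) : P.Total :=
  ∑ p ∈ DFinsupp.support f, (P.brace (P.incl 1 m) ![P.incl p (f p)] -
    (-1 : K) ^ p • P.brace (P.incl p (f p)) ![P.incl 1 m])

end NSOperad

/-! ### The bi-twisted endomorphism operad -/

section BiTwisted

variable {K : Type*} [Field K] {A : Type*} [AddCommGroup A] [Module K A]

/-- The multilinear maps `f : A^n → A` with `α ∘ f = f ∘ α^{⊗ n}` and `β ∘ f = f ∘ β^{⊗ n}`. -/
def biTwistedCochains (α β : A →ₗ[K] A) (n : ℕ) :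
    Submodule K (MultilinearMap K (fun _ : Fin n => A) A) where
  carrier := {f | (∀ a, α (f a) = f fun t => α (a t)) ∧ ∀ a, β (f a) = f fun t => β (a t)}
  add_mem' := by
    rintro f g ⟨hf, hf'⟩ ⟨hg, hg'⟩
    exact ⟨fun a => by simp [hf, hg], fun a => by simp [hf', hg']⟩
  zero_mem' := ⟨fun a => by simp, fun a => by simp⟩
  smul_mem' := by
    rintro c f ⟨hf, hf'⟩
    exact ⟨fun a => by simp [hf], fun a => by simp [hf']⟩

/-- The arguments of `f` in `f ∘ᵢ g`:
`α^q a₀, …, α^q a_{i-1}, g(a_i, …, a_{i+q}), β^q a_{i+q+1}, …, β^q a_{p+q}`. -/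
def biTwistedArgs (α β : A →ₗ[K] A) {p q : ℕ} (i : Fin (p + 1))
    (g : (Fin (q + 1) → A) → A) (a : Fin (p + q + 1) → A) (k : Fin (p + 1)) : A :=
  if k < i then (α ^ q) (a ⟨k, by omega⟩)
  else if k = i then g fun t => a ⟨i + t, by omega⟩
  else (β ^ q) (a ⟨k + q, by omega⟩)

theorem biTwistedArgs_update (α β : A →ₗ[K] A) {p q : ℕ} (i : Fin (p + 1))
    (g : MultilinearMap K (fun _ : Fin (q + 1) => A) A) [DecidableEq (Fin (p + q + 1))]
    (a : Fin (p + q + 1) → A) (s : Fin (p + q + 1)) :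
    ∃ (k : Fin (p + 1)) (L : A →ₗ[K] A), ∀ x,
      biTwistedArgs α β i g (Function.update a s x) =
        Function.update (biTwistedArgs α β i g a) k (L x) := by
  have hs := s.2
  by_cases h1 : (s : ℕ) < i
  · refine ⟨⟨s, by omega⟩, α ^ q, fun x => funext fun k => ?_⟩
    by_cases hk : k = ⟨s, by omega⟩
    · subst hk
      simp [biTwistedArgs, Fin.lt_def, h1]
    · have hk' : (k : ℕ) ≠ s := fun h => hk (Fin.ext h)
      rw [Function.update_of_ne hk]
      unfold biTwistedArgs
      split_ifs with h2 h3
      · rw [Function.update_of_ne (fun h => hk' (Fin.ext_iff.1 h))]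
      · congr 1; funext t
        rw [Function.update_of_ne (fun h => by have := Fin.ext_iff.1 h; simp at this; omega)]
      · rw [Function.update_of_ne
          (fun h => by have := Fin.ext_iff.1 h; rw [Fin.lt_def] at h2; simp at this; omega)]
  by_cases h2 : (s : ℕ) ≤ i + q
  · obtain ⟨t, ht⟩ : ∃ t : Fin (q + 1), (s : ℕ) = i + t := ⟨⟨s - i, by omega⟩, by simp; omega⟩
    refine ⟨i, g.toLinearMap (fun t => a ⟨i + t, by omega⟩) t, fun x => funext fun k => ?_⟩
    by_cases hk : k = i
    · subst hk
      simp only [biTwistedArgs, lt_irrefl, if_false, if_true, Function.update_self,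
        MultilinearMap.toLinearMap_apply]
      congr 1; funext t'
      by_cases htt : t' = t
      · subst htt
        have : s = ⟨k + t', by omega⟩ := Fin.ext ht
        rw [this]; simp
      · rw [Function.update_of_ne htt, Function.update_of_ne]
        intro h
        apply htt
        have := Fin.ext_iff.1 h
        simp at this
        exact Fin.ext (by omega)
    · have hk' : (k : ℕ) ≠ i := fun h => hk (Fin.ext h)
      rw [Function.update_of_ne hk]
      unfold biTwistedArgs
      rw [if_neg hk, if_neg hk]
      split_ifs with h3
      · rw [Function.update_of_ne
          (fun h => by have := Fin.ext_iff.1 h; rw [Fin.lt_def] at h3; simp at this; omega)]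
      · rw [Function.update_of_ne
          (fun h => by have := Fin.ext_iff.1 h; rw [Fin.lt_def] at h3; simp at this; omega)]
  · refine ⟨⟨s - q, by omega⟩, β ^ q, fun x => funext fun k => ?_⟩
    by_cases hk : k = ⟨s - q, by omega⟩
    · subst hk
      have e : (⟨(s : ℕ) - q + q, by omega⟩ : Fin (p + q + 1)) = s := Fin.ext (by simp; omega)
      have h3 : ¬ ((s : ℕ) - q < i) := by omega
      have h4 : ¬ ((s : ℕ) - q = i) := by omega
      simp [biTwistedArgs, Fin.lt_def, Fin.ext_iff, h3, h4, e]
    · have hk' : (k : ℕ) ≠ s - q := fun h => hk (Fin.ext h)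
      rw [Function.update_of_ne hk]
      unfold biTwistedArgs
      split_ifs with h3 h4
      · rw [Function.update_of_ne
          (fun h => by have := Fin.ext_iff.1 h; rw [Fin.lt_def] at h3; simp at this; omega)]
      · congr 1; funext t
        rw [Function.update_of_ne (fun h => by have := Fin.ext_iff.1 h; simp at this; omega)]
      · rw [Function.update_of_ne (fun h => by have := Fin.ext_iff.1 h; simp at this; omega)]

/-- The partial composition `f ∘ᵢ g` of multilinear maps, twisted by `α` and `β`. -/
def biTwistedPartial (α β : A →ₗ[K] A) {p q : ℕ} (i : Fin (p + 1))
    (f : MultilinearMap K (fun _ : Fin (p + 1) => A) A)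
    (g : MultilinearMap K (fun _ : Fin (q + 1) => A) A) :
    MultilinearMap K (fun _ : Fin (p + q + 1) => A) A where
  toFun a := f (biTwistedArgs α β i g a)
  map_update_add' a s x y := by
    obtain ⟨k, L, h⟩ := biTwistedArgs_update α β i g a s
    simp only [h, map_add, MultilinearMap.map_update_add]
  map_update_smul' a s c x := by
    obtain ⟨k, L, h⟩ := biTwistedArgs_update α β i g a s
    simp only [h, map_smul, MultilinearMap.map_update_smul]

theorem biTwistedPartial_comm {α β : A →ₗ[K] A} {φ : A →ₗ[K] A} (hα : Commute φ α)
    (hβ : Commute φ β) {p q : ℕ} (i : Fin (p + 1))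
    {f : MultilinearMap K (fun _ : Fin (p + 1) => A) A}
    {g : MultilinearMap K (fun _ : Fin (q + 1) => A) A}
    (hf : ∀ a, φ (f a) = f fun t => φ (a t)) (hg : ∀ a, φ (g a) = g fun t => φ (a t)) (a) :
    φ (biTwistedPartial α β i f g a) = biTwistedPartial α β i f g fun t => φ (a t) := by
  show φ (f _) = f _
  rw [hf]
  congr 1; funext k
  have h1 (x) : φ ((α ^ q) x) = (α ^ q) (φ x) := LinearMap.congr_fun (hα.pow_right q).eq x
  have h2 (x) : φ ((β ^ q) x) = (β ^ q) (φ x) := LinearMap.congr_fun (hβ.pow_right q).eq x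
  unfold biTwistedArgs
  split_ifs
  · exact h1 _
  · exact hg _
  · exact h2 _

theorem biTwistedPartial_mem {α β : A →ₗ[K] A} (h : Commute α β) {p q : ℕ} (i : Fin (p + 1))
    {f : MultilinearMap K (fun _ : Fin (p + 1) => A) A}
    {g : MultilinearMap K (fun _ : Fin (q + 1) => A) A} (hf : f ∈ biTwistedCochains α β (p + 1))
    (hg : g ∈ biTwistedCochains α β (q + 1)) :
    biTwistedPartial α β i f g ∈ biTwistedCochains α β (p + q + 1) :=
  ⟨biTwistedPartial_comm (Commute.refl α) h i hf.1 hg.1,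
    biTwistedPartial_comm h.symm (Commute.refl β) i hf.2 hg.2⟩

theorem biTwistedArgs_eq_update (α β : A →ₗ[K] A) {p q : ℕ} (i : Fin (p + 1))
    (g g' : (Fin (q + 1) → A) → A) (a : Fin (p + q + 1) → A) :
    biTwistedArgs α β i g a =
      Function.update (biTwistedArgs α β i g' a) i (g fun t => a ⟨i + t, by omega⟩) := by
  funext k
  by_cases hk : k = i
  · subst hk; simp [biTwistedArgs]
  · rw [Function.update_of_ne hk]; simp [biTwistedArgs, hk]

/-- The partial composition `∘ᵢ` on the maps which commute with `α` and `β`. -/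
def biTwistedComp {α β : A →ₗ[K] A} (h : Commute α β) {p q : ℕ} (i : Fin (p + 1)) :
    biTwistedCochains α β (p + 1) →ₗ[K] biTwistedCochains α β (q + 1) →ₗ[K]
      biTwistedCochains α β (p + q + 1) :=
  LinearMap.mk₂ K (fun f g => ⟨biTwistedPartial α β i f g, biTwistedPartial_mem h i f.2 g.2⟩)
    (fun _ _ _ => rfl) (fun _ _ _ => rfl)
    (fun f g g' => by
      ext a
      have e := fun u : MultilinearMap K (fun _ : Fin (q + 1) => A) A =>
        biTwistedArgs_eq_update α β i u 0 a
      show f.1 (biTwistedArgs α β i (g.1 + g'.1 : MultilinearMap _ _ _) a) = f.1 _ + f.1 _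
      rw [e, e g.1, e g'.1]
      simp)
    (fun c f g => by
      ext a
      have e := fun u : MultilinearMap K (fun _ : Fin (q + 1) => A) A =>
        biTwistedArgs_eq_update α β i u 0 a
      show f.1 (biTwistedArgs α β i (c • g.1 : MultilinearMap _ _ _) a) = c • f.1 _
      rw [e, e g.1]
      simp)

theorem lof_biTwisted_ext {α β : A →ₗ[K] A} {m n : ℕ} (h : m = n)
    (f : biTwistedCochains α β (m + 1)) (g : biTwistedCochains α β (n + 1))
    (hfg : ∀ a : ℕ → A, f.1 (fun t => a t) = g.1 fun t => a t) :
    DirectSum.lof K ℕ (fun p => biTwistedCochains α β (p + 1)) m f =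
      DirectSum.lof K ℕ (fun p => biTwistedCochains α β (p + 1)) n g := by
  subst h
  congr 1
  ext a
  have e : (fun t : Fin (m + 1) => if ht : (t : ℕ) < m + 1 then a ⟨t, ht⟩ else 0) = a := by
    funext t
    rw [dif_pos t.2]
  have := hfg fun t => if ht : t < m + 1 then a ⟨t, ht⟩ else 0
  simp only [e] at this
  exact this

theorem biTwistedArgs_nat (α β : A →ₗ[K] A) {p q : ℕ} (i : Fin (p + 1))
    (g : (Fin (q + 1) → A) → A) (a : Fin (p + q + 1) → A) (k : ℕ) (hk : k < p + 1) :
    (k < i → biTwistedArgs α β i g a ⟨k, hk⟩ = (α ^ q) (a ⟨k, by omega⟩)) ∧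
      (k = i → biTwistedArgs α β i g a ⟨k, hk⟩ = g fun t => a ⟨i + t, by omega⟩) ∧
      (i < k → biTwistedArgs α β i g a ⟨k, hk⟩ = (β ^ q) (a ⟨k + q, by omega⟩)) := by
  refine ⟨fun h => ?_, fun h => ?_, fun h => ?_⟩
  · simp [biTwistedArgs, Fin.lt_def, h]
  · subst h; simp [biTwistedArgs]
  · have h1 : ¬ k < i := by omega
    have h2 : k ≠ i := by omega
    simp [biTwistedArgs, Fin.lt_def, Fin.ext_iff, h1, h2]

theorem biTwisted_pow_comm {φ : A →ₗ[K] A} {n : ℕ}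
    {f : MultilinearMap K (fun _ : Fin n => A) A} (hf : ∀ a, φ (f a) = f fun t => φ (a t))
    (r : ℕ) (a : Fin n → A) : (φ ^ r) (f a) = f fun t => (φ ^ r) (a t) := by
  induction r generalizing a with
  | zero => rfl
  | succ r ih =>
    have e (x : A) : (φ ^ (r + 1)) x = (φ ^ r) (φ x) := by rw [pow_succ]; rfl
    simp only [e, hf, ih]

/-- The bi-twisted endomorphism operad of `(A, α, β)`. -/
noncomputable def biTwistedEndOperad {α β : A →ₗ[K] A} (hαβ : Commute α β) : NSOperad K where
  Op p := biTwistedCochains α β (p + 1)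
  comp i := biTwistedComp hαβ i
  one := ⟨MultilinearMap.ofSubsingleton K A A (0 : Fin 1) LinearMap.id, fun a => rfl, fun a => rfl⟩
  comp_seq {p q r} f g h i j := by
    apply lof_biTwisted_ext (by omega)
    intro a
    show f.1 _ = f.1 _
    congr 1; funext k
    obtain ⟨k, hk⟩ := k
    have hi := i.2
    have hj := j.2
    rcases lt_trichotomy k i with hki | hki | hki
    · rw [(biTwistedArgs_nat α β i _ _ k hk).1 hki, (biTwistedArgs_nat α β i _ _ k hk).1 hki,
        (biTwistedArgs_nat α β _ _ _ k _).1 (by simp; omega), pow_add]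
      rfl
    · rw [(biTwistedArgs_nat α β i _ _ k hk).2.1 hki, (biTwistedArgs_nat α β i _ _ k hk).2.1 hki]
      show g.1 _ = g.1 _
      congr 1; funext t
      obtain ⟨t, ht⟩ := t
      rcases lt_trichotomy t j with htj | htj | htj
      · rw [(biTwistedArgs_nat α β _ _ _ (i + t) _).1 (by simp; omega),
          (biTwistedArgs_nat α β j _ _ t _).1 htj]
      · rw [(biTwistedArgs_nat α β _ _ _ (i + t) _).2.1 (by simp; omega),
          (biTwistedArgs_nat α β j _ _ t _).2.1 htj]
        simp only [add_assoc]
      · rw [(biTwistedArgs_nat α β _ _ _ (i + t) _).2.2 (by simp; omega),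
          (biTwistedArgs_nat α β j _ _ t _).2.2 htj]
        simp only [add_assoc]
    · rw [(biTwistedArgs_nat α β i _ _ k hk).2.2 hki, (biTwistedArgs_nat α β i _ _ k hk).2.2 hki,
        (biTwistedArgs_nat α β _ _ _ (k + q) _).2.2 (by simp; omega), pow_add]
      simp only [add_assoc]
      rfl
  comp_par {p q r} f g h i j hij := by
    apply lof_biTwisted_ext (by omega)
    intro a
    show f.1 _ = f.1 _
    congr 1; funext k
    obtain ⟨k, hk⟩ := k
    have hi := i.2
    have hj := j.2
    rw [Fin.lt_def] at hij
    have comm (s t : ℕ) (x : A) : (α ^ s) ((β ^ t) x) = (β ^ t) ((α ^ s) x) :=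
      LinearMap.congr_fun (hαβ.pow_pow s t).eq x
    have comm' (φ : A →ₗ[K] A) (s t : ℕ) (x : A) : (φ ^ s) ((φ ^ t) x) = (φ ^ t) ((φ ^ s) x) :=
      LinearMap.congr_fun ((Commute.refl φ).pow_pow s t).eq x
    rcases lt_trichotomy k i with hki | hki | hki
    · rw [(biTwistedArgs_nat α β i _ _ k hk).1 hki,
        (biTwistedArgs_nat α β _ _ _ k _).1 (by simp; omega),
        (biTwistedArgs_nat α β j _ _ k hk).1 (by omega),
        (biTwistedArgs_nat α β _ _ _ k _).1 (by simp; omega), comm']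
    · rw [(biTwistedArgs_nat α β i _ _ k hk).2.1 hki,
        (biTwistedArgs_nat α β j _ _ k hk).1 (by omega),
        (biTwistedArgs_nat α β _ _ _ k _).2.1 (by simp; omega), biTwisted_pow_comm g.2.1]
      show g.1 _ = g.1 _
      congr 1; funext t
      rw [(biTwistedArgs_nat α β _ _ _ (i + t) _).1 (by simp; omega)]
    · rw [(biTwistedArgs_nat α β i _ _ k hk).2.2 hki]
      rcases lt_trichotomy k j with hkj | hkj | hkj
      · rw [(biTwistedArgs_nat α β _ _ _ (k + q) _).1 (by simp; omega),
          (biTwistedArgs_nat α β j _ _ k hk).1 hkj,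
          (biTwistedArgs_nat α β _ _ _ k _).2.2 (by simp; omega), comm]
      · rw [(biTwistedArgs_nat α β _ _ _ (k + q) _).2.1 (by simp; omega),
          (biTwistedArgs_nat α β j _ _ k hk).2.1 hkj, biTwisted_pow_comm h.2.2]
        show h.1 _ = h.1 _
        congr 1; funext t
        rw [(biTwistedArgs_nat α β _ _ _ (j + t) _).2.2 (by simp; omega)]
        show (β ^ q) (a (j + q + t)) = (β ^ q) (a (j + t + q))
        rw [add_right_comm]
      · rw [(biTwistedArgs_nat α β _ _ _ (k + q) _).2.2 (by simp; omega),
          (biTwistedArgs_nat α β j _ _ k hk).2.2 hkj,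
          (biTwistedArgs_nat α β _ _ _ (k + r) _).2.2 (by simp; omega), comm']
        show (β ^ r) ((β ^ q) (a (k + q + r))) = (β ^ r) ((β ^ q) (a (k + r + q)))
        rw [add_right_comm]
  comp_one f i := by
    ext a
    show f.1 _ = f.1 _
    congr 1; funext k
    unfold biTwistedArgs
    split_ifs with h1 h2
    · rfl
    · subst h2; rfl
    · rfl
  one_comp {p} f := by
    apply lof_biTwisted_ext (by omega)
    intro a
    show biTwistedArgs α β (p := 0) 0 f.1 (fun t => a t) 0 = _
    simp [biTwistedArgs]

end BiTwisted

/-! ### Bihom-associative algebras and their Hochschild complex -/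

/-- A bihom-associative algebra structure `(μ, α, β)` on the vector space `A`. -/
structure BihomAssocAlgebra (K : Type*) [Field K] (A : Type*) [AddCommGroup A] [Module K A] where
  μ : A →ₗ[K] A →ₗ[K] A
  α : A →ₗ[K] A
  β : A →ₗ[K] A
  comm : Commute α β
  α_mul : ∀ a b, α (μ a b) = μ (α a) (α b)
  β_mul : ∀ a b, β (μ a b) = μ (β a) (β b)
  assoc : ∀ a b c, μ (α a) (μ b c) = μ (μ a b) (β c)

namespace BihomAssocAlgebra

variable {K : Type*} [Field K] {A : Type*} [AddCommGroup A] [Module K A]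
  (B : BihomAssocAlgebra K A)

/-- The `n`-th Hochschild cochain space `C^n(A, A)`. -/
abbrev Cochain (n : ℕ) : Submodule K (MultilinearMap K (fun _ : Fin n => A) A) :=
  biTwistedCochains B.α B.β n

/-- The bi-twisted endomorphism operad on the Hochschild cochains; `Op p = C^(p+1)(A, A)`. -/
noncomputable abbrev operad : NSOperad K := biTwistedEndOperad B.comm

/-- The multiplication `μ` as a multilinear map in two variables. -/
def mulMultilinear : MultilinearMap K (fun _ : Fin 2 => A) A where
  toFun a := B.μ (a 0) (a 1)
  map_update_add' a s x y := by fin_cases s <;> simp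
  map_update_smul' a s c x := by fin_cases s <;> simp

/-- The multiplication `μ` as a `2`-cochain. -/
def mulCochain : B.Cochain 2 :=
  ⟨B.mulMultilinear, fun _ => B.α_mul _ _, fun _ => B.β_mul _ _⟩

/-- `μ(α^p a₁, f(a₂, …, a_{p+2}))`. -/
def hochschildLeft {p : ℕ} (f : MultilinearMap K (fun _ : Fin (p + 1) => A) A) :
    MultilinearMap K (fun _ : Fin (p + 1 + 1) => A) A where
  toFun a := B.μ ((B.α ^ p) (a 0)) (f fun t => a t.succ)
  map_update_add' {inst} a s x y := by
    rw [Subsingleton.elim inst (instDecidableEqFin _)]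
    have h := fun u => Fin.tail_update_succ (α := fun _ => A) a u
    unfold Fin.tail at h
    refine Fin.cases ?_ (fun t => ?_) s
    · simp
    · simp [h, (Fin.succ_ne_zero t).symm]
  map_update_smul' {inst} a s c x := by
    rw [Subsingleton.elim inst (instDecidableEqFin _)]
    have h := fun u => Fin.tail_update_succ (α := fun _ => A) a u
    unfold Fin.tail at h
    refine Fin.cases ?_ (fun t => ?_) s
    · simp
    · simp [h, (Fin.succ_ne_zero t).symm]

/-- `μ(f(a₁, …, a_{p+1}), β^p a_{p+2})`. -/
def hochschildRight {p : ℕ} (f : MultilinearMap K (fun _ : Fin (p + 1) => A) A) :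
    MultilinearMap K (fun _ : Fin (p + 1 + 1) => A) A where
  toFun a := B.μ (f fun t => a t.castSucc) ((B.β ^ p) (a (Fin.last (p + 1))))
  map_update_add' {inst} a s x y := by
    rw [Subsingleton.elim inst (instDecidableEqFin _)]
    have h := fun u => Fin.init_update_castSucc (α := fun _ => A) a u
    unfold Fin.init at h
    refine Fin.lastCases ?_ (fun t => ?_) s
    · simp
    · simp [h, (Fin.castSucc_lt_last t).ne']
  map_update_smul' {inst} a s c x := by
    rw [Subsingleton.elim inst (instDecidableEqFin _)]
    have h := fun u => Fin.init_update_castSucc (α := fun _ => A) a u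
    unfold Fin.init at h
    refine Fin.lastCases ?_ (fun t => ?_) s
    · simp
    · simp [h, (Fin.castSucc_lt_last t).ne']

theorem hochschildMid_aux {p : ℕ} (f : MultilinearMap K (fun _ : Fin (p + 1) => A) A)
    (i : Fin (p + 1)) (a : Fin (p + 1 + 1) → A) :
    (f fun t => if t < i then B.α (a t.castSucc) else if t = i then B.μ (a t.castSucc) (a t.succ)
      else B.β (a t.succ)) = biTwistedPartial B.α B.β i f B.mulMultilinear a := by
  show f _ = f _
  congr 1; funext t
  unfold biTwistedArgs
  split_ifs with h1 h2
  · rw [pow_one]; rfl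
  · subst h2; rfl
  · rw [pow_one]; rfl

/-- `f(α a₁, …, α a_{i-1}, μ(a_i, a_{i+1}), β a_{i+2}, …, β a_{p+2})`, with `i` counted
from `0` in the code. -/
def hochschildMid {p : ℕ} (f : MultilinearMap K (fun _ : Fin (p + 1) => A) A) (i : Fin (p + 1)) :
    MultilinearMap K (fun _ : Fin (p + 1 + 1) => A) A where
  toFun a := f fun t => if t < i then B.α (a t.castSucc)
    else if t = i then B.μ (a t.castSucc) (a t.succ) else B.β (a t.succ)
  map_update_add' a s x y := by simp only [hochschildMid_aux, MultilinearMap.map_update_add]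
  map_update_smul' a s c x := by simp only [hochschildMid_aux, MultilinearMap.map_update_smul]

/-- The Hochschild coboundary of a multilinear map in `p + 1` variables. -/
def hochschildMap {p : ℕ} (f : MultilinearMap K (fun _ : Fin (p + 1) => A) A) :
    MultilinearMap K (fun _ : Fin (p + 1 + 1) => A) A :=
  B.hochschildLeft f + ∑ i : Fin (p + 1), (-1 : K) ^ ((i : ℕ) + 1) • B.hochschildMid f i
    + (-1 : K) ^ (p + 2) • B.hochschildRight f

theorem hochschildMap_apply {p : ℕ} (f : MultilinearMap K (fun _ : Fin (p + 1) => A) A)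
    (a : Fin (p + 1 + 1) → A) :
    B.hochschildMap f a = B.μ ((B.α ^ p) (a 0)) (f fun t => a t.succ)
      + ∑ i : Fin (p + 1), (-1 : K) ^ ((i : ℕ) + 1) • (f fun t => if t < i then B.α (a t.castSucc)
          else if t = i then B.μ (a t.castSucc) (a t.succ) else B.β (a t.succ))
      + (-1 : K) ^ (p + 2) • B.μ (f fun t => a t.castSucc) ((B.β ^ p) (a (Fin.last (p + 1)))) := by
  simp [hochschildMap]
  rfl

theorem hochschildMap_comm {φ : A →ₗ[K] A} (hα : Commute φ B.α) (hβ : Commute φ B.β)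
    (hμ : ∀ a b, φ (B.μ a b) = B.μ (φ a) (φ b)) {p : ℕ}
    {f : MultilinearMap K (fun _ : Fin (p + 1) => A) A}
    (hf : ∀ a, φ (f a) = f fun t => φ (a t)) (a) :
    φ (B.hochschildMap f a) = B.hochschildMap f fun t => φ (a t) := by
  have h1 (x) : φ ((B.α ^ p) x) = (B.α ^ p) (φ x) := LinearMap.congr_fun (hα.pow_right p).eq x
  have h2 (x) : φ ((B.β ^ p) x) = (B.β ^ p) (φ x) := LinearMap.congr_fun (hβ.pow_right p).eq x
  have h3 (x) : φ (B.α x) = B.α (φ x) := LinearMap.congr_fun hα.eq x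
  have h4 (x) : φ (B.β x) = B.β (φ x) := LinearMap.congr_fun hβ.eq x
  simp only [hochschildMap_apply, map_add, map_sum, map_smul, hμ, h1, h2, hf, apply_ite φ, h3, h4]

/-- The Hochschild coboundary `δ : C^(p+1)(A, A) → C^(p+2)(A, A)`. -/
def hochschild (p : ℕ) : B.Cochain (p + 1) →ₗ[K] B.Cochain (p + 1 + 1) where
  toFun f := ⟨B.hochschildMap f,
    B.hochschildMap_comm (Commute.refl _) B.comm B.α_mul f.2.1,
    B.hochschildMap_comm B.comm.symm (Commute.refl _) B.β_mul f.2.2⟩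
  map_add' f g := by
    ext a
    simp [hochschildMap_apply, Finset.sum_add_distrib]
    abel
  map_smul' c f := by
    ext a
    simp [hochschildMap_apply, Finset.smul_sum, smul_comm c]

/-- The `(p+1)`-cocycles. -/
abbrev Cocycles (p : ℕ) : Submodule K (B.Cochain (p + 1)) := LinearMap.ker (B.hochschild p)

/-- The `(p+1)`-coboundaries; there are no cochains of degree `0`. -/
def Coboundaries : ∀ p : ℕ, Submodule K (B.Cochain (p + 1))
  | 0 => ⊥
  | p + 1 => LinearMap.range (B.hochschild p)

/-- The Hochschild cohomology `H^(p+1)(A, A)`. -/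
abbrev Cohomology (p : ℕ) : Type _ := B.Cocycles p ⧸ (B.Coboundaries p).submoduleOf (B.Cocycles p)

/-- The total Hochschild cohomology; `H^(p+1)(A, A)` has degree `p + 1`. -/
abbrev TotalCohomology : Type _ := ⨁ p, B.Cohomology p

/-- The class of a cocycle in the total Hochschild cohomology. -/
noncomputable def cohomologyClass {p : ℕ} (f : B.Cocycles p) : B.TotalCohomology :=
  DirectSum.lof K ℕ B.Cohomology p (Submodule.Quotient.mk f)

/-- A cochain in the total space of the operad. -/
noncomputable abbrev incl (p : ℕ) : B.Cochain (p + 1) →ₗ[K] B.operad.Total := B.operad.incl p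

end BihomAssocAlgebra

/-! The theorem is an instance of a fact about non-symmetric operads: the signed braces always
satisfy the higher pre-Lie identity, and a binary operation `m` with `m ∘ m = 0` turns the operad
into a homotopy G-algebra whose cohomology is a Gerstenhaber algebra. Bihom-associativity says
precisely that the two partial compositions of `μ` with itself agree in the bi-twisted endomorphism
operad, and there the operadic differential is `(-1)^|f| δ` term by term (`comp_opMul`,
`diffLinear_opMul_incl`).

Braces. The composition `γ` inserts its arguments from right to left. The proof works instead with
`brs`, which inserts from left to right and signs each insertion by `|y|` times its current
position. That position is the number of inputs in front, so the sign `ε` arises by itself, and the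
two operad axioms become `ins_par` (a Koszul sign) and `ins_seq` (no sign). The higher pre-Lie
identity `brs_brs` is an induction on the number of inputs, by looking at what occupies the first of
them; `sum_gammaFrom` identifies `brs` with the brace. Homogeneous elements are carried as pairs
(degree, element), since zero has every degree.

Product and differential. Everything follows by feeding `m` into the pre-Lie identity. As `m` has
two inputs, few terms survive: comparing the ways in which `m` swallows some `y`'s with the ways in
which a `y` swallows `m` gives `nestSum_mu_sub`, and from it the formula `gdiff_br` for `d(x{y₁, …,
yₙ})`. The relation `m{m} = 0`, expanded in `m{m}{x}`, `m{m}{x, y}` and `m{m}{x, y, z}`, then yields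
`d² = 0`, the Leibniz rule and associativity.

Cohomology. The associator of `∘` is graded symmetric in its last two arguments, so the bracket is
Lie, and `d = [m, –]` is a derivation of it. On cocycles `gdiff_br` shows that `x{y}` is a homotopy
for graded commutativity and `x{y, z}` one for the Leibniz rule of the bracket. -/

namespace NSOperad

variable {K : Type*} [Field K] (P : NSOperad K)

/-! ### Partial compositions in the total space -/

theorem pcomp_incl {p q : ℕ} {i : ℕ} (h : i < p + 1) (f : P.Op p) (g : P.Op q) :
    P.pcomp i (P.incl p f) (P.incl q g) = P.incl (p + q) (P.comp ⟨i, h⟩ f g) := by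
  simp [pcomp, Nat.le_of_lt_succ h]

theorem pcomp_incl_of_le {p : ℕ} {i : ℕ} (h : p + 1 ≤ i) (f : P.Op p) (y : P.Total) :
    P.pcomp i (P.incl p f) y = 0 := by
  induction y using DirectSum.induction_on with
  | zero => simp
  | of q g =>
    have : ¬ i ≤ p := by omega
    change P.pcomp i (P.incl p f) (P.incl q g) = 0
    simp [pcomp, this]
  | add x y hx hy => rw [map_add, hx, hy, add_zero]

theorem total_induction {C : P.Total → Prop} (h0 : C 0) (hi : ∀ p (f : P.Op p), C (P.incl p f))
    (ha : ∀ x y, C x → C y → C (x + y)) (x : P.Total) : C x :=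
  DirectSum.induction_on x h0 hi ha

/-- The bound `j ≤ q` ensures that input `i + j` of the composite comes from `g`; past it the right
side vanishes while the left may hit a later input of `x`. A component of `x` without input `i`
contributes zero to both sides. -/
theorem pcomp_seq {q : ℕ} {i j : ℕ} (hj : j ≤ q) (x : P.Total) (g : P.Op q) (z : P.Total) :
    P.pcomp (i + j) (P.pcomp i x (P.incl q g)) z = P.pcomp i x (P.pcomp j (P.incl q g) z) := by
  induction x using total_induction with
  | h0 => simp
  | ha x y hx hy => simp only [map_add, LinearMap.add_apply, hx, hy]
  | hi p f =>
    by_cases hi : i < p + 1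
    · induction z using total_induction with
      | h0 => simp
      | ha x y hx hy => simp only [map_add, hx, hy]
      | hi r h =>
        rw [pcomp_incl _ hi, pcomp_incl _ (by omega), pcomp_incl _ (by omega), pcomp_incl _ hi]
        exact P.comp_seq f g h ⟨i, hi⟩ ⟨j, by omega⟩
    · rw [pcomp_incl_of_le _ (by omega), pcomp_incl_of_le _ (by omega)]
      simp

/-- The out-of-range cases agree because composing with `g` adds `q` inputs: if `i` is an input of a
component of `x`, then `j + q` is out of range after the composition exactly when `j` was before. -/
theorem pcomp_par {q : ℕ} {i j : ℕ} (hij : i < j) (x : P.Total) (g : P.Op q) (z : P.Total) :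
    P.pcomp (j + q) (P.pcomp i x (P.incl q g)) z = P.pcomp i (P.pcomp j x z) (P.incl q g) := by
  induction x using total_induction with
  | h0 => simp
  | ha x y hx hy => simp only [map_add, LinearMap.add_apply, hx, hy]
  | hi p f =>
    by_cases hi : i < p + 1
    · by_cases hj : j < p + 1
      · induction z using total_induction with
        | h0 => simp
        | ha x y hx hy => simp only [map_add, LinearMap.add_apply, hx, hy]
        | hi r h =>
          rw [pcomp_incl _ hi, pcomp_incl _ (by omega), pcomp_incl _ hj, pcomp_incl _ (by omega)]
          exact P.comp_par f g h ⟨i, hi⟩ ⟨j, hj⟩ hij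
      · rw [pcomp_incl _ hi, pcomp_incl_of_le _ (by omega), pcomp_incl_of_le _ (by omega)]
        simp
    · rw [pcomp_incl_of_le _ (by omega), pcomp_incl_of_le P (i := j) (by omega)]
      simp

theorem pcomp_one {p : ℕ} {i : ℕ} (h : i ≤ p) (f : P.Op p) :
    P.pcomp i (P.incl p f) (P.incl 0 P.one) = P.incl p f := by
  rw [pcomp_incl _ (Nat.lt_succ_of_le h), P.comp_one]
  rfl

/-! ### Signed insertions of lists of homogeneous elements -/

/-- The pair `(p, x)` is homogeneous when `x` is an operation with `p + 1` inputs. -/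
def IsHom (y : ℕ × P.Total) : Prop := y.2 ∈ LinearMap.range (P.incl y.1)

variable {P} in
theorem IsHom.exists_eq {y : ℕ × P.Total} (hy : P.IsHom y) :
    ∃ (q : ℕ) (g : P.Op q), y = (q, P.incl q g) := by
  obtain ⟨g, hg⟩ := hy
  exact ⟨y.1, g, Prod.ext rfl hg.symm⟩

variable {P} in
/-- The total degree `|y₁| + ⋯ + |yₙ|` of a list. -/
def wt (ys : List (ℕ × P.Total)) : ℕ := (ys.map Prod.fst).sum

@[simp] theorem wt_nil : wt ([] : List (ℕ × P.Total)) = 0 := rfl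

variable {P} in
@[simp] theorem wt_cons (y : ℕ × P.Total) (ys) : wt (y :: ys) = y.1 + wt ys := by simp [wt]

variable {P} in
@[simp] theorem wt_append (xs ys : List (ℕ × P.Total)) : wt (xs ++ ys) = wt xs + wt ys := by
  simp [wt]

/-- The signed partial composition `x ↦ (-1)^(k|y|) x ∘ₖ y`. -/
noncomputable def ins (k : ℕ) (y : ℕ × P.Total) : P.Total →ₗ[K] P.Total :=
  (-1 : K) ^ (y.1 * k) • (P.pcomp k).flip y.2

theorem ins_apply (k : ℕ) (y : ℕ × P.Total) (x : P.Total) :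
    P.ins k y x = (-1 : K) ^ (y.1 * k) • P.pcomp k x y.2 := rfl

/-- The source of all Koszul signs: an insertion of `y` on the left moves the slot of `z` from `j`
to `j + |y|`, which changes its sign by `(-1)^(|y||z|)`. -/
theorem ins_par {i j : ℕ} (hij : i < j) {y : ℕ × P.Total} (hy : P.IsHom y) (z : ℕ × P.Total)
    (x : P.Total) :
    P.ins (j + y.1) z (P.ins i y x) = (-1 : K) ^ (y.1 * z.1) • P.ins i y (P.ins j z x) := by
  obtain ⟨q, g, rfl⟩ := hy.exists_eq
  simp only [ins_apply, map_smul, pcomp_par P hij, smul_smul]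
  congr 1
  ring

/-- No sign appears: of the sign `(-1)^(|z|(i + j))`, the factor with `j` belongs to the inner
insertion and the factor with `i` completes `(-1)^(|y| i)` to the sign of an element of degree `|y|
+ |z|`. -/
theorem ins_seq {i j : ℕ} {y : ℕ × P.Total} (hj : j ≤ y.1) (hy : P.IsHom y) (z : ℕ × P.Total)
    (x : P.Total) :
    P.ins (i + j) z (P.ins i y x) = P.ins i (y.1 + z.1, P.ins j z y.2) x := by
  obtain ⟨q, g, rfl⟩ := hy.exists_eq
  simp only [ins_apply, map_smul, pcomp_seq P hj, smul_smul]
  congr 1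
  ring

theorem ins_isHom {j : ℕ} {x y : ℕ × P.Total} (hj : j ≤ x.1) (hx : P.IsHom x) (hy : P.IsHom y) :
    P.IsHom (x.1 + y.1, P.ins j y x.2) := by
  obtain ⟨p, f, rfl⟩ := hx.exists_eq
  obtain ⟨q, g, rfl⟩ := hy.exists_eq
  simp only [IsHom, ins_apply] at hj ⊢
  rw [pcomp_incl _ (Nat.lt_succ_of_le hj), ← map_smul]
  exact ⟨_, rfl⟩

/-- The signed sum of all insertions of the list `ys`, in this order, into the `N` inputs
`s, s + 1, …, s + N - 1`. -/
noncomputable def brs : ℕ → ℕ → List (ℕ × P.Total) → P.Total →ₗ[K] P.Total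
  | _, _, [] => LinearMap.id
  | 0, _, _ :: _ => 0
  -- Either `y` takes input `s`, and the next input not coming from `y` is `s + |y| + 1`, or input
  -- `s` stays free.
  | N + 1, s, y :: ys => brs N (s + y.1 + 1) ys ∘ₗ P.ins s y + brs N (s + 1) (y :: ys)

@[simp] theorem brs_nil (N s : ℕ) (x : P.Total) : P.brs N s [] x = x := by
  cases N <;> rfl

@[simp] theorem brs_zero_cons (s : ℕ) (y ys) (x : P.Total) : P.brs 0 s (y :: ys) x = 0 := rfl

theorem brs_succ_cons (N s : ℕ) (y ys) (x : P.Total) :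
    P.brs (N + 1) s (y :: ys) x =
      P.brs N (s + y.1 + 1) ys (P.ins s y x) + P.brs N (s + 1) (y :: ys) x := rfl

/-- This exchanges the right-to-left order of `gammaFrom` for the left-to-right order of `brs`:
filling input `i` first shifts every later slot by `|y|`. -/
theorem ins_brs {i t : ℕ} (hit : i < t) {y : ℕ × P.Total} (hy : P.IsHom y) (N : ℕ)
    (ys : List (ℕ × P.Total)) (x : P.Total) :
    P.ins i y (P.brs N t ys x) = (-1 : K) ^ (y.1 * wt ys) • P.brs N (t + y.1) ys (P.ins i y x) := by
  induction N generalizing t ys x with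
  | zero => cases ys <;> simp
  | succ N ih =>
    cases ys with
    | nil => simp
    | cons z zs =>
      rw [brs_succ_cons, brs_succ_cons, map_add, ih (by omega), ih (by omega), smul_add,
        ins_par P hit hy, map_smul, smul_smul, wt_cons]
      have e : t + z.1 + 1 + y.1 = t + y.1 + z.1 + 1 := by omega
      have e' : t + 1 + y.1 = t + y.1 + 1 := by omega
      have h1 : (-1 : K) ^ (y.1 * (z.1 + wt zs)) * (-1) ^ (y.1 * z.1) = (-1) ^ (y.1 * wt zs) := by
        rw [← pow_add, show y.1 * (z.1 + wt zs) + y.1 * z.1 = 2 * (y.1 * z.1) + y.1 * wt zs by ring,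
          pow_add, pow_mul]
        simp
      rw [e, e', ← h1]

theorem ins_brs_of_le {s t N : ℕ} (h : s + N ≤ t) (z : ℕ × P.Total)
    {ys : List (ℕ × P.Total)} (hys : ∀ y ∈ ys, P.IsHom y) (x : P.Total) :
    P.ins (t + wt ys) z (P.brs N s ys x) =
      (-1 : K) ^ (z.1 * wt ys) • P.brs N s ys (P.ins t z x) := by
  induction N generalizing s t ys x with
  | zero => cases ys <;> simp
  | succ N ih =>
    cases ys with
    | nil => simp
    | cons y ys =>
      rw [List.forall_mem_cons] at hys
      have e : t + wt (y :: ys) = t + y.1 + wt ys := by simp [add_assoc]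
      rw [brs_succ_cons, brs_succ_cons, map_add, smul_add]
      congr 1
      · rw [e, ih (by omega) hys.2, ins_par P (by omega) hys.1, map_smul, smul_smul, ← pow_add]
        congr 2
        simp
        ring
      · exact ih (by omega) (List.forall_mem_cons.2 hys) x

/-- Insertions into disjoint blocks of inputs commute up to a Koszul sign. Once `ys` are in place,
the right-hand block has moved by `wt ys`. -/
theorem brs_brs_of_le {s t N : ℕ} (M : ℕ) (h : s + N ≤ t) {ys zs : List (ℕ × P.Total)}
    (hys : ∀ y ∈ ys, P.IsHom y) (x : P.Total) :
    P.brs M (t + wt ys) zs (P.brs N s ys x) =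
      (-1 : K) ^ (wt zs * wt ys) • P.brs N s ys (P.brs M t zs x) := by
  induction M generalizing t zs x with
  | zero => cases zs <;> simp
  | succ M ih =>
    cases zs with
    | nil => simp
    | cons z zs =>
      rw [brs_succ_cons, brs_succ_cons, map_add, smul_add, ins_brs_of_le P h z hys, map_smul]
      have e : t + wt ys + z.1 + 1 = t + z.1 + 1 + wt ys := by omega
      have e' : t + wt ys + 1 = t + 1 + wt ys := by omega
      rw [e, e', ih (by omega), ih (by omega), smul_smul, ← pow_add]
      congr 3
      simp
      ring

/-- The bound on `j + M` keeps all the available inputs inside the copy of `y`, so each single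
insertion falls under `ins_seq`. -/
theorem brs_ins_seq {i j M : ℕ} {y : ℕ × P.Total} (hy : P.IsHom y) (hj : j + M ≤ y.1 + 1)
    {zs : List (ℕ × P.Total)} (hzs : ∀ z ∈ zs, P.IsHom z) (x : P.Total) :
    P.brs M (i + j) zs (P.ins i y x) = P.ins i (y.1 + wt zs, P.brs M j zs y.2) x := by
  induction M generalizing j y zs with
  | zero => cases zs <;> simp [ins_apply]
  | succ M ih =>
    cases zs with
    | nil => simp
    | cons z zs =>
      have h := hzs
      rw [List.forall_mem_cons] at hzs
      rw [brs_succ_cons, brs_succ_cons, ins_seq P (by omega) hy]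
      have e : i + j + z.1 + 1 = i + (j + z.1 + 1) := by omega
      rw [e, ih (ins_isHom P (by omega) hy hzs.1) (by simp; omega) hzs.2, add_assoc i j 1,
        ih hy (by omega) h]
      simp only [ins_apply, wt_cons, map_add, smul_add, add_assoc]

theorem brs_isHom {j M : ℕ} {y : ℕ × P.Total} (hy : P.IsHom y) (hj : j + M ≤ y.1 + 1)
    {zs : List (ℕ × P.Total)} (hzs : ∀ z ∈ zs, P.IsHom z) :
    P.IsHom (y.1 + wt zs, P.brs M j zs y.2) := by
  induction M generalizing j y zs with
  | zero =>
    cases zs with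
    | nil => simpa using hy
    | cons z zs => exact zero_mem _
  | succ M ih =>
    cases zs with
    | nil => simpa using hy
    | cons z zs =>
      have h := hzs
      rw [List.forall_mem_cons] at hzs
      have h1 := ih (j := j + z.1 + 1) (ins_isHom P (show j ≤ y.1 by omega) hy hzs.1)
        (by simp; omega) hzs.2
      have h2 := ih (j := j + 1) hy (by omega) h
      simp only [add_assoc] at h1
      unfold IsHom at *
      simp only [brs_succ_cons, add_assoc] at *
      exact add_mem h1 h2

theorem brs_eq_zero {N : ℕ} (s : ℕ) {ys : List (ℕ × P.Total)} (h : N < ys.length) (x : P.Total) :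
    P.brs N s ys x = 0 := by
  induction N generalizing s ys x with
  | zero => cases ys <;> simp at h ⊢
  | succ N ih =>
    cases ys with
    | nil => simp at h
    | cons y ys =>
      simp only [List.length_cons] at h
      rw [brs_succ_cons, ih _ (by omega), ih _ (by simp; omega), add_zero]

end NSOperad

/-! ### Sums over the splittings of a list -/

/-- The sum of `F a b` over all splittings `l = a ++ b`. -/
def splitSum {α M : Type*} [AddCommMonoid M] : (List α → List α → M) → List α → M
  | F, [] => F [] []
  | F, y :: ys => F [] (y :: ys) + splitSum (fun a b => F (y :: a) b) ys

section splitSum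

variable {α M : Type*} [AddCommMonoid M]

@[simp] theorem splitSum_nil (F : List α → List α → M) : splitSum F [] = F [] [] := rfl

theorem splitSum_cons (F : List α → List α → M) (y : α) (ys : List α) :
    splitSum F (y :: ys) = F [] (y :: ys) + splitSum (fun a b => F (y :: a) b) ys := rfl

theorem splitSum_congr {F G : List α → List α → M} {l : List α}
    (h : ∀ a b, a ++ b = l → F a b = G a b) : splitSum F l = splitSum G l := by
  induction l generalizing F G with
  | nil => exact h _ _ rfl
  | cons y ys ih =>
    rw [splitSum_cons, splitSum_cons, h _ _ rfl, ih]
    rintro a b rfl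
    exact h _ _ rfl

theorem splitSum_add (F G : List α → List α → M) (l : List α) :
    splitSum (fun a b => F a b + G a b) l = splitSum F l + splitSum G l := by
  induction l generalizing F G with
  | nil => rfl
  | cons y ys ih => simp only [splitSum_cons, ih]; abel

theorem map_splitSum {N F' : Type*} [AddCommMonoid N] [FunLike F' M N] [AddMonoidHomClass F' M N]
    (φ : F') (F : List α → List α → M) (l : List α) :
    φ (splitSum F l) = splitSum (fun a b => φ (F a b)) l := by
  induction l generalizing F with
  | nil => rfl
  | cons y ys ih => simp only [splitSum_cons, map_add, ih]

theorem smul_splitSum {R : Type*} [Monoid R] [DistribMulAction R M] (c : R)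
    (F : List α → List α → M) (l : List α) :
    c • splitSum F l = splitSum (fun a b => c • F a b) l :=
  map_splitSum (DistribSMul.toAddMonoidHom M c) F l

theorem splitSum_eq_zero {F : List α → List α → M} {l : List α}
    (h : ∀ a b, a ++ b = l → F a b = 0) : splitSum F l = 0 := by
  induction l generalizing F with
  | nil => exact h _ _ rfl
  | cons y ys ih =>
    rw [splitSum_cons, h _ _ rfl, ih, add_zero]
    rintro a b rfl
    exact h _ _ rfl

theorem splitSum_eq_of_left_ne_nil {F : List α → List α → M} {l : List α}
    (h : ∀ a b, a ++ b = l → a ≠ [] → F a b = 0) : splitSum F l = F [] l := by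
  cases l with
  | nil => rfl
  | cons y ys =>
    rw [splitSum_cons, splitSum_eq_zero, add_zero]
    rintro a b rfl
    exact h _ _ rfl (List.cons_ne_nil _ _)

theorem splitSum_eq_of_right_ne_nil {F : List α → List α → M} {l : List α}
    (h : ∀ a b, a ++ b = l → b ≠ [] → F a b = 0) : splitSum F l = F l [] := by
  induction l generalizing F with
  | nil => rfl
  | cons y ys ih =>
    rw [splitSum_cons, h _ _ rfl (List.cons_ne_nil _ _), zero_add, ih]
    rintro a b rfl
    exact h _ _ rfl

theorem splitSum_eq_sum_range (F : List α → List α → M) (l : List α) :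
    splitSum F l = ∑ i ∈ Finset.range (l.length + 1), F (l.take i) (l.drop i) := by
  induction l generalizing F with
  | nil => simp
  | cons y ys ih => 
    rw [splitSum_cons, ih, List.length_cons, Finset.sum_range_succ' _ (ys.length + 1), add_comm]
    rfl

end splitSum

namespace NSOperad

variable {K : Type*} [Field K] (P : NSOperad K)

/-- The insertions preserve order, so an initial segment of `ys` lands in the first `N` inputs and
the rest in the last `M`, which that segment has moved by its weight. -/
theorem splitSum_brs (M N s : ℕ) (ys : List (ℕ × P.Total)) (x : P.Total) :
    P.brs (N + M) s ys x =
      splitSum (fun a b => P.brs M (s + N + wt a) b (P.brs N s a x)) ys := by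
  induction N generalizing s ys x with
  | zero =>
    rw [splitSum_eq_of_left_ne_nil]
    · simp
    · rintro (_ | ⟨y, a⟩) b - h
      · exact absurd rfl h
      · simp
  | succ N ih =>
    cases ys with
    | nil => simp
    | cons y ys =>
      rw [Nat.add_right_comm, brs_succ_cons, ih, ih, splitSum_cons, splitSum_cons]
      have e : s + 1 + N = s + (N + 1) := by omega
      simp only [brs_succ_cons, map_add, splitSum_add, brs_nil, wt_nil, wt_cons, add_zero, e]
      have e2 (w : ℕ) : s + (N + 1) + (y.1 + w) = s + y.1 + 1 + N + w := by omega
      simp only [e2]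
      abel

/-! ### Nested braces -/

variable {P} in
/-- The brace `x{y₁, …, yₙ}` of homogeneous elements, together with its degree. -/
noncomputable def br (x : ℕ × P.Total) (ys : List (ℕ × P.Total)) : ℕ × P.Total :=
  (x.1 + wt ys, P.brs (x.1 + 1) 0 ys x.2)

variable {P} in
@[simp] theorem br_fst (x : ℕ × P.Total) (ys) : (br x ys).1 = x.1 + wt ys := rfl

variable {P} in
theorem br_snd (x : ℕ × P.Total) (ys) : (br x ys).2 = P.brs (x.1 + 1) 0 ys x.2 := rfl

variable {P} in
@[simp] theorem br_nil (x : ℕ × P.Total) : br x [] = x := by simp [br]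

variable {P} in
theorem br_isHom {x : ℕ × P.Total} (hx : P.IsHom x) {ys} (hys : ∀ y ∈ ys, P.IsHom y) :
    P.IsHom (br x ys) :=
  brs_isHom P hx (by omega) hys

variable {P} in
/-- The signed sum of the values of `T` on the lists
`y₁, …, y_{i₁}, x₁{y_{i₁+1}, …, y_{j₁}}, …, xₘ{y_{iₘ+1}, …, y_{jₘ}}, y_{jₘ+1}, …, yₙ`. -/
noncomputable def nestSum : List (ℕ × P.Total) → (List (ℕ × P.Total) → P.Total) →
    List (ℕ × P.Total) → P.Total
  | [], T, ys => T ys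
  | x :: xs, T, ys => splitSum (fun a c => splitSum (fun b d =>
      -- `x` and all later `xs` pass the free arguments `a`, whereas only the later `xs` pass `b`.
      -- Over the whole recursion each `xₚ` passes exactly the `y`'s before its own first argument.
      (-1 : K) ^ ((x.1 + wt xs) * wt a + wt xs * wt b) •
        nestSum xs (fun L => T (a ++ br x b :: L)) d) c) ys

variable {P}

@[simp] theorem nestSum_nil (T : List (ℕ × P.Total) → P.Total) (ys) : nestSum [] T ys = T ys := rfl

theorem nestSum_cons (x xs) (T : List (ℕ × P.Total) → P.Total) (ys) :
    nestSum (x :: xs) T ys = splitSum (fun a c => splitSum (fun b d =>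
      (-1 : K) ^ ((x.1 + wt xs) * wt a + wt xs * wt b) •
        nestSum xs (fun L => T (a ++ br x b :: L)) d) c) ys := rfl

/-- Every list handed to `T` contains one entry for each element of `xs`, so shorter lists never
occur. -/
theorem nestSum_congr {xs : List (ℕ × P.Total)} {T T' : List (ℕ × P.Total) → P.Total}
    (h : ∀ L, xs.length ≤ L.length → T L = T' L) (ys) : nestSum xs T ys = nestSum xs T' ys := by
  induction xs generalizing T T' ys with
  | nil => exact h _ (Nat.zero_le _)
  | cons x xs ih =>
    refine splitSum_congr fun a c _ => splitSum_congr fun b d _ => ?_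
    rw [ih fun L hL => h _ _]
    simp
    omega

theorem nestSum_add (xs : List (ℕ × P.Total)) (T T' : List (ℕ × P.Total) → P.Total) (ys) :
    nestSum xs (fun L => T L + T' L) ys = nestSum xs T ys + nestSum xs T' ys := by
  induction xs generalizing T T' ys with
  | nil => rfl
  | cons x xs ih => simp only [nestSum_cons, ih, smul_add, splitSum_add]

theorem nestSum_zero (xs : List (ℕ × P.Total)) (ys) :
    nestSum xs (fun _ => (0 : P.Total)) ys = 0 := by
  induction xs generalizing ys with
  | nil => rfl
  | cons x xs ih =>
    exact splitSum_eq_zero fun a c _ => splitSum_eq_zero fun b d _ => by rw [ih, smul_zero]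

theorem nestSum_eq_zero {xs : List (ℕ × P.Total)} {T : List (ℕ × P.Total) → P.Total}
    (h : ∀ L, xs.length ≤ L.length → T L = 0) (ys) : nestSum xs T ys = 0 := by
  rw [nestSum_congr h, nestSum_zero]

theorem nestSum_cons_nil (x xs) (T : List (ℕ × P.Total) → P.Total) :
    nestSum (x :: xs) T [] = nestSum xs (fun L => T (x :: L)) [] := by
  simp [nestSum_cons]

theorem nestSum_right_nil (xs) (T : List (ℕ × P.Total) → P.Total) :
    nestSum xs T [] = T xs := by
  induction xs generalizing T with
  | nil => rfl
  | cons x xs ih => rw [nestSum_cons_nil, ih]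

/-- The two terms separate the lists that begin with `x{b}` from those that begin with the free
argument `y`. -/
theorem nestSum_cons_cons (x xs) (T : List (ℕ × P.Total) → P.Total) (y ys) :
    nestSum (x :: xs) T (y :: ys) =
      splitSum (fun b d => (-1 : K) ^ (wt xs * wt b) •
        nestSum xs (fun L => T (br x b :: L)) d) (y :: ys)
      + (-1 : K) ^ ((x.1 + wt xs) * y.1) • nestSum (x :: xs) (fun L => T (y :: L)) ys := by
  rw [nestSum_cons, splitSum_cons, nestSum_cons, smul_splitSum]
  simp only [smul_splitSum, smul_smul, ← pow_add, wt_nil, wt_cons, mul_zero, zero_add,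
    List.nil_append, List.cons_append, mul_add, add_assoc]

/-- The higher pre-Lie identity. -/
theorem brs_brs (N s : ℕ) {xs ys : List (ℕ × P.Total)} (hxs : ∀ x ∈ xs, P.IsHom x)
    (hys : ∀ y ∈ ys, P.IsHom y) (z : P.Total) :
    P.brs (N + wt xs) s ys (P.brs N s xs z) = nestSum xs (fun L => P.brs N s L z) ys := by
  -- Induction on the number of inputs of `z` still available. Both sides are sorted by what ends up
  -- in input `s`: some `x{b}`, the first `y`, or nothing.
  induction N generalizing s xs ys z with
  | zero =>
    cases xs with
    | nil => simp
    | cons x xs =>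
      rw [nestSum_eq_zero]
      · simp
      · rintro (_ | ⟨y, L⟩) h
        · simp at h
        · rfl
  | succ N ih =>
    cases xs with
    | nil => simp
    | cons x xs =>
      have hxs' := hxs
      rw [List.forall_mem_cons] at hxs'
      -- Input `s` is taken by `x`. The `y`'s that land in the `|x| + 1` inputs of `x` form an
      -- initial segment `b`; moving their insertion before that of `xs` makes it an insertion of
      -- `x{b}`.
      have hA : P.brs (N + 1 + wt (x :: xs)) s ys (P.brs N (s + x.1 + 1) xs (P.ins s x z)) =
          splitSum (fun b d => (-1 : K) ^ (wt xs * wt b) •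
            nestSum xs (fun L => P.brs N (s + (br x b).1 + 1) L (P.ins s (br x b) z)) d) ys := by
        have e : N + 1 + wt (x :: xs) = (x.1 + 1) + (N + wt xs) := by simp; omega
        rw [e, splitSum_brs]
        refine splitSum_congr fun b d hbd => ?_
        have hb : ∀ y ∈ b, P.IsHom y := fun y hy => hys y (by simp [← hbd, hy])
        have hd : ∀ y ∈ d, P.IsHom y := fun y hy => hys y (by simp [← hbd, hy])
        have h1 := brs_brs_of_le P (s := s) (N := x.1 + 1) (t := s + x.1 + 1) N (by omega) (zs := xs) hb
          (P.ins s x z)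
        have h2 : P.brs (x.1 + 1) s b (P.brs N (s + x.1 + 1) xs (P.ins s x z)) =
            (-1 : K) ^ (wt xs * wt b) • P.brs N (s + x.1 + 1 + wt b) xs
              (P.brs (x.1 + 1) s b (P.ins s x z)) := by
          rw [h1, smul_smul, ← pow_add, ← two_mul, pow_mul]
          simp
        have h3 := brs_ins_seq P (i := s) (j := 0) (M := x.1 + 1) hxs'.1 (by omega) hb z
        rw [add_zero] at h3
        rw [h2, map_smul, h3, ← add_assoc s x.1 1, ih _ hxs'.2 hd]
        have e2 : s + (br x b).1 + 1 = s + x.1 + 1 + wt b := by simp; omega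
        rw [e2]
        rfl
      rw [brs_succ_cons, map_add, hA]
      -- The same sorting on the right: the first entry of the list avoids input `s` or sits in it.
      -- The value at the empty list plays no role.
      have hT : ∀ L : List (ℕ × P.Total), (x :: xs).length ≤ L.length → P.brs (N + 1) s L z =
          P.brs N (s + 1) L z + (match L with
            | [] => 0
            | h :: t => P.brs N (s + h.1 + 1) t (P.ins s h z)) := by
        rintro (_ | ⟨h, t⟩) hL
        · simp at hL
        · rw [brs_succ_cons, add_comm]
      rw [nestSum_congr hT, nestSum_add]
      cases ys with
      | nil => 
        rw [brs_nil, nestSum_right_nil, nestSum_right_nil, splitSum_nil, nestSum_right_nil]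
        simp [add_comm]
      | cons y ys =>
        have hys' := hys
        rw [List.forall_mem_cons] at hys'
        -- Here `x` and `xs` leave input `s` free, so either `y` takes it or it remains empty.
        have e : N + 1 + wt (x :: xs) = N + wt (x :: xs) + 1 := by omega
        rw [e, brs_succ_cons, ih _ hxs hys, ins_brs P (by omega) hys'.1, map_smul]
        have e2 : s + 1 + y.1 = s + y.1 + 1 := by omega
        rw [e2, ih _ hxs hys'.2, nestSum_cons_cons _ _ (fun L => match L with
            | [] => 0
            | h :: t => P.brs N (s + h.1 + 1) t (P.ins s h z))]
        rw [wt_cons, mul_comm y.1]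
        abel

theorem br_br {x : ℕ × P.Total} {xs ys : List (ℕ × P.Total)} (hxs : ∀ x ∈ xs, P.IsHom x)
    (hys : ∀ y ∈ ys, P.IsHom y) :
    (br (br x xs) ys).2 = nestSum xs (fun L => (br x L).2) ys := by
  rw [br_snd, br_snd, br_fst, add_right_comm, brs_brs _ _ hxs hys]
  rfl

end NSOperad

/-! ### Sums over strictly increasing maps -/

theorem strictMono_fin_succ_comp {n N : ℕ} {k : Fin n → Fin N} :
    StrictMono (fun j => (k j).succ) ↔ StrictMono k := by
  simp [StrictMono, Fin.succ_lt_succ_iff]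

theorem strictMono_fin_cons_zero_succ {n N : ℕ} {k : Fin n → Fin N} :
    StrictMono (Fin.cons 0 (fun j => (k j).succ) : Fin (n + 1) → Fin (N + 1)) ↔ StrictMono k := by
  constructor
  · intro h a b hab
    have := h (Fin.succ_lt_succ_iff.2 hab)
    simpa using this
  · intro h a b hab
    induction a using Fin.cases with
    | zero =>
      obtain ⟨b, rfl⟩ := Fin.exists_succ_eq.2 hab.ne'
      simp
    | succ a =>
      obtain ⟨b, rfl⟩ := Fin.exists_succ_eq.2 ((Fin.succ_pos a).trans hab).ne'
      simpa using h (Fin.succ_lt_succ_iff.1 hab)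

open Classical in
-- The split by `k 0 = 0` or not is the recursion that defines `brs`: the first input is filled or
-- skipped.
theorem sum_strictMono_fin_succ {M : Type*} [AddCommMonoid M] {n N : ℕ}
    (F : (Fin (n + 1) → Fin (N + 1)) → M) :
    ∑ k : Fin (n + 1) → Fin (N + 1) with StrictMono k, F k =
      ∑ k : Fin n → Fin N with StrictMono k, F (Fin.cons 0 fun j => (k j).succ) +
        ∑ k : Fin (n + 1) → Fin N with StrictMono k, F fun j => (k j).succ := by
  rw [← Finset.sum_filter_add_sum_filter_not _ (fun k => k 0 = 0)]
  congr 1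
  · symm
    refine Finset.sum_bij (fun k _ => Fin.cons 0 fun j => (k j).succ) ?_ ?_ ?_ fun _ _ => rfl
    · intro k hk
      simp only [Finset.mem_filter, Finset.mem_univ, true_and] at hk ⊢
      exact ⟨strictMono_fin_cons_zero_succ.2 hk, rfl⟩
    · intro k _ k' _ h
      funext j
      simpa using congrFun h j.succ
    · intro k hk
      simp only [Finset.mem_filter, Finset.mem_univ, true_and] at hk
      have h (j : Fin n) : k j.succ ≠ 0 := (hk.2 ▸ hk.1 j.succ_pos).ne'
      have e : (Fin.cons 0 fun j : Fin n => ((k j.succ).pred (h j)).succ) = k := by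
        funext j
        induction j using Fin.cases with
        | zero => simp [hk.2]
        | succ j => simp
      refine ⟨fun j => (k j.succ).pred (h j), ?_, e⟩
      simp only [Finset.mem_filter, Finset.mem_univ, true_and]
      rw [← strictMono_fin_cons_zero_succ, e]
      exact hk.1
  · symm
    refine Finset.sum_bij (fun k _ j => (k j).succ) ?_ ?_ ?_ fun _ _ => rfl
    · intro k hk
      simp only [Finset.mem_filter, Finset.mem_univ, true_and] at hk ⊢
      exact ⟨strictMono_fin_succ_comp.2 hk, Fin.succ_ne_zero _⟩
    · intro k _ k' _ h
      funext j
      simpa using congrFun h j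
    · intro k hk
      simp only [Finset.mem_filter, Finset.mem_univ, true_and] at hk
      have h (j : Fin (n + 1)) : k j ≠ 0 := fun hj =>
        hk.2 (le_antisymm (hj ▸ hk.1.monotone (Fin.zero_le j)) (Fin.zero_le _))
      have e : (fun j => ((k j).pred (h j)).succ) = k := by simp
      refine ⟨fun j => (k j).pred (h j), ?_, e⟩
      simp only [Finset.mem_filter, Finset.mem_univ, true_and]
      rw [← strictMono_fin_succ_comp, e]
      exact hk.1

theorem extend_cons_zero_succ {α : Type*} {n N : ℕ} (k : Fin n → Fin N)
    (Y : Fin (n + 1) → α) (o : α) (hk : StrictMono k) :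
    List.ofFn (Function.extend (Fin.cons 0 fun j => (k j).succ : Fin (n + 1) → Fin (N + 1)) Y
      fun _ => o) = Y 0 :: List.ofFn (Function.extend k (Fin.tail Y) fun _ => o) := by
  have hc := (strictMono_fin_cons_zero_succ.2 hk).injective
  rw [List.ofFn_succ]
  congr 1
  · exact hc.extend_apply Y _ 0
  · congr 1
    funext i
    by_cases h : ∃ j, k j = i
    · obtain ⟨j, rfl⟩ := h
      rw [hk.injective.extend_apply]
      exact hc.extend_apply Y _ j.succ
    · rw [Function.extend_apply' _ _ _ h, Function.extend_apply']
      rintro ⟨j, hj⟩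
      induction j using Fin.cases with
      | zero => exact Fin.succ_ne_zero _ hj.symm
      | succ j => exact h ⟨j, by simpa using hj⟩

theorem extend_succ_comp {α : Type*} {n N : ℕ} (k : Fin n → Fin N)
    (Y : Fin n → α) (o : α) (hk : StrictMono k) :
    List.ofFn (Function.extend (fun j => (k j).succ) Y fun _ => o) =
      o :: List.ofFn (Function.extend k Y fun _ => o) := by
  have hc := (strictMono_fin_succ_comp.2 hk).injective
  rw [List.ofFn_succ]
  congr 1
  · rw [Function.extend_apply']
    rintro ⟨j, hj⟩
    exact Fin.succ_ne_zero _ hj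
  · congr 1
    funext i
    by_cases h : ∃ j, k j = i
    · obtain ⟨j, rfl⟩ := h
      rw [hk.injective.extend_apply]
      exact hc.extend_apply Y _ j
    · rw [Function.extend_apply' _ _ _ h, Function.extend_apply']
      rintro ⟨j, hj⟩
      exact h ⟨j, by simpa using hj⟩

theorem extend_mem {ι κ α : Type*} {C : α → Prop} (k : ι → κ) {Y : ι → α} {o : κ → α}
    (hY : ∀ j, C (Y j)) (ho : ∀ i, C (o i)) (i : κ) : C (Function.extend k Y o i) := by
  classical
  rw [Function.extend_def]
  split_ifs with h
  · exact hY _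
  · exact ho _

/-! ### Comparison of `γ` with the left-to-right insertions. -/

namespace NSOperad

variable {K : Type*} [Field K] (P : NSOperad K)

/-- Arities never drop, because no operation has arity zero. Hence `p ≤ p'`, and an input `t ≤ p`
still exists when the unit is inserted there. -/
theorem gammaFrom_homogeneous {p t : ℕ} (f : P.Op p) {L : List P.Total}
    (ht : t + L.length = p + 1) (hL : ∀ g ∈ L, ∃ q, g ∈ LinearMap.range (P.incl q)) :
    ∃ p' ≥ p, P.gammaFrom (P.incl p f) t L ∈ LinearMap.range (P.incl p') := by
  induction L generalizing t with
  | nil => exact ⟨p, le_rfl, f, rfl⟩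
  | cons g gs ih =>
    simp only [List.length_cons, List.forall_mem_cons] at ht hL
    obtain ⟨⟨q, g, rfl⟩, hL⟩ := hL
    obtain ⟨p', hp', u, hu⟩ := ih (t := t + 1) (by omega) hL
    refine ⟨p' + q, by omega, ?_⟩
    rw [gammaFrom, ← hu, pcomp_incl _ (by omega)]
    exact ⟨_, rfl⟩

theorem gammaFrom_one_cons {p t : ℕ} (f : P.Op p) {L : List P.Total}
    (ht : t + (L.length + 1) = p + 1) (hL : ∀ g ∈ L, ∃ q, g ∈ LinearMap.range (P.incl q)) :
    P.gammaFrom (P.incl p f) t (P.incl 0 P.one :: L) = P.gammaFrom (P.incl p f) (t + 1) L := by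
  obtain ⟨p', hp', u, hu⟩ := gammaFrom_homogeneous P f (t := t + 1) (by omega) hL
  rw [gammaFrom, ← hu, pcomp_one _ (by omega)]

open Classical in
-- In `γ` the rightmost entry goes in first, at an unshifted position, while the exponent already
-- counts the inputs created on its left. Reversing the order shifts the positions by just that
-- amount, so the signs of `brs` come out.
theorem sum_gammaFrom {p : ℕ} (f : P.Op p) {n N s : ℕ} (hs : s + N = p + 1) {q : Fin n → ℕ}
    {Y : Fin n → P.Total} (hY : ∀ j, Y j ∈ LinearMap.range (P.incl (q j))) :
    ∑ k : Fin n → Fin N with StrictMono k,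
      (-1 : K) ^ (∑ j, q j * (s + k j + ∑ l with l < j, q l)) •
        P.gammaFrom (P.incl p f) s (List.ofFn (Function.extend k Y fun _ => P.incl 0 P.one)) =
      P.brs N s (List.ofFn fun j => (q j, Y j)) (P.incl p f) := by
  have hL {n N : ℕ} {q : Fin n → ℕ} {Y : Fin n → P.Total}
      (hY : ∀ j, Y j ∈ LinearMap.range (P.incl (q j))) (k : Fin n → Fin N) :
      ∀ g ∈ List.ofFn (Function.extend k Y fun _ => P.incl 0 P.one),
        ∃ q, g ∈ LinearMap.range (P.incl q) := by
    rw [List.forall_mem_ofFn_iff]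
    exact extend_mem k (C := fun g => ∃ q, g ∈ LinearMap.range (P.incl q))
      (fun j => ⟨_, hY j⟩) fun i => ⟨0, P.one, rfl⟩
  induction N generalizing n s with
  | zero =>
    cases n with
    | zero =>
      rw [Finset.filter_true_of_mem fun k _ => Subsingleton.strictMono k]
      simp [gammaFrom]
    | succ n =>
      rw [Finset.sum_eq_zero]
      · simp
      · intro k
        exact (k 0).elim0
  | succ N ih =>
    cases n with
    | zero =>
      have := ih (s := s + 1) (by omega) hY
      rw [Finset.filter_true_of_mem fun k _ => Subsingleton.strictMono k] at this ⊢
      simp only [Finset.univ_unique, Finset.sum_singleton, Finset.univ_eq_empty, Finset.sum_empty,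
        pow_zero, one_smul, List.ofFn_zero, brs_nil] at this ⊢
      have e := extend_succ_comp (N := N) default Y (P.incl 0 P.one) (Subsingleton.strictMono _)
      refine (congrArg (fun k => P.gammaFrom (P.incl p f) s (List.ofFn
        (Function.extend k Y fun _ => P.incl 0 P.one))) (Subsingleton.elim _ _)).trans
        ((congrArg (P.gammaFrom (P.incl p f) s) e).trans ?_)
      rw [gammaFrom_one_cons _ _ (by simp; omega) (hL hY _), this]
    | succ n =>
      have hY' := fun j : Fin n => hY j.succ
      have h0 : P.IsHom (q 0, Y 0) := hY 0
      rw [sum_strictMono_fin_succ, List.ofFn_succ, brs_succ_cons]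
      congr 1
      -- The first input is filled. The sign of `ins_brs` accounts for the summand `q 0` which each
      -- later exponent receives from the entry on its left.
      · have h1 := ins_brs P (i := s) (t := s + 1) (by omega) h0 N
          (List.ofFn fun j => (q (Fin.succ j), Y (Fin.succ j))) (P.incl p f)
        have e : s + 1 + (q 0, Y 0).1 = s + q 0 + 1 := by simp only; omega
        rw [e, ← ih (by omega) hY', ins_apply, map_sum, LinearMap.sum_apply, Finset.smul_sum] at h1
        have h2 (c : ℕ) (u v : P.Total) (h : u = (-1 : K) ^ c • v) : v = (-1 : K) ^ c • u := by
          rw [h, smul_smul, ← pow_add, ← two_mul, pow_mul]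
          simp
        rw [h2 _ _ _ h1, Finset.smul_sum]
        refine Finset.sum_congr rfl fun k hk => ?_
        simp only [Finset.mem_filter, Finset.mem_univ, true_and] at hk
        rw [extend_cons_zero_succ _ _ _ hk, gammaFrom, map_smul, LinearMap.smul_apply, smul_smul,
          smul_smul, ← pow_add, ← pow_add]
        congr 2
        rw [Fin.sum_univ_succ]
        simp only [wt, List.map_ofFn, List.sum_ofFn, Function.comp_def, Fin.cons_zero, Fin.cons_succ]
        have h3 (i : Fin n) : ∑ l with l < i.succ, q l = q 0 + ∑ l with l < i, q l.succ := by
          rw [Finset.sum_filter, Fin.sum_univ_succ, Finset.sum_filter]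
          simp
        have h4 : ∑ l with l < 0, q l = 0 := by simp
        have h5 (i : Fin n) : q i.succ * (s + ((k i).succ : ℕ) + (q 0 + ∑ l with l < i, q l.succ)) =
            q 0 * q i.succ + q i.succ * (s + 1 + k i + ∑ l with l < i, q l.succ) := by
          rw [Fin.val_succ]
          ring
        simp only [h3, h4, h5, Finset.sum_add_distrib, Finset.mul_sum, Fin.val_zero]
        ring
      · rw [← List.ofFn_succ (f := fun j => (q j, Y j)), ← ih (by omega) hY]
        refine Finset.sum_congr rfl fun k hk => ?_
        simp only [Finset.mem_filter, Finset.mem_univ, true_and] at hk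
        rw [extend_succ_comp _ _ _ hk, gammaFrom_one_cons _ _ (by simp; omega) (hL hY _)]
        simp only [Fin.val_succ, add_assoc, add_comm 1]


/-! ### Multilinearity of the braces -/

/-- A function on lists of graded elements which is linear in each entry. -/
def ListLinear {M : Type*} [AddCommGroup M] [Module K M] (T : List (ℕ × P.Total) → M) : Prop :=
  ∀ l d (c : K) u v l', T (l ++ (d, u + c • v) :: l') = T (l ++ (d, u) :: l') +
    c • T (l ++ (d, v) :: l')

variable {P}

theorem ListLinear.append {M : Type*} [AddCommGroup M] [Module K M]
    {T : List (ℕ × P.Total) → M} (hT : P.ListLinear T) (l : List (ℕ × P.Total)) :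
    P.ListLinear fun L => T (l ++ L) := by
  intro l' d c u v l''
  simpa using hT (l ++ l') d c u v l''

theorem ListLinear.cons {M : Type*} [AddCommGroup M] [Module K M]
    {T : List (ℕ × P.Total) → M} (hT : P.ListLinear T) (y : ℕ × P.Total) :
    P.ListLinear fun L => T (y :: L) := hT.append [y]

theorem ListLinear.zero {M : Type*} [AddCommGroup M] [Module K M]
    {T : List (ℕ × P.Total) → M} (hT : P.ListLinear T) (l d l') : T (l ++ (d, 0) :: l') = 0 := by
  have := hT l d (-1) 0 0 l'
  simpa using this

theorem ListLinear.smul {M : Type*} [AddCommGroup M] [Module K M]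
    {T : List (ℕ × P.Total) → M} (hT : P.ListLinear T) (l d) (c : K) (u l') :
    T (l ++ (d, c • u) :: l') = c • T (l ++ (d, u) :: l') := by
  have := hT l d c 0 u l'
  rwa [zero_add, hT.zero, zero_add] at this

theorem ListLinear.add {M : Type*} [AddCommGroup M] [Module K M]
    {T : List (ℕ × P.Total) → M} (hT : P.ListLinear T) (l d) (u v l') :
    T (l ++ (d, u + v) :: l') = T (l ++ (d, u) :: l') + T (l ++ (d, v) :: l') := by
  have := hT l d 1 u v l'
  rwa [one_smul, one_smul] at this

variable (P)

theorem ins_add_smul (k d : ℕ) (c : K) (u v x : P.Total) :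
    P.ins k (d, u + c • v) x = P.ins k (d, u) x + c • P.ins k (d, v) x := by
  simp only [ins_apply, map_add, map_smul, smul_add]
  rw [smul_comm c]

theorem brs_listLinear (N s : ℕ) (x : P.Total) : P.ListLinear fun L => P.brs N s L x := by
  intro l d c u v l'
  induction N generalizing s l l' x with
  | zero => cases l <;> simp
  | succ N ih =>
    cases l with
    | nil =>
      have := ih (s + 1) x [] l'
      simp only [List.nil_append] at this ⊢
      simp only [brs_succ_cons, this, ins_add_smul, map_add, map_smul, smul_add]
      abel
    | cons y ys =>
      have := ih (s + 1) x (y :: ys) l'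
      simp only [List.cons_append] at this ⊢
      simp only [brs_succ_cons, this, ih, smul_add]
      abel

theorem gamma_sum_eq_brs {p n : ℕ} (f : P.Op p) {q : Fin n → ℕ} {Y : Fin n → P.Total}
    (hY : ∀ j, Y j ∈ LinearMap.range (P.incl (q j)))
    [DecidablePred (StrictMono (α := Fin n) (β := Fin (p + 1)))] :
    ∑ k : Fin n → Fin (p + 1) with StrictMono k,
      (-1 : K) ^ (∑ j, q j * ((k j : ℕ) + ∑ l with l < j, q l)) •
        P.gamma (P.incl p f) (List.ofFn (Function.extend k Y fun _ => P.incl 0 P.one)) =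
      P.brs (p + 1) 0 (List.ofFn fun j => (q j, Y j)) (P.incl p f) := by
  rw [← sum_gammaFrom P f (s := 0) (by omega) hY]
  simp only [zero_add, gamma]
  congr!

open Classical in
-- Terms outside the supports have a zero entry, so the index sets may be enlarged. Additivity needs
-- this: the supports of `u`, `v` and `u + v` differ, and the three braces must be written over one
-- index set.
theorem brace_eq_sum {n : ℕ} {x : P.Total} {y : Fin n → P.Total} {S : Finset ℕ}
    {R : Fin n → Finset ℕ} (hS : DFinsupp.support x ⊆ S) (hR : ∀ j, DFinsupp.support (y j) ⊆ R j) :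
    P.brace x y = ∑ p ∈ S, ∑ q ∈ Fintype.piFinset R,
      P.brs (p + 1) 0 (List.ofFn fun j => (q j, P.incl (q j) (y j (q j)))) (P.incl p (x p)) := by
  have h : P.brace x y = ∑ p ∈ DFinsupp.support x,
      ∑ q ∈ Fintype.piFinset fun j => DFinsupp.support (y j),
      P.brs (p + 1) 0 (List.ofFn fun j => (q j, P.incl (q j) (y j (q j)))) (P.incl p (x p)) :=
    Finset.sum_congr rfl fun p _ => Finset.sum_congr rfl fun q _ =>
      P.gamma_sum_eq_brs (x p) fun j => ⟨_, rfl⟩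
  rw [h]
  refine (Finset.sum_congr rfl fun p _ => Finset.sum_subset
    (Fintype.piFinset_subset _ _ hR) ?_).trans (Finset.sum_subset hS ?_)
  · intro q _ hq
    obtain ⟨j, hj⟩ : ∃ j, y j (q j) = 0 := by simpa using hq
    obtain ⟨l, l', hl⟩ := List.append_of_mem (List.mem_ofFn.2 ⟨j, rfl⟩ :
      (q j, P.incl (q j) (y j (q j))) ∈ List.ofFn fun j => (q j, P.incl (q j) (y j (q j))))
    rw [hl, hj, map_zero]
    exact (P.brs_listLinear _ _ _).zero l (q j) l'
  · intro p _ hp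
    have : x p = 0 := by simpa using hp
    simp [this]

theorem brace_incl {p n : ℕ} {q : Fin n → ℕ} (f : P.Op p) (g : ∀ j, P.Op (q j)) :
    P.brace (P.incl p f) (fun j => P.incl (q j) (g j)) =
      P.brs (p + 1) 0 (List.ofFn fun j => (q j, P.incl (q j) (g j))) (P.incl p f) := by
  classical
  have h1 : DFinsupp.support (P.incl p f) ⊆ {p} := DFinsupp.support_single_subset
  have h2 (j) : DFinsupp.support (P.incl (q j) (g j)) ⊆ {q j} := DFinsupp.support_single_subset
  rw [brace_eq_sum P h1 h2]
  have e : Fintype.piFinset (fun j => {q j}) = {q} := by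
    ext r
    simp [funext_iff]
  rw [e, Finset.sum_singleton, Finset.sum_singleton]
  simp only [DirectSum.lof_apply]

end NSOperad

namespace NSOperad

variable {K : Type*} [Field K] (P : NSOperad K)

theorem exists_ofFn_update {n : ℕ} (q : Fin n → ℕ) (Y : Fin n → P.Total) (i : Fin n) :
    ∃ l l' : List (ℕ × P.Total), ∀ u,
      List.ofFn (fun j => (q j, Function.update Y i u j)) = l ++ (q i, u) :: l' := by
  refine ⟨(List.ofFn fun j => (q j, Y j)).take i, (List.ofFn fun j => (q j, Y j)).drop (i + 1),
    fun u => ?_⟩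
  have h : List.ofFn (fun j => (q j, Function.update Y i u j)) =
      (List.ofFn fun j => (q j, Y j)).set i (q i, u) := by
    refine List.ext_getElem (by simp) fun k h1 h2 => ?_
    rw [List.getElem_set]
    split_ifs with hk
    · subst hk; simp
    · rw [List.getElem_ofFn, List.getElem_ofFn, Function.update_of_ne]
      exact fun h => hk (congrArg Fin.val h.symm)
  rw [h, List.set_eq_take_append_cons_drop, if_pos (by simp)]

variable {P} in
/-- A function on lists which is linear in each entry, as a multilinear map in the entries. -/
def ListLinear.toMultilinear {M : Type*} [AddCommGroup M] [Module K M]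
    {T : List (ℕ × P.Total) → M} (hT : P.ListLinear T) {n : ℕ} (q : Fin n → ℕ) :
    MultilinearMap K (fun _ : Fin n => P.Total) M where
  toFun Y := T (List.ofFn fun j => (q j, Y j))
  map_update_add' {inst} Y i u v := by
    rw [Subsingleton.elim inst (instDecidableEqFin _)]
    obtain ⟨l, l', h⟩ := exists_ofFn_update P q Y i
    rw [h, h, h, hT.add]
  map_update_smul' {inst} Y i c u := by
    rw [Subsingleton.elim inst (instDecidableEqFin _)]
    obtain ⟨l, l', h⟩ := exists_ofFn_update P q Y i
    rw [h, h, hT.smul]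

/-- The projection to the operations with `p + 1` inputs. -/
noncomputable def proj (p : ℕ) : P.Total →ₗ[K] P.Total :=
  P.incl p ∘ₗ DirectSum.component K ℕ P.Op p

/-- The multilinear map whose values are the braces. -/
noncomputable def braceMultilinear (n : ℕ) :
    P.Total →ₗ[K] MultilinearMap K (fun _ : Fin n => P.Total) P.Total := by
  classical
  let B (p : ℕ) (q : Fin n → ℕ) (x : P.Total) :
      MultilinearMap K (fun _ : Fin n => P.Total) P.Total :=
    ((P.brs_listLinear (p + 1) 0 (P.proj p x)).toMultilinear q).compLinearMap fun j => P.proj (q j)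
  have hB (x : P.Total) (y : Fin n → P.Total) {S : Finset ℕ} {R : Fin n → Finset ℕ}
      (hS : DFinsupp.support x ⊆ S) (hR : ∀ j, DFinsupp.support (y j) ⊆ R j) :
      P.brace x y = ∑ p ∈ S, ∑ q ∈ Fintype.piFinset R, B p q x y := P.brace_eq_sum hS hR
  have hu (y : Fin n → P.Total) (i : Fin n) (u : P.Total) (S : Finset ℕ)
      (hS : DFinsupp.support u ⊆ S) (j : Fin n) :
      DFinsupp.support (Function.update y i u j) ⊆ DFinsupp.support (y j) ∪ S := by
    by_cases h : j = i
    · subst h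
      rw [Function.update_self]
      exact hS.trans Finset.subset_union_right
    · rw [Function.update_of_ne h]
      exact Finset.subset_union_left
  refine
    { toFun x :=
        { toFun y := P.brace x y
          map_update_add' {inst} y i u v := ?_
          map_update_smul' {inst} y i c u := ?_ }
      map_add' x x' := ?_
      map_smul' c x := ?_ }
  · rw [Subsingleton.elim inst (instDecidableEqFin _)]
    -- All three braces are written over one family of index sets built from `S`; additivity then
    -- holds summand by summand.
    let S := DFinsupp.support u ∪ DFinsupp.support v
    rw [hB x _ subset_rfl (hu y i _ S DFinsupp.support_add),
      hB x _ subset_rfl (hu y i u S Finset.subset_union_left),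
      hB x _ subset_rfl (hu y i v S Finset.subset_union_right)]
    simp only [MultilinearMap.map_update_add, Finset.sum_add_distrib]
  · rw [Subsingleton.elim inst (instDecidableEqFin _)]
    rw [hB x _ subset_rfl (hu y i _ _ (DFinsupp.support_smul c u)),
      hB x _ subset_rfl (hu y i u _ subset_rfl)]
    simp only [MultilinearMap.map_update_smul, Finset.smul_sum]
  · refine MultilinearMap.ext fun y => ?_
    change P.brace _ _ = P.brace _ _ + P.brace _ _
    let S := DFinsupp.support x ∪ DFinsupp.support x'
    rw [hB (x + x') y (DFinsupp.support_add : _ ⊆ S) fun _ => subset_rfl,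
      hB x y (Finset.subset_union_left : _ ⊆ S) fun _ => subset_rfl,
      hB x' y (Finset.subset_union_right : _ ⊆ S) fun _ => subset_rfl]
    simp only [← Finset.sum_add_distrib]
    refine Finset.sum_congr rfl fun p _ => Finset.sum_congr rfl fun q _ => ?_
    change P.brs _ _ _ _ = P.brs _ _ _ _ + P.brs _ _ _ _
    rw [map_add, map_add]
  · refine MultilinearMap.ext fun y => ?_
    change P.brace _ _ = c • P.brace _ _
    rw [hB (c • x) y (DFinsupp.support_smul c x) fun _ => subset_rfl,
      hB x y subset_rfl fun _ => subset_rfl]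
    simp only [Finset.smul_sum]
    refine Finset.sum_congr rfl fun p _ => Finset.sum_congr rfl fun q _ => ?_
    change P.brs _ _ _ _ = c • P.brs _ _ _ _
    rw [map_smul, map_smul]

@[simp] theorem braceMultilinear_apply {n : ℕ} (x : P.Total) (y : Fin n → P.Total) :
    P.braceMultilinear n x y = P.brace x y := rfl

variable {P}

theorem brace_eq_br {n : ℕ} {x : ℕ × P.Total} (hx : P.IsHom x) {q : Fin n → ℕ}
    {y : Fin n → P.Total} (hy : ∀ j, P.IsHom (q j, y j)) :
    P.brace x.2 y = (br x (List.ofFn fun j => (q j, y j))).2 := by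
  obtain ⟨p, f, rfl⟩ := hx.exists_eq
  have hy' (j) : ∃ g : P.Op (q j), P.incl (q j) g = y j := hy j
  choose g hg using hy'
  obtain rfl : (fun j => P.incl (q j) (g j)) = y := funext hg
  exact P.brace_incl f g

theorem braceList_eq_br {x : ℕ × P.Total} (hx : P.IsHom x) {ys : List (ℕ × P.Total)}
    (hys : ∀ y ∈ ys, P.IsHom y) :
    braceList P.braceMultilinear x.2 (ys.map Prod.snd) = (br x ys).2 := by
  obtain ⟨n, y, rfl⟩ : ∃ (n : ℕ) (y : Fin n → ℕ × P.Total), ys = List.ofFn y :=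
    ⟨_, ys.get, (List.ofFn_get ys).symm⟩
  rw [List.forall_mem_ofFn_iff] at hys
  have h := brace_eq_br hx (q := fun j => (y j).1) (y := fun j => (y j).2) hys
  rw [← h, List.map_ofFn]
  -- The length of the mapped list equals `n` only propositionally, so the arity is generalised
  -- before it is substituted.
  have (n' : ℕ) (e : n' = n) (f : Fin n' → P.Total) (hf : ∀ j, f j = (y (Fin.cast e j)).2) :
      P.braceMultilinear n' x.2 f = P.brace x.2 fun j => (y j).2 := by
    subst e
    exact congrArg _ (funext hf)
  exact this _ (by simp) _ fun j => by simp; rfl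

end NSOperad

/-! ### The dot product and the differential on homogeneous elements. -/

theorem splitSum_concat {α M : Type*} [AddCommMonoid M] (F : List α → List α → M) (l : List α)
    (z : α) :
    splitSum F (l ++ [z]) = splitSum (fun a b => F a (b ++ [z])) l + F (l ++ [z]) [] := by
  induction l generalizing F with
  | nil => rfl
  | cons y ys ih => simp only [List.cons_append, splitSum_cons, ih, add_assoc]

namespace NSOperad

variable {K : Type*} [Field K] {P : NSOperad K}

theorem brs_br {M : ℕ} {x : ℕ × P.Total} {xs ys : List (ℕ × P.Total)} (hM : M = x.1 + 1 + wt xs)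
    (hxs : ∀ x ∈ xs, P.IsHom x) (hys : ∀ y ∈ ys, P.IsHom y) :
    P.brs M 0 ys (br x xs).2 = nestSum xs (fun L => (br x L).2) ys := by
  subst hM
  exact brs_brs _ _ hxs hys _

theorem br_listLinear (x : ℕ × P.Total) : P.ListLinear fun L => (br x L).2 :=
  P.brs_listLinear _ _ _

theorem ListLinear.eq_zero {M : Type*} [AddCommGroup M] [Module K M]
    {T : List (ℕ × P.Total) → M} (hT : P.ListLinear T) (l) {y : ℕ × P.Total} (hy : y.2 = 0) (l') :
    T (l ++ y :: l') = 0 := by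
  have h : y = (y.1, 0) := Prod.ext rfl hy
  rw [h, hT.zero]

theorem br_snd_eq_zero {x : ℕ × P.Total} {L : List (ℕ × P.Total)} (h : x.1 + 1 < L.length) :
    (br x L).2 = 0 := brs_eq_zero P _ h _

/-- The binary operation `m` as a graded element. -/
noncomputable def mu (m : P.Op 1) : ℕ × P.Total := (1, P.incl 1 m)

@[simp] theorem mu_fst (m : P.Op 1) : (mu m).1 = 1 := rfl

theorem mu_isHom (m : P.Op 1) : P.IsHom (mu m) := ⟨m, rfl⟩

/-- The dot product of graded elements. -/
noncomputable def gdot (m : P.Op 1) (x y : ℕ × P.Total) : ℕ × P.Total :=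
  (x.1 + y.1 + 1, (-1 : K) ^ (x.1 + 1) • (br (mu m) [x, y]).2)

/-- The differential of graded elements. -/
noncomputable def gdiff (m : P.Op 1) (x : ℕ × P.Total) : ℕ × P.Total :=
  (x.1 + 1, (br (mu m) [x]).2 - (-1 : K) ^ x.1 • (br x [mu m]).2)

@[simp] theorem gdot_fst (m : P.Op 1) (x y : ℕ × P.Total) :
  (gdot m x y).1 = x.1 + y.1 + 1 := rfl

theorem gdot_snd (m : P.Op 1) (x y : ℕ × P.Total) :
  (gdot m x y).2 = (-1 : K) ^ (x.1 + 1) • (br (mu m) [x, y]).2 := rfl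

@[simp] theorem gdiff_fst (m : P.Op 1) (x : ℕ × P.Total) : (gdiff m x).1 = x.1 + 1 := rfl

theorem gdiff_snd (m : P.Op 1) (x : ℕ × P.Total) :
  (gdiff m x).2 = (br (mu m) [x]).2 - (-1 : K) ^ x.1 • (br x [mu m]).2 := rfl

theorem IsHom.gdot (m : P.Op 1) {x y : ℕ × P.Total} (hx : P.IsHom x) (hy : P.IsHom y) :
    P.IsHom (gdot m x y) := by
  have h := br_isHom (mu_isHom m) (ys := [x, y]) (by simp [hx, hy])
  have e : (br (mu m) [x, y]).1 = x.1 + y.1 + 1 := by simp; omega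
  unfold IsHom at *
  rw [e] at h
  exact Submodule.smul_mem _ _ h

theorem IsHom.gdiff (m : P.Op 1) {x : ℕ × P.Total} (hx : P.IsHom x) : P.IsHom (gdiff m x) := by
  have h := br_isHom (mu_isHom m) (ys := [x]) (by simp [hx])
  have h' := br_isHom hx (ys := [mu m]) (by simp [mu_isHom])
  have e : (br (mu m) [x]).1 = x.1 + 1 := by simp; omega
  unfold IsHom at *
  rw [e] at h
  exact sub_mem h (Submodule.smul_mem _ _ h')

theorem ListLinear.map_gdot {T : List (ℕ × P.Total) → P.Total} (hT : P.ListLinear T) (m : P.Op 1)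
    (y z : ℕ × P.Total) (l ys) :
    T (l ++ gdot m y z :: ys) = (-1 : K) ^ (y.1 + 1) • T (l ++ br (mu m) [y, z] :: ys) := by
  have e : y.1 + z.1 + 1 = (br (mu m) [y, z]).1 := by simp; omega
  rw [NSOperad.gdot, hT.smul, e]

theorem ListLinear.map_gdiff {T : List (ℕ × P.Total) → P.Total} (hT : P.ListLinear T) (m : P.Op 1)
    (y : ℕ × P.Total) (l ys) :
    T (l ++ gdiff m y :: ys) =
      T (l ++ br (mu m) [y] :: ys) - (-1 : K) ^ y.1 • T (l ++ br y [mu m] :: ys) := by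
  have e : y.1 + 1 = (br (mu m) [y]).1 := by simp; omega
  have e' : (br (mu m) [y]).1 = (br y [mu m]).1 := by simp; omega
  rw [NSOperad.gdiff, sub_eq_add_neg, ← neg_smul, hT, e, neg_smul, ← sub_eq_add_neg]
  congr 3
  simp only [e']

theorem nestSum_singleton (y : ℕ × P.Total) (ys T) (z : ℕ × P.Total) :
    nestSum (y :: ys) T [z] = nestSum ys (fun L => T (y :: L)) [z]
      + (-1 : K) ^ (wt ys * z.1) • T (br y [z] :: ys)
      + (-1 : K) ^ ((y.1 + wt ys) * z.1) • T (z :: y :: ys) := by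
  simp [nestSum_cons, splitSum_cons, nestSum_right_nil]

/-- `x₁` and `x₂` already fill the two available places, so no `y` stays free and the list is merely
divided between them. -/
theorem two_nestSum {T : List (ℕ × P.Total) → P.Total} (hT : ∀ L, 2 < L.length → T L = 0)
    (x₁ x₂ : ℕ × P.Total) (ys) :
    nestSum [x₁, x₂] T ys =
      splitSum (fun a b => (-1 : K) ^ (x₂.1 * wt a) • T [br x₁ a, br x₂ b]) ys := by
  rw [nestSum_cons, splitSum_eq_of_left_ne_nil]
  · refine splitSum_congr fun a d _ => ?_
    rw [nestSum_cons, splitSum_eq_of_left_ne_nil, splitSum_eq_of_right_ne_nil]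
    · simp
    · rintro b (_ | ⟨z, d⟩) - h
      · exact absurd rfl h
      · rw [nestSum_nil, hT _ (by simp), smul_zero]
    · rintro (_ | ⟨z, d⟩) c - h
      · exact absurd rfl h
      · exact splitSum_eq_zero fun a b _ => by rw [nestSum_nil, hT _ (by simp), smul_zero]
  · rintro (_ | ⟨z, a⟩) c - h
    · exact absurd rfl h
    · refine splitSum_eq_zero fun b d _ => ?_
      rw [nestSum_eq_zero, smul_zero]
      intro L hL
      apply hT
      simp at hL ⊢
      omega

/-- Next to `x{…}` there is room for at most one free argument, which must be the first or the last.
The same list is given as `y :: ys` and as `l ++ [z]` to name both. -/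
theorem one_nestSum {T : List (ℕ × P.Total) → P.Total} (hT : ∀ L, 2 < L.length → T L = 0)
    (x y z : ℕ × P.Total) (l ys) (h : y :: ys = l ++ [z]) :
    nestSum [x] T (y :: ys) =
      T [br x (y :: ys)] + T [br x l, z] + (-1 : K) ^ (x.1 * y.1) • T [y, br x ys] := by
  have h1 : nestSum [x] (fun L => T (y :: L)) ys = T [y, br x ys] := by
    rw [nestSum_cons, splitSum_eq_of_left_ne_nil, splitSum_eq_of_right_ne_nil]
    · simp
    · rintro b (_ | ⟨w, d⟩) - h
      · exact absurd rfl h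
      · rw [nestSum_nil, hT _ (by simp), smul_zero]
    · rintro (_ | ⟨w, d⟩) c - h
      · exact absurd rfl h
      · exact splitSum_eq_zero fun a b _ => by rw [nestSum_nil, hT _ (by simp), smul_zero]
  rw [nestSum_cons_cons, h1, h, splitSum_concat, splitSum_eq_of_right_ne_nil]
  · simp [add_comm]
  · rintro b (_ | ⟨w, d⟩) - h
    · exact absurd rfl h
    · rw [nestSum_nil, hT _ (by simp), smul_zero]

variable (m : P.Op 1)

theorem br_mu_eq_zero {L : List (ℕ × P.Total)} (h : 2 < L.length) : (br (mu m) L).2 = 0 :=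
  br_snd_eq_zero h

/-- `x₁` and `x₂` occupy both inputs of `m`, so the pre-Lie identity reduces to `two_nestSum`. The
remaining sign `(-1)^(wt a)` comes from the factor `(-1)^(|x| + 1)` in the dot product, as `x₁{a}`
has degree `|x₁| + wt a`. -/
theorem br_gdot {x₁ x₂ : ℕ × P.Total} (h₁ : P.IsHom x₁) (h₂ : P.IsHom x₂) {ys}
    (hys : ∀ y ∈ ys, P.IsHom y) :
    (br (gdot m x₁ x₂) ys).2 =
      splitSum (fun a b => (-1 : K) ^ ((x₂.1 + 1) * wt a) • (gdot m (br x₁ a) (br x₂ b)).2) ys := by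
  rw [br_snd, gdot_snd, map_smul, brs_br (by simp; omega) (by simp [h₁, h₂]) hys,
    two_nestSum (fun L => br_mu_eq_zero m), smul_splitSum]
  refine splitSum_congr fun a b _ => ?_
  rw [gdot_snd, smul_smul, smul_smul, ← pow_add, ← pow_add]
  congr 1
  rw [br_fst, show (x₂.1 + 1) * wt a + (x₁.1 + wt a + 1) = 2 * wt a + (x₁.1 + 1 + x₂.1 * wt a) by
    ring, pow_add _ (2 * _), pow_mul]
  simp

/-- The signed sum of the values of `T` on the lists `y₁, …, d yᵢ, …, yₙ`. -/
noncomputable def derSum : (List (ℕ × P.Total) → P.Total) → List (ℕ × P.Total) → P.Total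
  | _, [] => 0
  | T, y :: ys => T (gdiff m y :: ys) + (-1 : K) ^ y.1 • derSum (fun L => T (y :: L)) ys

/-- The signed sum of the values of `T` on the lists `y₁, …, yᵢ · yᵢ₊₁, …, yₙ`. -/
noncomputable def contractSum : (List (ℕ × P.Total) → P.Total) → List (ℕ × P.Total) → P.Total
  | _, [] => 0
  | _, [_] => 0
  | T, y :: z :: ys => (-1 : K) ^ y.1 • (T (gdot m y z :: ys) +
      contractSum (fun L => T (y :: L)) (z :: ys))

theorem splitSum_br_mu {T : List (ℕ × P.Total) → P.Total} (hT : P.ListLinear T) (y z ys) :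
    splitSum (fun b d => T (br (mu m) b :: d)) (y :: z :: ys) =
      T (mu m :: y :: z :: ys) + T (br (mu m) [y] :: z :: ys) + T (br (mu m) [y, z] :: ys) := by
  rw [splitSum_cons, splitSum_cons, splitSum_eq_of_left_ne_nil]
  · rw [br_nil, add_assoc]
  · rintro (_ | ⟨w, a⟩) b - h
    · exact absurd rfl h
    · have h0 : (br (mu m) (y :: z :: w :: a)) = ((br (mu m) (y :: z :: w :: a)).1, 0) :=
        Prod.ext rfl (br_mu_eq_zero m (by simp))
      rw [h0]
      exact hT.zero [] _ _

theorem neg_one_pow_smul_smul (n : ℕ) (v : P.Total) : (-1 : K) ^ n • (-1 : K) ^ n • v = v := by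
  rw [smul_smul, ← pow_add, ← two_mul, pow_mul]
  simp

/-- The minuend lets `m` swallow consecutive `y`'s; the subtrahend lets one `y` swallow `m`. Terms
in which `m` stands alone cancel, `m{y}` and `y{m}` combine to `d y`, and `m{y, z}` is `y · z` up to
sign. Nothing else occurs, since `m` takes at most two arguments. -/
theorem nestSum_mu_sub {T : List (ℕ × P.Total) → P.Total} (hT : P.ListLinear T) (ys) :
    nestSum [mu m] T ys - (-1 : K) ^ wt ys • nestSum ys T [mu m] =
      derSum m T ys - contractSum m T ys := by
  induction ys generalizing T with
  | nil => simp [nestSum_right_nil, derSum, contractSum]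
  | cons y ys ih =>
    have h1 := ih (hT.cons y)
    have h2 := hT.map_gdiff m y [] ys
    simp only [List.nil_append] at h2
    have e : (-1 : K) ^ wt (y :: ys) • nestSum (y :: ys) T [mu m] =
        (-1 : K) ^ y.1 • (-1 : K) ^ wt ys • nestSum ys (fun L => T (y :: L)) [mu m]
          + (-1 : K) ^ y.1 • T (br y [mu m] :: ys) + T (mu m :: y :: ys) := by
      rw [nestSum_singleton]
      simp only [wt_cons, mu_fst, mul_one, smul_add, neg_one_pow_smul_smul]
      rw [pow_add, mul_smul, mul_smul, neg_one_pow_smul_smul]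
    rw [e, nestSum_cons_cons, derSum, h2]
    simp only [mu_fst, wt_nil, add_zero, one_mul, zero_mul, pow_zero, one_smul, nestSum_nil]
    rw [sub_eq_iff_eq_add] at h1
    rw [h1]
    cases ys with
    | nil =>
      simp [splitSum_cons, derSum, contractSum]
      abel
    | cons z ys =>
      have h3 := hT.map_gdot m y z [] ys
      simp only [List.nil_append] at h3
      rw [splitSum_br_mu m hT, contractSum, h3, pow_succ, mul_smul]
      simp only [smul_add, smul_sub, neg_one_pow_smul_smul]
      simp
      abel

/-- The pre-Lie identity expands `x{ys}{m}`, `x{m}{ys}` and `m{x}{ys}`. The first two differ by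
`nestSum_mu_sub`, which supplies the sums over `d yᵢ` and `yᵢ · yᵢ₊₁`. The third is `one_nestSum`:
its term `m{x{ys}}` cancels, and the other two are the products with the first and the last
argument. -/
theorem gdiff_br {x y z : ℕ × P.Total} (hx : P.IsHom x) {l ys} (h : y :: ys = l ++ [z])
    (hys : ∀ u ∈ y :: ys, P.IsHom u) :
    (gdiff m (br x (y :: ys))).2 - (br (gdiff m x) (y :: ys)).2
        - (-1 : K) ^ x.1 • derSum m (fun L => (br x L).2) (y :: ys) =
      (-1 : K) ^ ((x.1 + 1) * y.1) • (gdot m y (br x ys)).2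
        + (-1 : K) ^ (x.1 + 1) • contractSum m (fun L => (br x L).2) (y :: ys)
        + (-1 : K) ^ (x.1 + wt l) • (gdot m (br x l) z).2 := by
  have hm : ∀ u ∈ [mu m], P.IsHom u := by simp [mu_isHom]
  have h1 := nestSum_mu_sub m (br_listLinear x) (y :: ys)
  rw [sub_eq_iff_eq_add] at h1
  rw [gdiff_snd, br_br hys hm, br_snd (gdiff m x), gdiff_snd, map_sub, map_smul,
    brs_br (by simp; omega) (by simpa using hx) hys, brs_br (by simp) hm hys, h1,
    one_nestSum (fun L => br_mu_eq_zero m) _ _ _ _ _ h, gdot_snd, gdot_snd]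
  simp only [br_fst, pow_add, pow_one, add_mul, one_mul, mul_smul, smul_add, smul_sub,
    neg_one_pow_smul_smul, neg_smul, one_smul, smul_neg]
  rw [smul_comm ((-1 : K) ^ wt l), neg_one_pow_smul_smul, neg_one_pow_smul_smul]
  abel

/-! ### Consequences of `m ∘ m = 0`. -/

variable {m}

/-- In `x{m}{m}` the two terms `x{m, m}` have opposite signs because `|m| = 1`, leaving `x{m{m}} =
0`. After cancellation of `m{x{m}}`, the rest is the expansion of `m{m}{x} = 0`. -/
theorem gdiff_gdiff (hm : (br (mu m) [mu m]).2 = 0) {x : ℕ × P.Total} (hx : P.IsHom x) :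
    (gdiff m (gdiff m x)).2 = 0 := by
  have h1 : nestSum [mu m] (fun L => (br (mu m) L).2) [x] = 0 := by
    rw [← brs_br (M := 3) (by simp) (by simp [mu_isHom]) (by simp [hx]), hm, map_zero]
  have hmm : ∀ u ∈ [mu m], P.IsHom u := by simp [mu_isHom]
  have hxx : ∀ u ∈ [x], P.IsHom u := by simpa using hx
  have h3 := (br_listLinear (mu m)).map_gdiff m x [] []
  simp only [List.nil_append] at h3
  have h4 : (br (gdiff m x) [mu m]).2 = nestSum [x] (fun L => (br (mu m) L).2) [mu m] -
      (-1 : K) ^ x.1 • nestSum [mu m] (fun L => (br x L).2) [mu m] := by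
    rw [br_snd, gdiff_snd, map_sub, map_smul, brs_br (by simp; omega) hxx hmm,
      brs_br (by simp) hmm hmm]
  have h5 : (br x [br (mu m) [mu m]]).2 = 0 := (br_listLinear x).eq_zero [] hm []
  simp only [nestSum_singleton, nestSum_nil, mu_fst, wt_nil, zero_mul, add_zero, pow_zero, one_smul,
    mul_one, one_mul, pow_one, h5, neg_smul] at h1 h4
  rw [gdiff_snd, h3, h4]
  simp only [gdiff_fst, pow_succ, mul_smul, smul_sub, smul_add, neg_one_pow_smul_smul, neg_smul,
    one_smul, smul_neg]
  rw [← h1]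
  abel

theorem nestSum_mu_cons_cons {T : List (ℕ × P.Total) → P.Total} (hT : P.ListLinear T) (y z ys) :
    nestSum [mu m] T (y :: z :: ys) =
      T (mu m :: y :: z :: ys) + T (br (mu m) [y] :: z :: ys) + T (br (mu m) [y, z] :: ys) +
        (-1 : K) ^ y.1 • nestSum [mu m] (fun L => T (y :: L)) (z :: ys) := by
  rw [nestSum_cons_cons, ← splitSum_br_mu m hT]
  simp only [mu_fst, wt_nil, add_zero, one_mul, zero_mul, pow_zero, one_smul, nestSum_nil]

theorem nestSum_mu_pair (hm : (br (mu m) [mu m]).2 = 0) {x y : ℕ × P.Total} (hx : P.IsHom x)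
    (hy : P.IsHom y) :
    (br (mu m) [br (mu m) [x], y]).2 + (br (mu m) [br (mu m) [x, y]]).2 +
      (-1 : K) ^ x.1 • (br (mu m) [x, br (mu m) [y]]).2 = 0 := by
  have h1 : nestSum [mu m] (fun L => (br (mu m) L).2) [x, y] = 0 := by
    rw [← brs_br (M := 3) (by simp) (by simp [mu_isHom]) (by simp [hx, hy]), hm, map_zero]
  rw [nestSum_mu_cons_cons (br_listLinear _), nestSum_singleton] at h1
  simpa [br_mu_eq_zero] using h1

theorem nestSum_mu_triple (hm : (br (mu m) [mu m]).2 = 0) {x y z : ℕ × P.Total} (hx : P.IsHom x)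
    (hy : P.IsHom y) (hz : P.IsHom z) :
    (br (mu m) [br (mu m) [x, y], z]).2 +
      (-1 : K) ^ x.1 • (br (mu m) [x, br (mu m) [y, z]]).2 = 0 := by
  have h1 : nestSum [mu m] (fun L => (br (mu m) L).2) [x, y, z] = 0 := by
    rw [← brs_br (M := 3) (by simp) (by simp [mu_isHom]) (by simp [hx, hy, hz]), hm, map_zero]
  rw [nestSum_mu_cons_cons (br_listLinear _),
    nestSum_mu_cons_cons ((br_listLinear _).cons x), nestSum_singleton] at h1
  simpa [br_mu_eq_zero] using h1

/-- Only the two nested products survive in `m{m}{x, y, z} = 0`, since `m` has no third input; the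
signs in the dot product turn this relation into associativity. -/
theorem gdot_assoc (hm : (br (mu m) [mu m]).2 = 0) {x y z : ℕ × P.Total} (hx : P.IsHom x)
    (hy : P.IsHom y) (hz : P.IsHom z) :
    (gdot m (gdot m x y) z).2 = (gdot m x (gdot m y z)).2 := by
  have h1 := (br_listLinear (mu m)).map_gdot m x y [] [z]
  have h2 := (br_listLinear (mu m)).map_gdot m y z [x] []
  have h3 := nestSum_mu_triple hm hx hy hz
  simp only [List.nil_append, List.cons_append] at h1 h2
  rw [gdot_snd, gdot_snd, h1, h2, eq_neg_of_add_eq_zero_left h3]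
  simp only [gdot_fst, pow_succ, pow_add, mul_smul, neg_smul, one_smul, smul_neg, neg_neg]
  rw [smul_comm ((-1 : K) ^ y.1), smul_comm ((-1 : K) ^ y.1), neg_one_pow_smul_smul]

/-- This is `gdiff_br` for `m{x, y}`. The term `(d m){x, y}` vanishes because `d m = 2 m{m}`, and
the three products on the right of `gdiff_br` are, up to a common sign, the three terms of `m{m}{x,
y} = 0`. -/
theorem gdiff_gdot (hm : (br (mu m) [mu m]).2 = 0) {x y : ℕ × P.Total} (hx : P.IsHom x)
    (hy : P.IsHom y) :
    (gdiff m (gdot m x y)).2 =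
      (gdot m (gdiff m x) y).2 + (-1 : K) ^ (x.1 + 1) • (gdot m x (gdiff m y)).2 := by
  have h1 := gdiff_br m (mu_isHom m) (y := x) (ys := [y]) (l := [x]) (z := y) rfl
    (by simp [hx, hy])
  have h2 := nestSum_mu_pair hm hx hy
  have h3 : (gdiff m (gdot m x y)).2 = (-1 : K) ^ (x.1 + 1) • (gdiff m (br (mu m) [x, y])).2 := by
    have e : (br (mu m) [x, y]).1 = x.1 + y.1 + 1 := by simp; omega
    have h := (br_listLinear (mu m)).map_gdot m x y [] []
    simp only [List.nil_append] at h
    rw [gdiff_snd, gdiff_snd, h, smul_sub, e, smul_comm ((-1 : K) ^ (x.1 + 1)) ((-1 : K) ^ _)]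
    congr 2
    rw [br_snd, br_snd, e, gdot_snd, map_smul]
    rfl
  have h4 : (br (gdiff m (mu m)) [x, y]).2 = 0 := by
    rw [br_snd, gdiff_snd, hm]
    simp
  have h5 := (br_listLinear (mu m)).map_gdot m x y [] []
  simp only [List.nil_append] at h5
  simp only [h4, derSum, contractSum, gdot_snd, h5, h3, br_fst, gdiff_fst, mu_fst, wt_cons, wt_nil,
    smul_zero, add_zero, pow_add, pow_one, mul_smul, smul_add, neg_one_pow_smul_smul, neg_smul,
    one_smul, smul_neg, neg_neg, sub_zero, add_mul, one_mul] at h1 ⊢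
  have h6 : (gdiff m (br (mu m) [x, y])).2 = -(br (mu m) [gdiff m x, y]).2 -
      (-1 : K) ^ x.1 • (br (mu m) [x, gdiff m y]).2 := by
    rw [sub_eq_iff_eq_add] at h1
    rw [h1, ← sub_eq_zero, ← neg_eq_zero, ← h2]
    abel
  rw [h6, smul_sub, smul_neg, neg_one_pow_smul_smul]
  abel

/-! ### The bracket -/

/-- The bracket of graded elements. -/
noncomputable def gbracket (x y : ℕ × P.Total) : ℕ × P.Total :=
  (x.1 + y.1, (br x [y]).2 - (-1 : K) ^ (x.1 * y.1) • (br y [x]).2)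

@[simp] theorem gbracket_fst (x y : ℕ × P.Total) : (gbracket x y).1 = x.1 + y.1 := rfl

theorem gbracket_snd (x y : ℕ × P.Total) :
    (gbracket x y).2 = (br x [y]).2 - (-1 : K) ^ (x.1 * y.1) • (br y [x]).2 := rfl

/-- The associator of `∘` is the graded symmetrisation of `x{y, z}` in `y` and `z`. This pre-Lie
property is what the Jacobi identity rests on. -/
theorem br_br_singleton {x y z : ℕ × P.Total} (hy : P.IsHom y) (hz : P.IsHom z) :
    (br (br x [y]) [z]).2 = (br x [br y [z]]).2 + (br x [y, z]).2 +
      (-1 : K) ^ (y.1 * z.1) • (br x [z, y]).2 := by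
  rw [br_br (by simpa using hy) (by simpa using hz), nestSum_singleton]
  simp
  abel

theorem br_gbracket_right (x y z : ℕ × P.Total) :
    (br x [gbracket y z]).2 =
      (br x [br y [z]]).2 - (-1 : K) ^ (y.1 * z.1) • (br x [br z [y]]).2 := by
  have h := br_listLinear x [] (y.1 + z.1) (-(-1 : K) ^ (y.1 * z.1)) (br y [z]).2 (br z [y]).2 []
  rw [neg_smul, neg_smul, ← sub_eq_add_neg, ← sub_eq_add_neg] at h
  have e : (y.1 + z.1, (br z [y]).2) = br z [y] := Prod.ext (by simp [add_comm]) rfl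
  rw [e] at h
  exact h

theorem br_gbracket_left (x y z : ℕ × P.Total) :
    (br (gbracket y z) [x]).2 =
      (br (br y [z]) [x]).2 - (-1 : K) ^ (y.1 * z.1) • (br (br z [y]) [x]).2 := by
  have e : y.1 + z.1 + 1 = (br z [y]).1 + 1 := by simp [add_comm]
  rw [br_snd, gbracket_snd, map_sub, map_smul]
  congr 2
  rw [gbracket_fst, e]
  rfl

theorem gbracket_jacobi {x y z : ℕ × P.Total} (hx : P.IsHom x) (hy : P.IsHom y) (hz : P.IsHom z) :
    (gbracket x (gbracket y z)).2 = (gbracket (gbracket x y) z).2 +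
      (-1 : K) ^ (x.1 * y.1) • (gbracket y (gbracket x z)).2 := by
  simp only [gbracket_snd _ (gbracket _ _), gbracket_snd (gbracket _ _), br_gbracket_left,
    br_gbracket_right, br_br_singleton, hx, hy, hz, gbracket_fst, mul_add, add_mul, pow_add,
    mul_comm y.1 x.1, mul_comm z.1 x.1, mul_comm z.1 y.1]
  -- After expansion only the signs of the three pairwise products of degrees remain. Each may be
  -- taken as an independent `±1`, and the terms cancel formally.
  rcases neg_one_pow_eq_or K (x.1 * y.1) with h | h <;>
  rcases neg_one_pow_eq_or K (x.1 * z.1) with h' | h' <;>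
  rcases neg_one_pow_eq_or K (y.1 * z.1) with h'' | h'' <;>
  simp only [h, h', h'', one_smul, neg_smul, mul_one, mul_neg, smul_sub, smul_add, smul_neg,
    neg_neg] <;>
  abel

theorem gdiff_snd_eq_gbracket (x : ℕ × P.Total) : (gdiff m x).2 = (gbracket (mu m) x).2 := by
  simp [gdiff_snd, gbracket_snd]

/-- As `d = [m, –]` with `|m| = 1`, this is the Jacobi identity for `m`, `x`, `y`. -/
theorem gdiff_gbracket {x y : ℕ × P.Total} (hx : P.IsHom x) (hy : P.IsHom y) :
    (gdiff m (gbracket x y)).2 =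
      (gbracket (gdiff m x) y).2 + (-1 : K) ^ x.1 • (gbracket x (gdiff m y)).2 := by
  have h (x : ℕ × P.Total) : gdiff m x = gbracket (mu m) x :=
    Prod.ext (by simp [add_comm]) (gdiff_snd_eq_gbracket x)
  rw [h, h, h, gbracket_jacobi (mu_isHom m) hx hy]
  simp

/-- With a single argument, the right side of `gdiff_br` consists of `y · x` and `x · y` up to sign;
for cocycles the left side is just `d(x{y})`. -/
theorem gdot_comm_of_cocycle {x y : ℕ × P.Total} (hx : P.IsHom x) (hy : P.IsHom y)
    (dx : (gdiff m x).2 = 0) (dy : (gdiff m y).2 = 0) :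
    (gdot m x y).2 = (-1 : K) ^ ((x.1 + 1) * (y.1 + 1)) • (gdot m y x).2 +
      (-1 : K) ^ x.1 • (gdiff m (br x [y])).2 := by
  have h1 := gdiff_br m hx (y := y) (ys := []) (l := []) (z := y) rfl (by simp [hy])
  have h2 : (br (gdiff m x) [y]).2 = 0 := by rw [br_snd, dx, map_zero]
  have h3 : (br x [gdiff m y]).2 = 0 := (br_listLinear x).eq_zero [] dy []
  simp only [h2, h3, derSum, contractSum, br_nil, wt_nil, add_zero, smul_zero, sub_zero] at h1
  rw [h1, smul_add, neg_one_pow_smul_smul, smul_smul, ← add_assoc, ← add_smul]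
  simp only [add_mul, mul_add, one_mul, mul_one, pow_add, pow_one]
  rcases neg_one_pow_eq_or K x.1 with h | h <;> rcases neg_one_pow_eq_or K y.1 with h' | h' <;>
  simp [h, h']

/-- The bracket has two halves. `(y · z){x}` splits without correction by `br_gdot`, while for
cocycles `x{y · z}` splits up to `d(x{y, z})` by `gdiff_br` with two arguments. -/
theorem gbracket_gdot_of_cocycle {x y z : ℕ × P.Total} (hx : P.IsHom x) (hy : P.IsHom y)
    (hz : P.IsHom z)
    (dx : (gdiff m x).2 = 0) (dy : (gdiff m y).2 = 0) (dz : (gdiff m z).2 = 0) :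
    (gbracket x (gdot m y z)).2 = (gdot m (gbracket x y) z).2 +
      (-1 : K) ^ (x.1 * (y.1 + 1)) • (gdot m y (gbracket x z)).2 -
        (-1 : K) ^ (x.1 + y.1) • (gdiff m (br x [y, z])).2 := by
  have h1 := gdiff_br m hx (y := y) (ys := [z]) (l := [y]) (z := z) rfl (by simp [hy, hz])
  have h2 : (br (gdiff m x) [y, z]).2 = 0 := by rw [br_snd, dx, map_zero]
  have h3 : (br x [gdiff m y, z]).2 = 0 := (br_listLinear x).eq_zero [] dy [z]
  have h4 : (br x [y, gdiff m z]).2 = 0 := (br_listLinear x).eq_zero [y] dz []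
  have h5 := br_gdot m hy hz (ys := [x]) (by simpa using hx)
  have h6 : (gdot m (gbracket x y) z).2 =
      (gdot m (br x [y]) z).2 - (-1 : K) ^ (x.1 * y.1) • (gdot m (br y [x]) z).2 := by
    have h := (br_listLinear (mu m)) [] (x.1 + y.1) (-(-1 : K) ^ (x.1 * y.1)) (br x [y]).2
      (br y [x]).2 [z]
    have e : (x.1 + y.1, (br y [x]).2) = br y [x] := Prod.ext (by simp [add_comm]) rfl
    rw [e, neg_smul, neg_smul, ← sub_eq_add_neg, ← sub_eq_add_neg] at h
    have e' : (br y [x]).1 = x.1 + y.1 := by simp [add_comm]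
    have e₂ : (br x [y]).1 = x.1 + y.1 := rfl
    rw [gdot_snd, gdot_snd, gdot_snd, e', e₂, gbracket_fst,
      smul_comm ((-1 : K) ^ (x.1 * y.1)), ← smul_sub]
    exact congrArg _ h
  have h7 : (gdot m y (gbracket x z)).2 =
      (gdot m y (br x [z])).2 - (-1 : K) ^ (x.1 * z.1) • (gdot m y (br z [x])).2 := by
    have h := (br_listLinear (mu m)) [y] (x.1 + z.1) (-(-1 : K) ^ (x.1 * z.1)) (br x [z]).2
      (br z [x]).2 []
    have e : (x.1 + z.1, (br z [x]).2) = br z [x] := Prod.ext (by simp [add_comm]) rfl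
    rw [e, neg_smul, neg_smul, ← sub_eq_add_neg, ← sub_eq_add_neg] at h
    rw [gdot_snd, gdot_snd, gdot_snd, smul_comm ((-1 : K) ^ (x.1 * z.1)), ← smul_sub]
    exact congrArg _ h
  simp only [h2, h3, h4, derSum, contractSum, wt_cons, wt_nil, add_zero, smul_zero, sub_zero] at h1
  simp only [splitSum_cons, splitSum_nil, br_nil, wt_cons, wt_nil, add_zero, mul_zero,
    pow_zero, one_smul] at h5
  rw [gbracket_snd, h1, h5, h6, h7]
  simp only [gdot_fst, add_mul, mul_add, one_mul, mul_one, pow_add, pow_one,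
    mul_comm z.1 x.1]
  rcases neg_one_pow_eq_or K x.1 with h | h <;> rcases neg_one_pow_eq_or K y.1 with h' | h' <;>
  rcases neg_one_pow_eq_or K (x.1 * y.1) with h'' | h'' <;>
  rcases neg_one_pow_eq_or K (x.1 * z.1) with k | k <;>
  simp only [h, h', h'', k, one_smul, neg_smul, mul_one, mul_neg, smul_sub, smul_add, smul_neg,
    neg_neg] <;>
  abel

end NSOperad

/-! ### Nested sums indexed by `nestingIndices`. -/

theorem List.drop_take_append_drop_take {α : Type*} (l : List α) {s i k : ℕ} (h : s ≤ i)
    (h' : i ≤ k) : (l.take i).drop s ++ (l.take k).drop i = (l.take k).drop s := by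
  rw [← List.take_append_drop (i - s) ((l.take k).drop s), List.drop_drop, List.take_drop,
    List.take_take]
  congr 3 <;> omega

theorem splitSum_drop {α M : Type*} [AddCommMonoid M] (F : List α → List α → M) (l : List α)
    {n : ℕ} (hn : l.length = n) {s : ℕ} (hs : s ≤ n) :
    splitSum F (l.drop s) =
      ∑ i ∈ {i : Fin (n + 1) | s ≤ (i : ℕ)}, F ((l.take i).drop s) (l.drop i) := by
  rw [splitSum_eq_sum_range, List.length_drop, hn, Finset.sum_filter,
    Fin.sum_univ_eq_sum_range (fun i => if s ≤ i then F ((l.take i).drop s) (l.drop i) else 0),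
    ← Finset.sum_filter]
  have h : (Finset.range (n + 1)).filter (fun i => s ≤ i) = Finset.Ico s (n + 1) := by
    ext i
    simp
    omega
  rw [h, Finset.sum_Ico_eq_sum_range, show n + 1 - s = n - s + 1 by omega]
  refine Finset.sum_congr rfl fun i _ => ?_
  rw [List.drop_drop, List.take_drop]

theorem mem_nestingIndices {m n : ℕ} {w : (Fin m → Fin (n + 1)) × (Fin m → Fin (n + 1))} :
    w ∈ nestingIndices m n ↔ (∀ p, w.1 p ≤ w.2 p) ∧ ∀ p p', p < p' → w.2 p ≤ w.1 p' := by
  simp [nestingIndices]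

theorem cons_mem_nestingIndices {m n : ℕ} {i j : Fin (n + 1)} {u v : Fin m → Fin (n + 1)} :
    ((Fin.cons i u, Fin.cons j v) : (Fin (m + 1) → Fin (n + 1)) × (Fin (m + 1) → Fin (n + 1))) ∈
      nestingIndices (m + 1) n ↔
        i ≤ j ∧ (∀ p, j ≤ u p) ∧ (u, v) ∈ nestingIndices m n := by
  simp only [mem_nestingIndices, Fin.forall_fin_succ, Fin.cons_zero, Fin.cons_succ,
    Fin.succ_lt_succ_iff, Fin.succ_pos, Fin.not_lt_zero, false_implies, true_implies,
    true_and]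
  tauto

/-- Peeling off the first pair `(i, j)` leaves sequences that start no earlier than `j`, which is
the recursion of `nestSum`. -/
theorem sum_nestingIndices_succ {M : Type*} [AddCommMonoid M] {m n s : ℕ}
    (G : Fin (n + 1) → Fin (n + 1) → (Fin m → Fin (n + 1)) × (Fin m → Fin (n + 1)) → M) :
    ∑ i ∈ {i : Fin (n + 1) | s ≤ (i : ℕ)}, ∑ j ∈ {j : Fin (n + 1) | (i : ℕ) ≤ (j : ℕ)},
        ∑ w ∈ nestingIndices m n with ∀ p, (j : ℕ) ≤ w.1 p, G i j w =
      ∑ w ∈ nestingIndices (m + 1) n with ∀ p, s ≤ (w.1 p : ℕ),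
        G (w.1 0) (w.2 0) (Fin.tail w.1, Fin.tail w.2) := by
  rw [Finset.sum_sigma', Finset.sum_sigma']
  refine Finset.sum_bij' (fun t _ => (Fin.cons t.1.1 t.2.1, Fin.cons t.1.2 t.2.2))
    (fun w _ => ⟨⟨w.1 0, w.2 0⟩, (Fin.tail w.1, Fin.tail w.2)⟩) ?_ ?_ ?_ ?_ ?_
  · rintro ⟨⟨i, j⟩, u, v⟩ h
    simp only [Finset.mem_sigma, Finset.mem_filter, Finset.mem_univ, true_and] at h ⊢
    obtain ⟨⟨h1, h2⟩, h3, h4⟩ := h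
    refine ⟨cons_mem_nestingIndices.2 ⟨h2, h4, h3⟩, ?_⟩
    refine Fin.cases h1 fun p => ?_
    exact (h1.trans h2).trans (h4 p)
  · rintro ⟨u, v⟩ h
    simp only [Finset.mem_sigma, Finset.mem_filter, Finset.mem_univ, true_and] at h ⊢
    obtain ⟨h, h1⟩ := h
    rw [← Fin.cons_self_tail u, ← Fin.cons_self_tail v, cons_mem_nestingIndices] at h
    exact ⟨⟨h1 0, h.1⟩, h.2.2, h.2.1⟩
  · rintro ⟨⟨i, j⟩, u, v⟩ h
    simp
  · rintro ⟨u, v⟩ h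
    simp
  · rintro ⟨⟨i, j⟩, u, v⟩ h
    simp

namespace NSOperad

variable {K : Type*} [Field K] {P : NSOperad K}

/-- The graded version of `nestedArgs`. -/
noncomputable def gradedNestedArgs (ys : List (ℕ × P.Total)) :
    ℕ → List ((ℕ × P.Total) × ℕ × ℕ) → List (ℕ × P.Total)
  | s, [] => ys.drop s
  | s, (x, i, j) :: t =>
      (ys.take i).drop s ++ br x ((ys.take j).drop i) :: gradedNestedArgs ys j t

theorem gradedNestedArgs_isHom {ys : List (ℕ × P.Total)} (hys : ∀ y ∈ ys, P.IsHom y) (s : ℕ)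
    {l : List ((ℕ × P.Total) × ℕ × ℕ)} (hl : ∀ x ∈ l, P.IsHom x.1) :
    ∀ y ∈ gradedNestedArgs ys s l, P.IsHom y := by
  induction l generalizing s with
  | nil => exact fun y hy => hys y (List.mem_of_mem_drop hy)
  | cons x t ih =>
    obtain ⟨x, i, j⟩ := x
    rw [List.forall_mem_cons] at hl
    intro y hy
    simp only [gradedNestedArgs, List.mem_append, List.mem_cons] at hy
    rcases hy with hy | rfl | hy
    · exact hys y (List.mem_of_mem_take (List.mem_of_mem_drop hy))
    · exact br_isHom hl.1 fun y hy => hys y (List.mem_of_mem_take (List.mem_of_mem_drop hy))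
    · exact ih j hl.2 y hy

theorem map_snd_gradedNestedArgs {ys : List (ℕ × P.Total)} (hys : ∀ y ∈ ys, P.IsHom y) (s : ℕ)
    {l : List ((ℕ × P.Total) × ℕ × ℕ)} (hl : ∀ x ∈ l, P.IsHom x.1) :
    (gradedNestedArgs ys s l).map Prod.snd =
      nestedArgs P.braceMultilinear (ys.map Prod.snd) s (l.map fun t => (t.1.2, t.2)) := by
  induction l generalizing s with
  | nil => simp [gradedNestedArgs, nestedArgs]
  | cons x t ih =>
    obtain ⟨x, i, j⟩ := x
    rw [List.forall_mem_cons] at hl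
    have h := braceList_eq_br hl.1 (ys := (ys.take j).drop i)
      fun y hy => hys y (List.mem_of_mem_take (List.mem_of_mem_drop hy))
    simp only [gradedNestedArgs, nestedArgs, List.map_cons, List.map_append, ih _ hl.2, ← h,
      List.map_drop, List.map_take]

theorem nestSum_eq_sum {m n : ℕ} (X : Fin m → ℕ × P.Total) (T : List (ℕ × P.Total) → P.Total)
    {ys : List (ℕ × P.Total)} (hn : ys.length = n) {s : ℕ} (hs : s ≤ n) :
    nestSum (List.ofFn X) T (ys.drop s) =
      ∑ w ∈ nestingIndices m n with ∀ p, s ≤ (w.1 p : ℕ),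
        (-1 : K) ^ (∑ p, (X p).1 * wt ((ys.take (w.1 p)).drop s)) •
          T (gradedNestedArgs ys s (List.ofFn fun p => (X p, (w.1 p : ℕ), (w.2 p : ℕ)))) := by
  induction m generalizing s T with
  | zero =>
    have h : nestingIndices 0 n = Finset.univ := by
      ext w
      simp [mem_nestingIndices]
    simp [h, gradedNestedArgs]
  | succ m ih =>
    rw [List.ofFn_succ, nestSum_cons, splitSum_drop _ _ hn hs]
    have h (i : Fin (n + 1)) := splitSum_drop (fun b d =>
      (-1 : K) ^ (((X 0).1 + wt (List.ofFn fun p => X (Fin.succ p))) * wt ((ys.take i).drop s) +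
        wt (List.ofFn fun p => X (Fin.succ p)) * wt b) •
        nestSum (List.ofFn fun p => X (Fin.succ p))
          (fun L => T ((ys.take i).drop s ++ br (X 0) b :: L)) d) ys hn (s := i) (by omega)
    have h' (i j : Fin (n + 1)) := ih (fun p => X (Fin.succ p))
      (fun L => T ((ys.take i).drop s ++ br (X 0) ((ys.take j).drop i) :: L)) (s := j) (by omega)
    simp only [h, h', Finset.smul_sum, smul_smul]
    rw [sum_nestingIndices_succ (fun i j w => ((-1 : K) ^ (((X 0).1 +
      wt (List.ofFn fun p => X (Fin.succ p))) * wt ((ys.take i).drop s) +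
        wt (List.ofFn fun p => X (Fin.succ p)) * wt ((ys.take j).drop i)) *
        (-1 : K) ^ (∑ p : Fin m, (X p.succ).1 * wt ((ys.take (w.1 p)).drop j))) •
        T ((ys.take i).drop s ++ br (X 0) ((ys.take j).drop i) ::
          gradedNestedArgs ys j (List.ofFn fun p => (X p.succ, (w.1 p : ℕ), (w.2 p : ℕ)))))]
    refine Finset.sum_congr rfl fun w hw => ?_
    simp only [Finset.mem_filter, mem_nestingIndices] at hw
    rw [List.ofFn_succ (f := fun p => (X p, (w.1 p : ℕ), (w.2 p : ℕ))), gradedNestedArgs, ← pow_add,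
      Fin.sum_univ_succ]
    congr 2
    -- The `y`'s passed by a later `x` are the free ones before the first `x`, those swallowed by
    -- it, and those after; the sign in `nestSum` records the first two groups at once.
    have h2 (p : Fin m) : wt ((ys.take (w.1 p.succ)).drop s) = wt ((ys.take (w.1 0)).drop s) +
        wt ((ys.take (w.2 0)).drop (w.1 0)) + wt ((ys.take (w.1 p.succ)).drop (w.2 0)) := by
      have h3 := hw.1.1 0
      have h4 := hw.1.2 0 p.succ p.succ_pos
      rw [← wt_append, List.drop_take_append_drop_take _ (hw.2 0) h3, ← wt_append,
        List.drop_take_append_drop_take _ ((hw.2 0).trans h3) h4]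
    simp only [h2, Fin.tail, mul_add, Finset.sum_add_distrib, ← Finset.sum_mul]
    have h5 : wt (List.ofFn fun p => X (Fin.succ p)) = ∑ p : Fin m, (X p.succ).1 := by
      simp [wt, List.map_ofFn, List.sum_ofFn]
    rw [h5]
    ring

end NSOperad

/-! ### Signs and degrees -/

/-- Signs see degrees only modulo two, so the integer exponents of the statement can be traded for
the natural degree labels of homogeneous pairs. -/
theorem negOnePow_smul {K V : Type*} [Field K] [AddCommGroup V] [Module K V] {n : ℤ} {k : ℕ}
    (h : n ≡ k [ZMOD 2]) (v : V) : n.negOnePow • v = (-1 : K) ^ k • v := by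
  rcases Nat.even_or_odd k with hk | hk
  · have hn : Even n := by
      rw [Int.even_iff, h, ← Int.even_iff]
      exact_mod_cast hk
    rw [Int.negOnePow_even _ hn, hk.neg_one_pow, one_smul, one_smul]
  · have hn : Odd n := by
      rw [Int.odd_iff, h, ← Int.odd_iff]
      exact_mod_cast hk
    rw [Int.negOnePow_odd _ hn, hk.neg_one_pow, neg_smul, one_smul, Units.neg_smul, one_smul]

section succDegree

variable {K : Type*} [Field K] {G : ℕ → Type*} [∀ p, AddCommGroup (G p)] [∀ p, Module K (G p)]

theorem lof_mem_succDegree (p : ℕ) (f : G p) {n : ℤ} (h : (p : ℤ) + 1 = n) :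
    DirectSum.lof K ℕ G p f ∈ succDegree K G n :=
  Submodule.mem_iSup_of_mem p (Submodule.mem_iSup_of_mem h ⟨f, rfl⟩)

theorem mem_succDegree {n : ℤ} {x : ⨁ p, G p} (hx : x ∈ succDegree K G n) :
    x = 0 ∨ ∃ (p : ℕ) (f : G p), (p : ℤ) + 1 = n ∧ x = DirectSum.lof K ℕ G p f := by
  by_cases h : ∃ p : ℕ, (p : ℤ) + 1 = n
  · obtain ⟨p, hp⟩ := h
    have hle : succDegree K G n ≤ LinearMap.range (DirectSum.lof K ℕ G p) := by
      refine iSup₂_le fun q hq => ?_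
      obtain rfl : q = p := by omega
      exact le_rfl
    obtain ⟨f, hf⟩ := hle hx
    exact Or.inr ⟨p, f, hp, hf.symm⟩
  · have hle : succDegree K G n ≤ ⊥ := iSup₂_le fun q hq => absurd ⟨q, hq⟩ h
    exact Or.inl ((Submodule.mem_bot K).1 (hle hx))

/-- Zero lies in every degree, including those `≤ 0`. It is represented in `G 0` or `G 1` according
to the parity of `n`, which suffices wherever only signs matter. -/
theorem exists_lof_of_mem_succDegree {n : ℤ} {x : ⨁ p, G p} (hx : x ∈ succDegree K G n) :
    ∃ (p : ℕ) (f : G p), x = DirectSum.lof K ℕ G p f ∧ n ≡ (p + 1 : ℕ) [ZMOD 2] := by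
  rcases mem_succDegree hx with rfl | ⟨p, f, hp, rfl⟩
  · rcases Int.even_or_odd n with h | h
    · refine ⟨1, 0, by simp, ?_⟩
      rw [Int.even_iff] at h
      exact h
    · refine ⟨0, 0, by simp, ?_⟩
      rw [Int.odd_iff] at h
      exact h
  · exact ⟨p, f, rfl, by rw [← hp]; rfl⟩

theorem succDegree_isInternal : DirectSum.IsInternal (succDegree K G) := by
  let dec : (⨁ p, G p) →ₗ[K] ⨁ n, succDegree K G n :=
    DirectSum.toModule K ℕ _ fun p =>
      DirectSum.lof K ℤ (fun n => succDegree K G n) ((p : ℤ) + 1) ∘ₗ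
        (DirectSum.lof K ℕ G p).codRestrict _ fun f => lof_mem_succDegree p f rfl
  have h1 : DirectSum.coeLinearMap (succDegree K G) ∘ₗ dec = LinearMap.id := by
    ext p f : 2
    simp [dec]
  have h2 : dec ∘ₗ DirectSum.coeLinearMap (succDegree K G) = LinearMap.id := by
    ext n x : 2
    obtain ⟨x, hx⟩ := x
    rcases mem_succDegree hx with rfl | ⟨p, f, rfl, rfl⟩
    · have : (⟨0, hx⟩ : succDegree K G n) = 0 := rfl
      rw [this, map_zero, map_zero]
    · simp only [dec, LinearMap.comp_apply, DirectSum.coeLinearMap_lof, DirectSum.toModule_lof]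
      rfl
  exact ⟨fun x y h =>
      (LinearMap.congr_fun h2 x).symm.trans ((congrArg dec h).trans (LinearMap.congr_fun h2 y)),
    fun x => ⟨dec x, LinearMap.congr_fun h1 x⟩⟩

/-- The operations of the operad are defined by sums over supports; this exhibits them as values of
linear maps. -/
theorem sum_support_eq_toModule {N : Type*} [AddCommGroup N] [Module K N]
    [∀ p (f : G p), Decidable (f ≠ 0)] (φ : ∀ p, G p →ₗ[K] N) (x : ⨁ p, G p) :
    ∑ p ∈ DFinsupp.support x, φ p (x p) = DirectSum.toModule K ℕ N φ x :=
  (DFinsupp.sumAddHom_apply (fun p => (φ p).toAddMonoidHom) x).symm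

end succDegree

namespace NSOperad

variable {K : Type*} [Field K] (P : NSOperad K)

theorem exists_isHom_of_mem {P : NSOperad K} {n : ℤ} {x : P.Total} (hx : x ∈ P.degree n) :
    ∃ X : ℕ × P.Total, P.IsHom X ∧ X.2 = x ∧ n - 1 ≡ X.1 [ZMOD 2] := by
  obtain ⟨p, f, rfl, h⟩ := exists_lof_of_mem_succDegree hx
  refine ⟨(p, P.incl p f), ⟨f, rfl⟩, rfl, ?_⟩
  have := h.sub_right 1
  push_cast at this
  rwa [add_sub_cancel_right] at this

theorem mem_degree_of_isHom {P : NSOperad K} {n : ℤ} {X : ℕ × P.Total} (hX : P.IsHom X)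
    (h : (X.1 : ℤ) + 1 = n) : X.2 ∈ P.degree n := by
  obtain ⟨p, f, rfl⟩ := hX.exists_eq
  exact lof_mem_succDegree p f h

/-! ### The operations as bilinear maps -/

/-- The operation `x ∘ y = {x}{y}`. -/
noncomputable def circ : P.Total →ₗ[K] P.Total →ₗ[K] P.Total :=
  LinearMap.mk₂ K (fun x y => P.brace x ![y])
    (fun x x' y => by simp only [← braceMultilinear_apply, map_add, add_apply])
    (fun c x y => by simp only [← braceMultilinear_apply, map_smul, smul_apply])
    (fun x y y' => by
      have e (u : P.Total) : Function.update ![0] 0 u = ![u] := by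
        ext i : 1
        fin_cases i
        rfl
      have := (P.braceMultilinear 1 x).map_update_add ![0] 0 y y'
      simp only [e] at this
      exact this)
    (fun c x y => by
      have e (u : P.Total) : Function.update ![0] 0 u = ![u] := by
        ext i : 1
        fin_cases i
        rfl
      have := (P.braceMultilinear 1 x).map_update_smul ![0] 0 c y
      simp only [e] at this
      exact this)

theorem circ_apply (x y : P.Total) : P.circ x y = P.brace x ![y] := rfl

/-- The operation `x, y ↦ {m}{x, y}`. -/
noncomputable def binary (m : P.Op 1) : P.Total →ₗ[K] P.Total →ₗ[K] P.Total :=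
  LinearMap.mk₂ K (fun x y => P.brace (P.incl 1 m) ![x, y])
    (fun x x' y => by
      have e (u : P.Total) : Function.update ![0, y] 0 u = ![u, y] := by
        ext i : 1
        fin_cases i <;> rfl
      have := (P.braceMultilinear 2 (P.incl 1 m)).map_update_add ![0, y] 0 x x'
      simp only [e] at this
      exact this)
    (fun c x y => by
      have e (u : P.Total) : Function.update ![0, y] 0 u = ![u, y] := by
        ext i : 1
        fin_cases i <;> rfl
      have := (P.braceMultilinear 2 (P.incl 1 m)).map_update_smul ![0, y] 0 c x
      simp only [e] at this
      exact this)
    (fun x y y' => by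
      have e (u : P.Total) : Function.update ![x, 0] 1 u = ![x, u] := by
        ext i : 1
        fin_cases i <;> rfl
      have := (P.braceMultilinear 2 (P.incl 1 m)).map_update_add ![x, 0] 1 y y'
      simp only [e] at this
      exact this)
    (fun c x y => by
      have e (u : P.Total) : Function.update ![x, 0] 1 u = ![x, u] := by
        ext i : 1
        fin_cases i <;> rfl
      have := (P.braceMultilinear 2 (P.incl 1 m)).map_update_smul ![x, 0] 1 c y
      simp only [e] at this
      exact this)

/-- The dot product as a bilinear map. -/
noncomputable def dotLinear (m : P.Op 1) : P.Total →ₗ[K] P.Total →ₗ[K] P.Total :=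
  DirectSum.toModule K ℕ _ fun p => (-1 : K) ^ (p + 1) • (P.binary m ∘ₗ P.incl p)

theorem dotLinear_apply (m : P.Op 1) (x y : P.Total) : P.dotLinear m x y = P.dot m x y := by
  classical
  rw [dotLinear, ← sum_support_eq_toModule, LinearMap.sum_apply]
  rfl

/-- The differential as a linear map. -/
noncomputable def diffLinear (m : P.Op 1) : P.Total →ₗ[K] P.Total :=
  DirectSum.toModule K ℕ _ fun p =>
    (P.circ (P.incl 1 m) - (-1 : K) ^ p • P.circ.flip (P.incl 1 m)) ∘ₗ P.incl p

theorem diffLinear_apply (m : P.Op 1) (x : P.Total) : P.diffLinear m x = P.diff m x := by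
  classical
  rw [diffLinear, ← sum_support_eq_toModule]
  rfl

/-- The bracket as a bilinear map. -/
noncomputable def bracketLinear : P.Total →ₗ[K] P.Total →ₗ[K] P.Total :=
  DirectSum.toModule K ℕ _ fun p => LinearMap.flip <| DirectSum.toModule K ℕ _ fun q =>
    LinearMap.flip <| P.circ.compl₁₂ (P.incl p) (P.incl q) -
      (-1 : K) ^ (p * q) • P.circ.flip.compl₁₂ (P.incl p) (P.incl q)

theorem bracketLinear_apply (x y : P.Total) : P.bracketLinear x y = P.bracket x y := by
  classical
  rw [bracketLinear, ← sum_support_eq_toModule, LinearMap.sum_apply]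
  refine Finset.sum_congr rfl fun p _ => ?_
  rw [LinearMap.flip_apply, ← sum_support_eq_toModule, LinearMap.sum_apply]
  rfl

variable {P}

theorem circ_eq_br {x y : ℕ × P.Total} (hx : P.IsHom x) (hy : P.IsHom y) :
    P.circ x.2 y.2 = (br x [y]).2 := by
  have := brace_eq_br hx (q := fun _ : Fin 1 => y.1) (y := ![y.2]) (by simpa using hy)
  rw [circ_apply]
  simpa using this

theorem binary_eq_br (m : P.Op 1) {x y : ℕ × P.Total} (hx : P.IsHom x) (hy : P.IsHom y) :
    P.binary m x.2 y.2 = (br (mu m) [x, y]).2 := by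
  have := brace_eq_br (mu_isHom m) (q := ![x.1, y.1]) (y := ![x.2, y.2])
    (by simpa [Fin.forall_fin_two] using ⟨hx, hy⟩)
  simp at this
  exact this

theorem dotLinear_eq (m : P.Op 1) {x y : ℕ × P.Total} (hx : P.IsHom x) (hy : P.IsHom y) :
    P.dotLinear m x.2 y.2 = (gdot m x y).2 := by
  rw [gdot_snd, ← binary_eq_br m hx hy]
  obtain ⟨p, f, rfl⟩ := hx.exists_eq
  simp [dotLinear]

theorem diffLinear_eq (m : P.Op 1) {x : ℕ × P.Total} (hx : P.IsHom x) :
    P.diffLinear m x.2 = (gdiff m x).2 := by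
  rw [gdiff_snd, ← circ_eq_br (mu_isHom m) hx, ← circ_eq_br hx (mu_isHom m)]
  obtain ⟨p, f, rfl⟩ := hx.exists_eq
  simp [diffLinear, mu]

theorem bracketLinear_eq {x y : ℕ × P.Total} (hx : P.IsHom x) (hy : P.IsHom y) :
    P.bracketLinear x.2 y.2 = (gbracket x y).2 := by
  rw [gbracket_snd, ← circ_eq_br hx hy, ← circ_eq_br hy hx]
  obtain ⟨p, f, rfl⟩ := hx.exists_eq
  obtain ⟨q, g, rfl⟩ := hy.exists_eq
  simp [bracketLinear]

theorem IsMultiplication.br_eq_zero {m : P.Op 1} (hm : P.IsMultiplication m) :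
    (br (mu m) [mu m]).2 = 0 := by
  rw [← circ_eq_br (mu_isHom m) (mu_isHom m)]
  exact hm

end NSOperad

/-! ### The brace algebra and the homotopy G-algebra of an operad. -/

namespace NSOperad

variable {K : Type*} [Field K] {P : NSOperad K}

theorem wt_take_ofFn {n : ℕ} (Y : Fin n → ℕ × P.Total) (k : ℕ) :
    wt ((List.ofFn Y).take k) = ∑ q ∈ {q : Fin n | (q : ℕ) < k}, (Y q).1 := by
  induction n generalizing k with
  | zero => simp
  | succ n ih =>
    cases k with
    | zero => simp
    | succ k =>
      rw [List.ofFn_succ, List.take_succ_cons, wt_cons, ih, Finset.sum_filter, Finset.sum_filter,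
        Fin.sum_univ_succ]
      simp

theorem wt_ofFn {n : ℕ} (Y : Fin n → ℕ × P.Total) : wt (List.ofFn Y) = ∑ q, (Y q).1 := by
  simp [wt, List.map_ofFn, List.sum_ofFn]

theorem derSum_ofFn (m : P.Op 1) {n : ℕ} (T : List (ℕ × P.Total) → P.Total)
    (Y : Fin n → ℕ × P.Total) :
    derSum m T (List.ofFn Y) = ∑ r : Fin n, (-1 : K) ^ (∑ q : Fin n with q < r, (Y q).1) •
      T (List.ofFn (Function.update Y r (gdiff m (Y r)))) := by
  induction n generalizing T with
  | zero => simp [derSum]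
  | succ n ih =>
    rw [List.ofFn_succ, derSum, ih, Fin.sum_univ_succ]
    congr 1
    · have : (∑ q : Fin (n + 1) with q < 0, (Y q).1) = 0 := by simp
      rw [this, pow_zero, one_smul, List.ofFn_succ (f := Function.update Y 0 _)]
      simp
    · rw [Finset.smul_sum]
      refine Finset.sum_congr rfl fun r _ => ?_
      have : (∑ q : Fin (n + 1) with q < r.succ, (Y q).1) =
          (Y 0).1 + ∑ q : Fin n with q < r, (Y q.succ).1 := by
        rw [Finset.sum_filter, Fin.sum_univ_succ, Finset.sum_filter]
        simp
      rw [this, pow_add, mul_smul, List.ofFn_succ (f := Function.update Y r.succ _)]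
      congr 4
      congr 1
      funext q
      by_cases h : q = r
      · subst h; simp
      · rw [Function.update_of_ne h, Function.update_of_ne (fun e => h (Fin.succ_injective _ e))]

theorem contractSum_ofFn (m : P.Op 1) {n : ℕ} (T : List (ℕ × P.Total) → P.Total)
    (Y : Fin (n + 1) → ℕ × P.Total) :
    contractSum m T (List.ofFn Y) = ∑ r : Fin n,
      (-1 : K) ^ (∑ q : Fin (n + 1) with q ≤ r.castSucc, (Y q).1) •
        T (List.ofFn (Fin.contractNth r.castSucc (gdot m) Y)) := by
  induction n generalizing T with
  | zero => simp [contractSum]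
  | succ n ih =>
    have h := ih (fun L => T (Y 0 :: L)) (fun q => Y q.succ)
    rw [List.ofFn_succ] at h
    rw [List.ofFn_succ, List.ofFn_succ, contractSum, h, Fin.sum_univ_succ, smul_add]
    congr 1
    · have : (∑ q : Fin (n + 2) with q ≤ Fin.castSucc (0 : Fin (n + 1)), (Y q).1) = (Y 0).1 := by
        rw [Finset.sum_filter, Fin.sum_univ_succ]
        simp
      rw [this, List.ofFn_succ (f := Fin.contractNth _ _ _)]
      simp [Fin.contractNth]
    · rw [Finset.smul_sum]
      refine Finset.sum_congr rfl fun r _ => ?_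
      have : (∑ q : Fin (n + 2) with q ≤ r.succ.castSucc, (Y q).1) =
          (Y 0).1 + ∑ q : Fin (n + 1) with q ≤ r.castSucc, (Y q.succ).1 := by
        rw [Finset.sum_filter, Fin.sum_univ_succ, Finset.sum_filter]
        simp [Fin.le_def]
      rw [this, pow_add, mul_smul, List.ofFn_succ (f := Fin.contractNth _ _ Y)]
      congr 4
      congr 1
      funext q
      simp [Fin.contractNth]

theorem brace_eq_br_ofFn {n : ℕ} {X : ℕ × P.Total} (hX : P.IsHom X) {Y : Fin n → ℕ × P.Total}
    (hY : ∀ q, P.IsHom (Y q)) : P.brace X.2 (fun q => (Y q).2) = (br X (List.ofFn Y)).2 :=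
  brace_eq_br hX hY

theorem ofFn_isHom {n : ℕ} {Y : Fin n → ℕ × P.Total} (hY : ∀ q, P.IsHom (Y q)) :
    ∀ y ∈ List.ofFn Y, P.IsHom y := List.forall_mem_ofFn_iff.2 hY

/-- The braces of an operad form a brace algebra. -/
noncomputable def braceAlgebra (P : NSOperad K) : BraceAlgebra K P.degree where
  brace := P.braceMultilinear
  isInternal := succDegree_isInternal
  brace_mem {n i b x ys} hx hys := by
    rcases mem_succDegree hx with rfl | ⟨p, f, hp, rfl⟩
    · rw [map_zero]
      exact zero_mem _
    -- Here degrees must match exactly and not only modulo two, so zero arguments, which fit every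
    -- degree, are set aside.
    by_cases h0 : ∃ q, ys q = 0
    · obtain ⟨q, hq⟩ := h0
      rw [MultilinearMap.map_coord_zero _ q hq]
      exact zero_mem _
    have h (q) : ∃ Y : ℕ × P.Total, P.IsHom Y ∧ Y.2 = ys q ∧ (Y.1 : ℤ) + 1 = b q := by
      rcases mem_succDegree (hys q) with h | ⟨r, g, hr, h⟩
      · exact absurd ⟨q, h⟩ h0
      · exact ⟨(r, P.incl r g), ⟨g, rfl⟩, h.symm, hr⟩
    choose Y hY hYs hYb using h
    obtain rfl : (fun q => (Y q).2) = ys := funext hYs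
    have hX : P.IsHom (p, P.incl p f) := ⟨f, rfl⟩
    rw [braceMultilinear_apply, brace_eq_br_ofFn hX hY]
    refine mem_degree_of_isHom (br_isHom hX (ofFn_isHom hY)) ?_
    rw [br_fst, wt_ofFn, ← hp]
    simp only [← hYb, Finset.sum_add_distrib]
    push_cast
    simp
    ring
  brace_zero x ys := by
    induction x using total_induction with
    | h0 => rw [map_zero]; rfl
    | hi p f =>
      have := brace_eq_br_ofFn (X := (p, P.incl p f)) ⟨f, rfl⟩
        (Y := fun q : Fin 0 => (0, ys q)) (fun q => q.elim0)
      rw [braceMultilinear_apply, this]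
      simp
    | ha x y hx hy => rw [map_add, add_apply, hx, hy]
  brace_brace {m n c a b x xs ys} hx hxs hys := by
    obtain ⟨X, hX, rfl, hXc⟩ := exists_isHom_of_mem hx
    choose Xs hXs hXs' hXsa using fun p => exists_isHom_of_mem (hxs p)
    obtain rfl : (fun p => (Xs p).2) = xs := funext hXs'
    choose Y hY hY' hYb using fun q => exists_isHom_of_mem (hys q)
    obtain rfl : (fun q => (Y q).2) = ys := funext hY'
    have hL := ofFn_isHom hXs
    have h := nestSum_eq_sum Xs (fun L => (br X L).2) (List.length_ofFn (f := Y)) (Nat.zero_le n)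
    rw [List.drop_zero, ← br_br hL (ofFn_isHom hY)] at h
    rw [braceMultilinear_apply, braceMultilinear_apply, brace_eq_br_ofFn hX hXs,
      brace_eq_br_ofFn (br_isHom hX hL) hY, h, Finset.filter_true_of_mem fun w _ p => Nat.zero_le _]
    refine Finset.sum_congr rfl fun w _ => ?_
    have hl : ∀ t ∈ List.ofFn fun p => (Xs p, (w.1 p : ℕ), (w.2 p : ℕ)), P.IsHom t.1 :=
      List.forall_mem_ofFn_iff.2 hXs
    have h1 := map_snd_gradedNestedArgs (ofFn_isHom hY) 0 hl
    rw [List.map_ofFn, List.map_ofFn] at h1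
    have h2 := braceList_eq_br hX (gradedNestedArgs_isHom (ofFn_isHom hY) 0 hl)
    rw [h1] at h2
    rw [← h2]
    refine (negOnePow_smul ?_ _).symm
    push_cast
    refine Int.ModEq.sum fun p _ => ?_
    refine (hXsa p).mul ?_
    rw [List.drop_zero, wt_take_ofFn]
    push_cast
    exact Int.ModEq.sum fun q _ => hYb q

/-- The homotopy G-algebra of an operad with multiplication. -/
noncomputable def homotopyGAlgebra {m : P.Op 1} (hm : P.IsMultiplication m) :
    HomotopyGAlgebra K P.degree where
  toBraceAlgebra := P.braceAlgebra
  dot := P.dotLinear m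
  d := P.diffLinear m
  dot_mem {i j x y} hx hy := by
    rcases mem_succDegree hx with rfl | ⟨p, f, hp, rfl⟩
    · rw [map_zero]
      exact zero_mem _
    rcases mem_succDegree hy with rfl | ⟨q, g, hq, rfl⟩
    · rw [map_zero]
      exact zero_mem _
    have hX : P.IsHom (p, P.incl p f) := ⟨f, rfl⟩
    have hY : P.IsHom (q, P.incl q g) := ⟨g, rfl⟩
    refine dotLinear_eq m hX hY ▸ mem_degree_of_isHom (hX.gdot m hY) ?_
    simp
    omega
  dot_assoc x y z := by
    induction x using total_induction with
    | h0 => simp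
    | ha x x' h h' => simp only [map_add, LinearMap.add_apply, h, h']
    | hi p f =>
      induction y using total_induction with
      | h0 => simp
      | ha x x' h h' => simp only [map_add, LinearMap.add_apply, h, h']
      | hi q g =>
        induction z using total_induction with
        | h0 => simp
        | ha x x' h h' => simp only [map_add, h, h']
        | hi r k =>
          have hX : P.IsHom (p, P.incl p f) := ⟨f, rfl⟩
          have hY : P.IsHom (q, P.incl q g) := ⟨g, rfl⟩
          have hZ : P.IsHom (r, P.incl r k) := ⟨k, rfl⟩
          have := gdot_assoc hm.br_eq_zero hX hY hZ
          rwa [← dotLinear_eq m (hX.gdot m hY) hZ, ← dotLinear_eq m hX hY,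
            ← dotLinear_eq m hX (hY.gdot m hZ), ← dotLinear_eq m hY hZ] at this
  d_mem {i x} hx := by
    rcases mem_succDegree hx with rfl | ⟨p, f, hp, rfl⟩
    · rw [map_zero]
      exact zero_mem _
    have hX : P.IsHom (p, P.incl p f) := ⟨f, rfl⟩
    refine diffLinear_eq m hX ▸ mem_degree_of_isHom (hX.gdiff m) ?_
    simp
    omega
  d_d x := by
    induction x using total_induction with
    | h0 => simp
    | ha x x' h h' => rw [map_add, map_add, h, h', add_zero]
    | hi p f =>
      have hX : P.IsHom (p, P.incl p f) := ⟨f, rfl⟩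
      have := gdiff_gdiff hm.br_eq_zero hX
      rwa [← diffLinear_eq m (hX.gdiff m), ← diffLinear_eq m hX] at this
  d_dot {i x} y hx := by
    obtain ⟨X, hX, rfl, hXi⟩ := exists_isHom_of_mem hx
    have hi : i ≡ (X.1 + 1 : ℕ) [ZMOD 2] := by
      have := hXi.add_right 1
      push_cast
      rwa [sub_add_cancel] at this
    rw [negOnePow_smul (K := K) hi]
    induction y using total_induction with
    | h0 => simp
    | ha x x' h h' => simp only [map_add, h, h', smul_add]; abel
    | hi q g =>
      have hY : P.IsHom (q, P.incl q g) := ⟨g, rfl⟩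
      have := gdiff_gdot hm.br_eq_zero hX hY
      rwa [← diffLinear_eq m (hX.gdot m hY), ← dotLinear_eq m hX hY,
        ← dotLinear_eq m hX (hY.gdiff m), ← dotLinear_eq m (hX.gdiff m) hY,
        ← diffLinear_eq m hX, ← diffLinear_eq m hY] at this
  dot_brace {n i j b x₁ x₂ ys} h₁ h₂ hys := by
    obtain ⟨X, hX, rfl, hXi⟩ := exists_isHom_of_mem h₁
    obtain ⟨Z, hZ, rfl, hZj⟩ := exists_isHom_of_mem h₂
    choose Y hY hY' hYb using fun q => exists_isHom_of_mem (hys q)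
    obtain rfl : (fun q => (Y q).2) = ys := funext hY'
    have hL := ofFn_isHom hY
    change P.brace _ _ = _
    rw [dotLinear_eq m hX hZ, brace_eq_br_ofFn (hX.gdot m hZ) hY, br_gdot m hX hZ hL,
      splitSum_eq_sum_range, List.length_ofFn]
    refine Finset.sum_congr rfl fun k _ => ?_
    have ht : ∀ y ∈ (List.ofFn Y).take k, P.IsHom y := fun y hy => hL y (List.mem_of_mem_take hy)
    have hd : ∀ y ∈ (List.ofFn Y).drop k, P.IsHom y := fun y hy => hL y (List.mem_of_mem_drop hy)
    have e : List.ofFn (fun q => (Y q).2) = (List.ofFn Y).map Prod.snd := by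
      rw [List.map_ofFn]; rfl
    rw [e, ← List.map_take, ← List.map_drop]
    change _ = _ • P.dotLinear m (braceList P.braceMultilinear _ _)
      (braceList P.braceMultilinear _ _)
    rw [braceList_eq_br hX ht, braceList_eq_br hZ hd,
      dotLinear_eq m (br_isHom hX ht) (br_isHom hZ hd)]
    refine (negOnePow_smul ?_ _).symm
    rw [wt_take_ofFn]
    push_cast
    refine Int.ModEq.mul ?_ (Int.ModEq.sum fun q _ => hYb q)
    have := hZj.add_right 1
    rwa [sub_add_cancel] at this
  d_brace {n i b x ys} hx hys := by
    obtain ⟨X, hX, rfl, hXi⟩ := exists_isHom_of_mem hx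
    choose Y hY hY' hYb using fun q => exists_isHom_of_mem (hys q)
    obtain rfl : (fun q => (Y q).2) = ys := funext hY'
    have hi : i ≡ (X.1 + 1 : ℕ) [ZMOD 2] := by
      have := hXi.add_right 1
      push_cast
      rwa [sub_add_cancel] at this
    have hL := ofFn_isHom hY
    -- The argument list is read both from its head `Y 0` and from its end `Y (Fin.last n)`, as the
    -- two outer products require.
    have hmain := gdiff_br m hX (y := Y 0) (ys := List.ofFn fun q => Y (Fin.succ q))
      (l := List.ofFn fun q => Y (Fin.castSucc q)) (z := Y (Fin.last n))
      (by rw [← List.ofFn_succ, List.ofFn_succ', List.concat_eq_append])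
      (by rwa [← List.ofFn_succ])
    rw [← List.ofFn_succ, derSum_ofFn, contractSum_ofFn] at hmain
    have e1 : P.diffLinear m (P.brace X.2 fun q => (Y q).2) =
        (gdiff m (br X (List.ofFn Y))).2 := by
      rw [brace_eq_br_ofFn hX hY, diffLinear_eq m (br_isHom hX hL)]
    have e2 : P.brace (P.diffLinear m X.2) (fun q => (Y q).2) =
        (br (gdiff m X) (List.ofFn Y)).2 := by
      rw [diffLinear_eq m hX, brace_eq_br_ofFn (hX.gdiff m) hY]
    have e3 (r : Fin (n + 1)) : P.brace X.2
        (Function.update (fun q => (Y q).2) r (P.diffLinear m (Y r).2)) =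
        (br X (List.ofFn (Function.update Y r (gdiff m (Y r))))).2 := by
      rw [← brace_eq_br_ofFn hX]
      · congr 1
        funext q
        by_cases h : q = r
        · subst h; simp [diffLinear_eq m (hY q)]
        · simp [h]
      · intro q
        by_cases h : q = r
        · subst h; simpa using (hY q).gdiff m
        · simpa [h] using hY q
    have e4 : P.dotLinear m (Y 0).2 (P.brace X.2 (Fin.tail fun q => (Y q).2)) =
        (gdot m (Y 0) (br X (List.ofFn fun q => Y (Fin.succ q)))).2 := by
      have := brace_eq_br_ofFn hX (Y := fun q => Y (Fin.succ q)) fun q => hY _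
      have h2 := br_isHom hX (ofFn_isHom fun q : Fin n => hY (Fin.succ q))
      rw [← dotLinear_eq m (hY 0) h2, ← this]
      rfl
    have e5 : P.dotLinear m (P.brace X.2 (Fin.init fun q => (Y q).2)) (Y (Fin.last n)).2 =
        (gdot m (br X (List.ofFn fun q => Y (Fin.castSucc q))) (Y (Fin.last n))).2 := by
      have := brace_eq_br_ofFn hX (Y := fun q => Y (Fin.castSucc q)) fun q => hY _
      have h2 := br_isHom hX (ofFn_isHom fun q : Fin n => hY (Fin.castSucc q))
      rw [← dotLinear_eq m h2 (hY _), ← this]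
      rfl
    have e6 (r : Fin n) : P.brace X.2
        (Fin.contractNth r.castSucc (fun u v => P.dotLinear m u v) fun q => (Y q).2) =
        (br X (List.ofFn (Fin.contractNth r.castSucc (gdot m) Y))).2 := by
      rw [← brace_eq_br_ofFn hX]
      · congr 1
        funext q
        unfold Fin.contractNth
        split_ifs
        · rfl
        · exact dotLinear_eq m (hY _) (hY _)
        · rfl
      · intro q
        unfold Fin.contractNth
        split_ifs
        · exact hY _
        · exact (hY _).gdot m (hY _)
        · exact hY _
    change P.diffLinear m (P.brace _ _) - P.brace _ _ - _ • ∑ r, _ • P.brace _ _ =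
      _ • P.dotLinear m _ (P.brace _ _) + _ • (∑ r : Fin n, _ • P.brace _ _) +
        _ • P.dotLinear m (P.brace _ _) _
    rw [e1, e2, e4, e5]
    simp only [e3, e6]
    have s1 (r : Fin (n + 1)) (v : P.Total) :
        (∑ q : Fin (n + 1) with q < r, (b q - 1)).negOnePow • v =
          (-1 : K) ^ (∑ q : Fin (n + 1) with q < r, (Y q).1) • v :=
      negOnePow_smul (by push_cast; exact Int.ModEq.sum fun q _ => hYb q) v
    have s2 (r : Fin n) (v : P.Total) :
        (∑ q : Fin (n + 1) with q ≤ r.castSucc, (b q - 1)).negOnePow • v =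
          (-1 : K) ^ (∑ q : Fin (n + 1) with q ≤ r.castSucc, (Y q).1) • v :=
      negOnePow_smul (by push_cast; exact Int.ModEq.sum fun q _ => hYb q) v
    have s3 : ((i - 1) + ∑ q : Fin n, (b q.castSucc - 1)) ≡
        (X.1 + ∑ q : Fin n, (Y q.castSucc).1 : ℕ) [ZMOD 2] := by
      push_cast
      exact hXi.add (Int.ModEq.sum fun q _ => hYb _)
    have s4 : i * (b 0 - 1) ≡ ((X.1 + 1) * (Y 0).1 : ℕ) [ZMOD 2] := by
      rw [Nat.cast_mul]
      exact hi.mul (hYb 0)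
    simp only [s1, s2]
    rw [negOnePow_smul (K := K) hXi, negOnePow_smul (K := K) hi, negOnePow_smul (K := K) s3,
      negOnePow_smul (K := K) s4, hmain, wt_ofFn]

end NSOperad

/-! ### The Hochschild coboundary as an operadic differential. -/

namespace NSOperad

variable {K : Type*} [Field K] {P : NSOperad K}

theorem brs_singleton (N s : ℕ) (y : ℕ × P.Total) (x : P.Total) :
    P.brs N s [y] x = ∑ k ∈ Finset.range N, P.ins (s + k) y x := by
  induction N generalizing s with
  | zero => rfl
  | succ N ih =>
    rw [brs_succ_cons, brs_nil, ih, Finset.sum_range_succ', add_comm]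
    simp [add_assoc, add_comm 1]

/-- `m{m}` is the difference of the two partial compositions: insertion at the input numbered `1`
carries the sign `(-1)^(1 · 1)`. -/
theorem isMultiplication_of_comp_eq {m : P.Op 1}
    (h : P.comp (p := 1) (q := 1) 0 m m = P.comp (p := 1) (q := 1) 1 m m) :
    P.IsMultiplication m := by
  change P.circ (mu m).2 (mu m).2 = 0
  rw [circ_eq_br (mu_isHom m) (mu_isHom m), br_snd, brs_singleton]
  simp only [Finset.sum_range_succ, Finset.sum_range_zero, zero_add, ins_apply, mu]
  rw [pcomp_incl _ (by omega), pcomp_incl _ (by omega)]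
  change P.comp ⟨0, _⟩ _ _ = P.comp ⟨1, _⟩ _ _ at h
  rw [h]
  simp

theorem diffLinear_incl_eq (m : P.Op 1) {p : ℕ} (f : P.Op p) :
    P.diffLinear m (P.incl p f) = P.pcomp 0 (P.incl 1 m) (P.incl p f) +
      (-1 : K) ^ p • P.pcomp 1 (P.incl 1 m) (P.incl p f) -
        (-1 : K) ^ p • P.incl (p + 1) (∑ i : Fin (p + 1), (-1 : K) ^ (i : ℕ) • P.comp i f m) := by
  have hf : P.IsHom (p, P.incl p f) := ⟨f, rfl⟩
  have h := diffLinear_eq m hf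
  rw [h, gdiff_snd, br_snd, br_snd, brs_singleton, brs_singleton, Finset.sum_range,
    Finset.sum_range]
  simp only [ins_apply, mu, zero_add, map_sum, map_smul]
  congr 1
  · refine (Fin.sum_univ_two _).trans ?_
    simp
  · congr 1
    refine Finset.sum_congr rfl fun i _ => ?_
    rw [pcomp_incl _ i.2, one_mul]

theorem incl_injective (p : ℕ) : Function.Injective (P.incl p) :=
  DirectSum.of_injective (β := P.Op) p

end NSOperad

namespace BihomAssocAlgebra

open NSOperad

variable {K : Type*} [Field K] {A : Type*} [AddCommGroup A] [Module K A]
  (B : BihomAssocAlgebra K A)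

/-- The multiplication as an operation of the operad. -/
noncomputable def opMul : B.operad.Op 1 := B.mulCochain

/-- The Hochschild coboundary on the operations of the operad. -/
noncomputable def opHochschild (p : ℕ) : B.operad.Op p →ₗ[K] B.operad.Op (p + 1) := B.hochschild p

/-- Since `|μ| = 1`, the argument left outside is twisted by `β` on the right or by `α` on the left,
each to the first power. Equality is bihom-associativity. -/
theorem comp_opMul : B.operad.comp (p := 1) (q := 1) 0 B.opMul B.opMul =
    B.operad.comp (p := 1) (q := 1) 1 B.opMul B.opMul := by
  apply Subtype.ext
  ext a
  change B.μ (B.μ (a _) (a _)) ((B.β ^ 1) (a _)) = B.μ ((B.α ^ 1) (a _)) (B.μ (a _) (a _))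
  rw [pow_one, pow_one]
  exact (B.assoc _ _ _).symm

theorem isMultiplication : B.operad.IsMultiplication B.opMul :=
  isMultiplication_of_comp_eq (P := B.operad) B.comp_opMul

/-- `μ(α^p a₁, f(a₂, …, a_{p+2}))` as an operation. -/
noncomputable def opLeft {p : ℕ} (f : B.Cochain (p + 1)) : B.operad.Op (p + 1) :=
  ⟨B.hochschildLeft f.1, fun a => by
      change B.α (B.μ _ (f.1 _)) = B.μ _ (f.1 _)
      rw [B.α_mul, f.2.1]
      congr 2
      exact LinearMap.congr_fun ((Commute.refl B.α).pow_right p).eq _,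
    fun a => by
      change B.β (B.μ _ (f.1 _)) = B.μ _ (f.1 _)
      rw [B.β_mul, f.2.2]
      congr 2
      exact LinearMap.congr_fun (B.comm.symm.pow_right p).eq _⟩

/-- `μ(f(a₁, …, a_{p+1}), β^p a_{p+2})` as an operation. -/
noncomputable def opRight {p : ℕ} (f : B.Cochain (p + 1)) : B.operad.Op (p + 1) :=
  ⟨B.hochschildRight f.1, fun a => by
      change B.α (B.μ (f.1 _) _) = B.μ (f.1 _) _
      rw [B.α_mul, f.2.1]
      congr 1
      exact LinearMap.congr_fun (B.comm.pow_right p).eq _,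
    fun a => by
      change B.β (B.μ (f.1 _) _) = B.μ (f.1 _) _
      rw [B.β_mul, f.2.2]
      congr 1
      exact LinearMap.congr_fun ((Commute.refl B.β).pow_right p).eq _⟩

theorem opHochschild_eq {p : ℕ} (f : B.operad.Op p) :
    B.opHochschild p f = B.opLeft f -
      ∑ i : Fin (p + 1), (-1 : K) ^ (i : ℕ) • B.operad.comp i f B.opMul +
        (-1 : K) ^ p • B.opRight f := by
  have h (i : Fin (p + 1)) : (B.operad.comp i f B.opMul).1 = B.hochschildMid f.1 i :=
    MultilinearMap.ext fun a => (B.hochschildMid_aux f.1 i a).symm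
  apply Subtype.ext
  change B.hochschildMap f.1 = B.hochschildLeft f.1 - ((∑ i : Fin (p + 1), (-1 : K) ^ (i : ℕ) •
    (show B.Cochain (p + 1 + 1) from B.operad.comp i f B.opMul) : B.Cochain (p + 1 + 1)) :
      MultilinearMap K (fun _ : Fin (p + 1 + 1) => A) A) + (-1 : K) ^ p • B.hochschildRight f.1
  rw [Submodule.coe_sum, hochschildMap, sub_eq_add_neg, ← Finset.sum_neg_distrib]
  congr 2
  · refine Finset.sum_congr rfl fun i _ => ?_
    rw [pow_succ, mul_neg, mul_one, neg_smul]
    exact congrArg (fun g => -((-1 : K) ^ (i : ℕ) • g)) (h i).symm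
  · rw [pow_add]
    simp

/-- The composite has degree `1 + p` instead of `p + 1`, so the comparison takes place in the direct
sum. -/
theorem pcomp_opMul_zero {p : ℕ} (f : B.operad.Op p) :
    B.operad.pcomp 0 (B.operad.incl 1 B.opMul) (B.operad.incl p f) =
      B.operad.incl (p + 1) (B.opRight f) := by
  rw [pcomp_incl _ (by omega)]
  refine lof_biTwisted_ext (add_comm 1 p) _ _ fun a => ?_
  change B.μ (f.1 fun t => a (0 + t)) ((B.β ^ p) (a (1 + p))) =
    B.μ (f.1 fun t => a t) ((B.β ^ p) (a (p + 1)))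
  simp only [zero_add, add_comm 1 p]

theorem pcomp_opMul_one {p : ℕ} (f : B.operad.Op p) :
    B.operad.pcomp 1 (B.operad.incl 1 B.opMul) (B.operad.incl p f) =
      B.operad.incl (p + 1) (B.opLeft f) := by
  rw [pcomp_incl _ (by omega)]
  refine lof_biTwisted_ext (add_comm 1 p) _ _ fun a => ?_
  change B.μ ((B.α ^ p) (a 0)) (f.1 fun t => a (1 + t)) =
    B.μ ((B.α ^ p) (a 0)) (f.1 fun t => a (t + 1))
  simp only [add_comm]

/-- `m ∘ f` contributes the two outer Hochschild terms and `f ∘ m` the inner ones; the factor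
`(-1)^p` moves from the last term of `δ` to the first. -/
theorem diffLinear_opMul_incl (p : ℕ) (f : B.operad.Op p) :
    B.operad.diffLinear B.opMul (B.operad.incl p f) =
      (-1 : K) ^ p • B.operad.incl (p + 1) (B.opHochschild p f) := by
  rw [opHochschild_eq, diffLinear_incl_eq, pcomp_opMul_zero, pcomp_opMul_one, map_add,
    map_sub, map_smul, smul_add, smul_sub, neg_one_pow_smul_smul]
  abel

/-- Inherited from `d² = 0`, because `d` and `δ` differ by a sign and the inclusion into the total
space is injective. -/
theorem opHochschild_opHochschild {p : ℕ} (f : B.operad.Op p) :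
    B.opHochschild (p + 1) (B.opHochschild p f) = 0 := by
  have h := (homotopyGAlgebra B.isMultiplication).d_d (B.operad.incl p f)
  change B.operad.diffLinear _ (B.operad.diffLinear _ _) = 0 at h
  rw [diffLinear_opMul_incl, map_smul, diffLinear_opMul_incl, smul_smul, ← pow_add] at h
  have h' := (smul_eq_zero.1 h).resolve_left (pow_ne_zero _ (by simp))
  exact incl_injective (P := B.operad) _ (h'.trans (map_zero _).symm)

end BihomAssocAlgebra

/-! ### Operations compatible with the differential. -/

namespace NSOperad

variable {K : Type*} [Field K] {P : NSOperad K}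

theorem IsHom.gbracket {x y : ℕ × P.Total} (hx : P.IsHom x) (hy : P.IsHom y) :
    P.IsHom (gbracket x y) := by
  have h := br_isHom hx (ys := [y]) (by simp [hy])
  have h' := br_isHom hy (ys := [x]) (by simp [hx])
  have e : (br y [x]).1 = x.1 + y.1 := by simp [add_comm]
  unfold IsHom at *
  rw [e] at h'
  exact sub_mem h (Submodule.smul_mem _ _ h')

theorem gbracket_skew (x y : ℕ × P.Total) :
    (gbracket x y).2 = -((-1 : K) ^ (x.1 * y.1) • (gbracket y x).2) := by
  rw [gbracket_snd, gbracket_snd, smul_sub, mul_comm y.1 x.1, neg_one_pow_smul_smul, neg_sub]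

theorem diffLinear_diffLinear {m : P.Op 1} (hm : P.IsMultiplication m) (x : P.Total) :
    P.diffLinear m (P.diffLinear m x) = 0 := (homotopyGAlgebra hm).d_d x

/-- The differential is a derivation of `Φ` up to sign. -/
def IsDerivation (m : P.Op 1) (Φ : P.Total →ₗ[K] P.Total →ₗ[K] P.Total) : Prop :=
  ∀ (p : ℕ) (f : P.Op p), ∃ k : ℕ, ∀ y, P.diffLinear m (Φ (P.incl p f) y) =
    Φ (P.diffLinear m (P.incl p f)) y + (-1 : K) ^ k • Φ (P.incl p f) (P.diffLinear m y)

theorem dotLinear_isDerivation {m : P.Op 1} (hm : P.IsMultiplication m) :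
    IsDerivation m (P.dotLinear m) := by
  refine fun p f => ⟨p + 1, fun y => ?_⟩
  have hx : P.IsHom (p, P.incl p f) := ⟨f, rfl⟩
  induction y using total_induction with
  | h0 => simp
  | ha x y hx hy => simp only [map_add, hx, hy, smul_add]; abel
  | hi q g =>
    have hy : P.IsHom (q, P.incl q g) := ⟨g, rfl⟩
    have h := gdiff_gdot hm.br_eq_zero hx hy
    rw [← diffLinear_eq m (hx.gdot m hy), ← dotLinear_eq m hx hy,
      ← dotLinear_eq m (hx.gdiff m) hy, ← dotLinear_eq m hx (hy.gdiff m), ← diffLinear_eq m hx,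
      ← diffLinear_eq m hy] at h
    exact h

theorem bracketLinear_isDerivation (m : P.Op 1) :
    IsDerivation m P.bracketLinear := by
  refine fun p f => ⟨p, fun y => ?_⟩
  have hx : P.IsHom (p, P.incl p f) := ⟨f, rfl⟩
  induction y using total_induction with
  | h0 => simp
  | ha x y hx hy => simp only [map_add, hx, hy, smul_add]; abel
  | hi q g =>
    have hy : P.IsHom (q, P.incl q g) := ⟨g, rfl⟩
    have h := gdiff_gbracket (m := m) hx hy
    rw [← diffLinear_eq m (hx.gbracket hy), ← bracketLinear_eq hx hy,
      ← bracketLinear_eq (hx.gdiff m) hy, ← bracketLinear_eq hx (hy.gdiff m),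
      ← diffLinear_eq m hx, ← diffLinear_eq m hy] at h
    exact h

/-! ### The cohomology of the complex of an operad with multiplication -/

section Cohomology

/-- The cohomology of the cochain map `δ` modulo the coboundaries `Bd`. -/
abbrev Coh (δ : ∀ p, P.Op p →ₗ[K] P.Op (p + 1)) (Bd : ∀ p, Submodule K (P.Op p)) (p : ℕ) :
    Type _ := LinearMap.ker (δ p) ⧸ (Bd p).submoduleOf (LinearMap.ker (δ p))

/-- The class of a cocycle in the total cohomology. -/
noncomputable abbrev cls {δ : ∀ p, P.Op p →ₗ[K] P.Op (p + 1)} (Bd : ∀ p, Submodule K (P.Op p))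
    {p : ℕ} (f : LinearMap.ker (δ p)) : ⨁ p, Coh δ Bd p :=
  DirectSum.lof K ℕ (Coh δ Bd) p (Submodule.Quotient.mk f)

variable {m : P.Op 1} {δ : ∀ p, P.Op p →ₗ[K] P.Op (p + 1)} {Bd : ∀ p, Submodule K (P.Op p)}

theorem diffLinear_incl_eq_zero_iff
    (hδ : ∀ p f, P.diffLinear m (P.incl p f) = (-1 : K) ^ p • P.incl (p + 1) (δ p f)) {p : ℕ}
    {f : P.Op p} : P.diffLinear m (P.incl p f) = 0 ↔ f ∈ LinearMap.ker (δ p) := by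
  rw [hδ, smul_eq_zero_iff_right (pow_ne_zero _ (by simp)), LinearMap.mem_ker]
  exact map_eq_zero_iff _ (incl_injective _)

theorem exists_diffLinear_eq
    (hδ : ∀ p f, P.diffLinear m (P.incl p f) = (-1 : K) ^ p • P.incl (p + 1) (δ p f))
    (h0 : Bd 0 = ⊥) (hs : ∀ p, Bd (p + 1) = LinearMap.range (δ p)) {p : ℕ} {f : P.Op p}
    (hf : f ∈ Bd p) : ∃ e, P.incl p f = P.diffLinear m e := by
  cases p with
  | zero =>
    rw [h0, Submodule.mem_bot] at hf
    exact ⟨0, by rw [hf, map_zero, map_zero]⟩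
  | succ p =>
    rw [hs] at hf
    obtain ⟨g, rfl⟩ := hf
    exact ⟨(-1 : K) ^ p • P.incl p g, by rw [map_smul, hδ, neg_one_pow_smul_smul]⟩

/-- Over a field, `κ` extends the class map to all cochains by linear retractions onto the cocycles,
and `σ` chooses representatives linearly. A cohomology operation can then be defined bilinearly as
`κ (Φ (σ a) (σ b))`. -/
theorem exists_class_maps (hm : P.IsMultiplication m)
    (hδ : ∀ p f, P.diffLinear m (P.incl p f) = (-1 : K) ^ p • P.incl (p + 1) (δ p f))
    (h0 : Bd 0 = ⊥) (hs : ∀ p, Bd (p + 1) = LinearMap.range (δ p)) :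
    ∃ (κ : P.Total →ₗ[K] ⨁ p, Coh δ Bd p) (σ : (⨁ p, Coh δ Bd p) →ₗ[K] P.Total),
      (∀ (p : ℕ) (f : LinearMap.ker (δ p)), κ (P.incl p f) = cls Bd f) ∧
      (∀ e, κ (P.diffLinear m e) = 0) ∧
      ∀ (p : ℕ) (f : LinearMap.ker (δ p)), ∃ e, σ (cls Bd f) = P.incl p f + P.diffLinear m e := by
  have hρ (p : ℕ) : ∃ ρ : P.Op p →ₗ[K] LinearMap.ker (δ p),
      ρ ∘ₗ Submodule.subtype _ = LinearMap.id :=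
    LinearMap.exists_leftInverse_of_injective _ (Submodule.ker_subtype _)
  have hτ (p : ℕ) : ∃ τ : Coh δ Bd p →ₗ[K] LinearMap.ker (δ p),
      Submodule.mkQ _ ∘ₗ τ = LinearMap.id :=
    LinearMap.exists_rightInverse_of_surjective _ (Submodule.range_mkQ _)
  choose ρ hρ using hρ
  choose τ hτ using hτ
  have hκ (p : ℕ) (f : LinearMap.ker (δ p)) :
      DirectSum.toModule K ℕ (⨁ p, Coh δ Bd p)
        (fun p => DirectSum.lof K ℕ (Coh δ Bd) p ∘ₗ Submodule.mkQ _ ∘ₗ ρ p) (P.incl p f) =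
      cls Bd f := by
    rw [DirectSum.toModule_lof]
    exact congrArg (cls Bd) (LinearMap.congr_fun (hρ p) f)
  refine ⟨DirectSum.toModule K ℕ _ fun p =>
      DirectSum.lof K ℕ (Coh δ Bd) p ∘ₗ Submodule.mkQ _ ∘ₗ ρ p,
    DirectSum.toModule K ℕ _ fun p => P.incl p ∘ₗ Submodule.subtype _ ∘ₗ τ p, hκ, ?_, ?_⟩
  · intro e
    induction e using total_induction with
    | h0 => simp only [map_zero]
    | ha x y hx hy => simp only [map_add, hx, hy, add_zero]
    | hi p f =>
      have hz : δ p f ∈ LinearMap.ker (δ (p + 1)) := by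
        rw [← diffLinear_incl_eq_zero_iff hδ]
        have h := diffLinear_diffLinear hm (P.incl p f)
        rw [hδ, map_smul] at h
        exact (smul_eq_zero.1 h).resolve_left (pow_ne_zero _ (by simp))
      have h := hκ (p + 1) ⟨_, hz⟩
      rw [hδ, map_smul, h, cls, (Submodule.Quotient.mk_eq_zero _).2, map_zero, smul_zero]
      change δ p f ∈ Bd (p + 1)
      rw [hs]
      exact ⟨f, rfl⟩
  · intro p f
    rw [DirectSum.toModule_lof]
    have h : (τ p (Submodule.Quotient.mk f) : P.Op p) - f ∈ Bd p :=
      (Submodule.Quotient.eq ((Bd p).submoduleOf (LinearMap.ker (δ p)))).1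
        (LinearMap.congr_fun (hτ p) (Submodule.Quotient.mk f))
    obtain ⟨e, he⟩ := exists_diffLinear_eq hδ h0 hs h
    refine ⟨e, ?_⟩
    rw [← he, map_sub, add_sub_cancel]
    rfl

/-- Independence of representatives: for cocycles `f` and `w'`, both `Φ(f, d e') = ± d Φ(f, e')` and
`Φ(d e, w') = d Φ(e, w')` hold for homogeneous `e`, and `κ` kills boundaries. -/
theorem IsDerivation.map_eq {Φ : P.Total →ₗ[K] P.Total →ₗ[K] P.Total} (hΦ : IsDerivation m Φ)
    (hm : P.IsMultiplication m) {M : Type*} [AddCommGroup M] [Module K M] {κ : P.Total →ₗ[K] M}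
    (hκ : ∀ e, κ (P.diffLinear m e) = 0) {p : ℕ} {f : P.Op p}
    (hf : P.diffLinear m (P.incl p f) = 0) {w : P.Total} (hw : P.diffLinear m w = 0)
    (e e' : P.Total) :
    κ (Φ (P.incl p f + P.diffLinear m e) (w + P.diffLinear m e')) = κ (Φ (P.incl p f) w) := by
  have h1 : κ (Φ (P.incl p f) (P.diffLinear m e')) = 0 := by
    obtain ⟨k, hk⟩ := hΦ p f
    have h := congrArg κ (hk e')
    rw [hκ, hf, map_zero, LinearMap.zero_apply, zero_add, map_smul] at h
    exact (smul_eq_zero.1 h.symm).resolve_left (pow_ne_zero _ (by simp))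
  have h2 : κ (Φ (P.diffLinear m e) (w + P.diffLinear m e')) = 0 := by
    -- The derivation rule is available only for a homogeneous first argument, so `e` is decomposed.
    induction e using total_induction with
    | h0 => simp
    | ha x y hx hy => simp only [map_add, LinearMap.add_apply] at hx hy ⊢; grind
    | hi q g =>
      obtain ⟨k, hk⟩ := hΦ q g
      have h := congrArg κ (hk (w + P.diffLinear m e'))
      rw [hκ, map_add (P.diffLinear m) w, hw, diffLinear_diffLinear hm, add_zero, map_zero,
        smul_zero, add_zero] at h
      exact h.symm
  rw [map_add Φ, LinearMap.add_apply, map_add κ, h2, add_zero, map_add, map_add, h1, add_zero]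

theorem IsDerivation.exists_cocycle {Φ : P.Total →ₗ[K] P.Total →ₗ[K] P.Total}
    (hΦ : IsDerivation m Φ)
    (hδ : ∀ p f, P.diffLinear m (P.incl p f) = (-1 : K) ^ p • P.incl (p + 1) (δ p f))
    {p q : ℕ} {f : P.Op p} {g : P.Op q} (hf : f ∈ LinearMap.ker (δ p))
    (hg : g ∈ LinearMap.ker (δ q)) {n : ℕ} {x : P.Total} (hx : P.IsHom (n, x))
    (h : Φ (P.incl p f) (P.incl q g) = x) : ∃ h : LinearMap.ker (δ n), P.incl n h = x := by
  obtain ⟨c, hc⟩ := hx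
  change P.incl n c = x at hc
  refine ⟨⟨c, ?_⟩, hc⟩
  obtain ⟨k, hk⟩ := hΦ p f
  rw [← diffLinear_incl_eq_zero_iff hδ, hc, ← h, hk, (diffLinear_incl_eq_zero_iff hδ).2 hf,
    (diffLinear_incl_eq_zero_iff hδ).2 hg, map_zero, map_zero, smul_zero, add_zero,
    LinearMap.zero_apply]

theorem exists_cls_of_mem {i : ℤ} {a : ⨁ p, Coh δ Bd p} (ha : a ∈ succDegree K (Coh δ Bd) i) :
    ∃ (p : ℕ) (f : LinearMap.ker (δ p)), a = cls Bd f ∧ i ≡ ((p : ℤ) + 1) [ZMOD 2] := by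
  obtain ⟨p, c, rfl, h⟩ := exists_lof_of_mem_succDegree ha
  obtain ⟨f, rfl⟩ := Submodule.Quotient.mk_surjective _ c
  exact ⟨p, f, rfl, by push_cast at h; exact h⟩

set_option maxHeartbeats 1000000 in
/-- Operations on cohomology which are represented by the dot product and the bracket of
cocycles form a Gerstenhaber algebra. -/
noncomputable def gerstenhaberAlgebra (hm : P.IsMultiplication m)
    (hδ : ∀ p f, P.diffLinear m (P.incl p f) = (-1 : K) ^ p • P.incl (p + 1) (δ p f))
    {κ : P.Total →ₗ[K] ⨁ p, Coh δ Bd p}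
    (hκ : ∀ (p : ℕ) (f : LinearMap.ker (δ p)), κ (P.incl p f) = cls Bd f)
    (κd : ∀ e, κ (P.diffLinear m e) = 0)
    (M L : (⨁ p, Coh δ Bd p) →ₗ[K] (⨁ p, Coh δ Bd p) →ₗ[K] ⨁ p, Coh δ Bd p)
    (hM : ∀ (p q : ℕ) (f : LinearMap.ker (δ p)) (g : LinearMap.ker (δ q)),
      ∃ h : LinearMap.ker (δ (p + q + 1)),
        (p + q + 1, P.incl (p + q + 1) (h : P.Op (p + q + 1))) =
          gdot m (p, P.incl p (f : P.Op p)) (q, P.incl q (g : P.Op q)) ∧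
        M (cls Bd f) (cls Bd g) = cls Bd h)
    (hL : ∀ (p q : ℕ) (f : LinearMap.ker (δ p)) (g : LinearMap.ker (δ q)),
      ∃ h : LinearMap.ker (δ (p + q)),
        (p + q, P.incl (p + q) (h : P.Op (p + q))) =
          gbracket (p, P.incl p (f : P.Op p)) (q, P.incl q (g : P.Op q)) ∧
        L (cls Bd f) (cls Bd g) = cls Bd h) :
    GerstenhaberAlgebra K (succDegree K (Coh δ Bd)) := by
  have hom (p : ℕ) (f : P.Op p) : P.IsHom (p, P.incl p f) := ⟨f, rfl⟩
  have d0 {p : ℕ} (f : LinearMap.ker (δ p)) : P.diffLinear m (P.incl p f) = 0 :=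
    (diffLinear_incl_eq_zero_iff hδ).2 f.2
  have gd0 {p : ℕ} (f : LinearMap.ker (δ p)) : (gdiff m (p, P.incl p (f : P.Op p))).2 = 0 :=
    (diffLinear_eq m (hom p f)).symm.trans (d0 f)
  have κd' {X : ℕ × P.Total} (hX : P.IsHom X) : κ (gdiff m X).2 = 0 := by
    rw [← diffLinear_eq m hX, κd]
  have cls_eq {p : ℕ} {h : LinearMap.ker (δ p)} {X : ℕ × P.Total}
      (hX : (p, P.incl p (h : P.Op p)) = X) : cls Bd h = κ X.2 := by
    rw [← hX, hκ]
  have deg {i : ℤ} {p : ℕ} (h : i ≡ (p : ℤ) + 1 [ZMOD 2]) : i - 1 ≡ p [ZMOD 2] := by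
    simpa using h.sub_right 1
  refine ⟨M, L, succDegree_isInternal, ?_, ?_, ?_, ?_, ?_, ?_, ?_⟩
  · intro i j a b ha hb
    rcases mem_succDegree ha with rfl | ⟨p, c, rfl, rfl⟩
    · simp
    rcases mem_succDegree hb with rfl | ⟨q, c', rfl, rfl⟩
    · simp
    obtain ⟨f, rfl⟩ := Submodule.Quotient.mk_surjective _ c
    obtain ⟨g, rfl⟩ := Submodule.Quotient.mk_surjective _ c'
    obtain ⟨h, -, hh⟩ := hM p q f g
    rw [hh]
    exact lof_mem_succDegree _ _ (by push_cast; ring)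
  · intro a b c
    induction a using DirectSum.induction_on with
    | zero => simp
    | add x y hx hy => simp only [map_add, LinearMap.add_apply, hx, hy]
    | of p a =>
    induction b using DirectSum.induction_on with
    | zero => simp
    | add x y hx hy => simp only [map_add, LinearMap.add_apply, hx, hy]
    | of q b =>
    induction c using DirectSum.induction_on with
    | zero => simp
    | add x y hx hy => simp only [map_add, hx, hy]
    | of r c =>
    obtain ⟨f, rfl⟩ := Submodule.Quotient.mk_surjective _ a
    obtain ⟨g, rfl⟩ := Submodule.Quotient.mk_surjective _ b
    obtain ⟨h, rfl⟩ := Submodule.Quotient.mk_surjective _ c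
    change M (M (cls Bd f) (cls Bd g)) (cls Bd h) = M (cls Bd f) (M (cls Bd g) (cls Bd h))
    obtain ⟨u, hu, hu'⟩ := hM _ _ f g
    obtain ⟨v, hv, hv'⟩ := hM _ _ g h
    obtain ⟨w, hw, hw'⟩ := hM _ _ u h
    obtain ⟨z, hz, hz'⟩ := hM _ _ f v
    rw [hu', hv', hw', hz', cls_eq hw, cls_eq hz, hu, hv,
      gdot_assoc hm.br_eq_zero (hom _ _) (hom _ _) (hom _ _)]
  · intro i j a b ha hb
    obtain ⟨p, f, rfl, hi⟩ := exists_cls_of_mem ha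
    obtain ⟨q, g, rfl, hj⟩ := exists_cls_of_mem hb
    obtain ⟨u, hu, hu'⟩ := hM _ _ f g
    obtain ⟨v, hv, hv'⟩ := hM _ _ g f
    -- The homotopy term `d(x{y})` disappears under `κ`.
    rw [hu', hv', cls_eq hu, cls_eq hv, gdot_comm_of_cocycle (hom _ _) (hom _ _) (gd0 f) (gd0 g),
      map_add, map_smul, map_smul, κd' (br_isHom (hom _ _) (by simp [hom])), smul_zero, add_zero]
    exact (negOnePow_smul (by push_cast; exact hi.mul hj) _).symm
  · intro i j a b ha hb
    rcases mem_succDegree ha with rfl | ⟨p, c, rfl, rfl⟩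
    · simp
    rcases mem_succDegree hb with rfl | ⟨q, c', rfl, rfl⟩
    · simp
    obtain ⟨f, rfl⟩ := Submodule.Quotient.mk_surjective _ c
    obtain ⟨g, rfl⟩ := Submodule.Quotient.mk_surjective _ c'
    obtain ⟨h, -, hh⟩ := hL p q f g
    rw [hh]
    exact lof_mem_succDegree _ _ (by push_cast; ring)
  · intro i j a b ha hb
    obtain ⟨p, f, rfl, hi⟩ := exists_cls_of_mem ha
    obtain ⟨q, g, rfl, hj⟩ := exists_cls_of_mem hb
    obtain ⟨u, hu, hu'⟩ := hL _ _ f g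
    obtain ⟨v, hv, hv'⟩ := hL _ _ g f
    rw [hu', hv', cls_eq hu, cls_eq hv, gbracket_skew, map_neg, map_smul]
    exact congrArg _ (negOnePow_smul (by push_cast; exact (deg hi).mul (deg hj)) _).symm
  · intro i j k a b c ha hb _
    obtain ⟨p, f, rfl, hi⟩ := exists_cls_of_mem ha
    obtain ⟨q, g, rfl, hj⟩ := exists_cls_of_mem hb
    obtain ⟨r, h, rfl, -⟩ := exists_cls_of_mem ‹c ∈ _›
    obtain ⟨u, hu, hu'⟩ := hL _ _ g h
    obtain ⟨v, hv, hv'⟩ := hL _ _ f u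
    obtain ⟨w, hw, hw'⟩ := hL _ _ f g
    obtain ⟨x, hx, hx'⟩ := hL _ _ w h
    obtain ⟨y, hy, hy'⟩ := hL _ _ f h
    obtain ⟨z, hz, hz'⟩ := hL _ _ g y
    rw [hu', hv', hw', hx', hy', hz', cls_eq hv, cls_eq hx, cls_eq hz, hu, hw, hy,
      gbracket_jacobi (hom _ _) (hom _ _) (hom _ _), map_add, map_smul]
    exact congrArg _ (negOnePow_smul (by push_cast; exact (deg hi).mul (deg hj)) _).symm
  · intro i j k a b c ha hb hc
    obtain ⟨p, f, rfl, hi⟩ := exists_cls_of_mem ha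
    obtain ⟨q, g, rfl, hj⟩ := exists_cls_of_mem hb
    obtain ⟨r, h, rfl, -⟩ := exists_cls_of_mem hc
    obtain ⟨u, hu, hu'⟩ := hM _ _ g h
    obtain ⟨v, hv, hv'⟩ := hL _ _ f u
    obtain ⟨w, hw, hw'⟩ := hL _ _ f g
    obtain ⟨x, hx, hx'⟩ := hM _ _ w h
    obtain ⟨y, hy, hy'⟩ := hL _ _ f h
    obtain ⟨z, hz, hz'⟩ := hM _ _ g y
    -- The defect `d(x{y, z})` of the Leibniz rule disappears under `κ`.
    rw [hu', hv', hw', hx', hy', hz', cls_eq hv, cls_eq hx, cls_eq hz, hu, hw, hy,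
      gbracket_gdot_of_cocycle (hom _ _) (hom _ _) (hom _ _) (gd0 f) (gd0 g) (gd0 h), map_sub,
      map_add, map_smul, map_smul, κd' (br_isHom (hom _ _) (by simp [hom])), smul_zero, sub_zero]
    exact congrArg _ (negOnePow_smul (by push_cast; exact (deg hi).mul hj) _).symm

theorem exists_gerstenhaberAlgebra (hm : P.IsMultiplication m)
    (hδ : ∀ p f, P.diffLinear m (P.incl p f) = (-1 : K) ^ p • P.incl (p + 1) (δ p f))
    (h0 : Bd 0 = ⊥) (hs : ∀ p, Bd (p + 1) = LinearMap.range (δ p)) :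
    ∃ H : GerstenhaberAlgebra K (succDegree K (Coh δ Bd)),
      (∀ (p q : ℕ) (f : LinearMap.ker (δ p)) (g : LinearMap.ker (δ q)),
        ∃ h : LinearMap.ker (δ (p + q + 1)),
          P.incl (p + q + 1) h = P.dot m (P.incl p f) (P.incl q g) ∧
          H.mul (cls Bd f) (cls Bd g) = cls Bd h) ∧
      (∀ (p q : ℕ) (f : LinearMap.ker (δ p)) (g : LinearMap.ker (δ q)),
        ∃ h : LinearMap.ker (δ (p + q)),
          P.incl (p + q) h = P.bracket (P.incl p f) (P.incl q g) ∧
          H.bracket (cls Bd f) (cls Bd g) = cls Bd h) := by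
  obtain ⟨κ, σ, hκ, κd, hσ⟩ := exists_class_maps hm hδ h0 hs
  let M : (⨁ p, Coh δ Bd p) →ₗ[K] (⨁ p, Coh δ Bd p) →ₗ[K] ⨁ p, Coh δ Bd p :=
    ((P.dotLinear m).compl₁₂ σ σ).compr₂ κ
  let L : (⨁ p, Coh δ Bd p) →ₗ[K] (⨁ p, Coh δ Bd p) →ₗ[K] ⨁ p, Coh δ Bd p :=
    (P.bracketLinear.compl₁₂ σ σ).compr₂ κ
  have hom (p : ℕ) (f : P.Op p) : P.IsHom (p, P.incl p f) := ⟨f, rfl⟩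
  have d0 {p : ℕ} (f : LinearMap.ker (δ p)) : P.diffLinear m (P.incl p f) = 0 :=
    (diffLinear_incl_eq_zero_iff hδ).2 f.2
  have hM (p q : ℕ) (f : LinearMap.ker (δ p)) (g : LinearMap.ker (δ q)) :
      ∃ h : LinearMap.ker (δ (p + q + 1)),
        (p + q + 1, P.incl (p + q + 1) (h : P.Op (p + q + 1))) =
          gdot m (p, P.incl p (f : P.Op p)) (q, P.incl q (g : P.Op q)) ∧
        M (cls Bd f) (cls Bd g) = cls Bd h := by
    have e := dotLinear_eq m (hom p f) (hom q g)
    obtain ⟨h, hh⟩ := (dotLinear_isDerivation hm).exists_cocycle hδ f.2 g.2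
      (n := p + q + 1) ((hom p f).gdot m (hom q g)) e
    refine ⟨h, Prod.ext rfl hh, ?_⟩
    obtain ⟨u, hu⟩ := hσ p f
    obtain ⟨v, hv⟩ := hσ q g
    rw [← hκ _ h]
    change κ (P.dotLinear m (σ _) (σ _)) = κ (P.incl _ _)
    -- `σ` returns `f` and `g` only up to boundaries, and `map_eq` discards these.
    rw [hu, hv, (dotLinear_isDerivation hm).map_eq hm κd (d0 f) (d0 g)]
    exact congrArg κ (e.trans hh.symm)
  have hL (p q : ℕ) (f : LinearMap.ker (δ p)) (g : LinearMap.ker (δ q)) :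
      ∃ h : LinearMap.ker (δ (p + q)),
        (p + q, P.incl (p + q) (h : P.Op (p + q))) =
          gbracket (p, P.incl p (f : P.Op p)) (q, P.incl q (g : P.Op q)) ∧
        L (cls Bd f) (cls Bd g) = cls Bd h := by
    have e := bracketLinear_eq (hom p f) (hom q g)
    obtain ⟨h, hh⟩ := (bracketLinear_isDerivation m).exists_cocycle hδ f.2 g.2
      (n := p + q) ((hom p f).gbracket (hom q g)) e
    refine ⟨h, Prod.ext rfl hh, ?_⟩
    obtain ⟨u, hu⟩ := hσ p f
    obtain ⟨v, hv⟩ := hσ q g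
    rw [← hκ _ h]
    change κ (P.bracketLinear (σ _) (σ _)) = κ (P.incl _ _)
    rw [hu, hv, (bracketLinear_isDerivation m).map_eq hm κd (d0 f) (d0 g)]
    exact congrArg κ (e.trans hh.symm)
  refine ⟨gerstenhaberAlgebra hm hδ hκ κd M L hM hL, ?_, ?_⟩
  · intro p q f g
    obtain ⟨h, hh, hh'⟩ := hM p q f g
    refine ⟨h, ?_, hh'⟩
    rw [← dotLinear_apply]
    exact (congrArg Prod.snd hh).trans (dotLinear_eq m (hom p f) (hom q g)).symm
  · intro p q f g
    obtain ⟨h, hh, hh'⟩ := hL p q f g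
    refine ⟨h, ?_, hh'⟩
    rw [← bracketLinear_apply]
    exact (congrArg Prod.snd hh).trans (bracketLinear_eq (hom p f) (hom q g)).symm

end Cohomology

end NSOperad

/-! ### The theorem for bihom-associative algebras. -/

theorem mainTheorem1 {K : Type*} [Field K] [CharZero K] {A : Type*} [AddCommGroup A] [Module K A]
    (B : BihomAssocAlgebra K A) :
    -- `μ` is a multiplication on the bi-twisted endomorphism operad
    B.operad.IsMultiplication B.mulCochain ∧
    -- the differential it induces is the Hochschild coboundary up to sign
    (∀ (p : ℕ) (f : B.Cochain (p + 1)),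
      B.operad.diff B.mulCochain (B.incl p f) = (-1 : K) ^ p • B.incl (p + 1) (B.hochschild p f)) ∧
    (∀ (p : ℕ) (f : B.Cochain (p + 1)), B.hochschild (p + 1) (B.hochschild p f) = 0) ∧
    -- the homotopy G-algebra structure on the Hochschild cochains
    (∃ G : HomotopyGAlgebra K B.operad.degree,
      (∀ (n : ℕ) (x : B.operad.Total) (y : Fin n → B.operad.Total),
        G.brace n x y = B.operad.brace x y) ∧
      (∀ x y : B.operad.Total, G.dot x y = B.operad.dot B.mulCochain x y) ∧
      (∀ x : B.operad.Total, G.d x = B.operad.diff B.mulCochain x)) ∧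
    -- the Gerstenhaber algebra structure which it induces on the Hochschild cohomology
    (∃ H : GerstenhaberAlgebra K (succDegree K B.Cohomology),
      (∀ (p q : ℕ) (f : B.Cocycles p) (g : B.Cocycles q), ∃ h : B.Cocycles (p + q + 1),
        B.incl (p + q + 1) h = B.operad.dot B.mulCochain (B.incl p f) (B.incl q g) ∧
        H.mul (B.cohomologyClass f) (B.cohomologyClass g) = B.cohomologyClass h) ∧
      (∀ (p q : ℕ) (f : B.Cocycles p) (g : B.Cocycles q), ∃ h : B.Cocycles (p + q),
        B.incl (p + q) h = B.operad.bracket (B.incl p f) (B.incl q g) ∧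
        H.bracket (B.cohomologyClass f) (B.cohomologyClass g) = B.cohomologyClass h)) := by
  refine ⟨B.isMultiplication, fun p f => ?_, fun p f => B.opHochschild_opHochschild f,
    ⟨NSOperad.homotopyGAlgebra B.isMultiplication, fun _ _ _ => rfl,
      B.operad.dotLinear_apply B.opMul, B.operad.diffLinear_apply B.opMul⟩, ?_⟩
  · exact (B.operad.diffLinear_apply B.opMul _).symm.trans (B.diffLinear_opMul_incl p f)
  -- The two descriptions of `Coboundaries`, zero in degree `1` and the range of `δ` above it, hold
  -- by definition.
  · exact NSOperad.exists_gerstenhaberAlgebra (P := B.operad) (m := B.opMul)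
      (δ := B.opHochschild) (Bd := B.Coboundaries) B.isMultiplication B.diffLinear_opMul_incl rfl
      fun _ => rfl
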